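/- Let $F$ be a non-Archimedean local field whose residue field $k_F$ has $q$ elements and characteristic $p=2$, and let $D$ be a quaternion division algebra over $F$ (central of dimension $4$) with reduced norm $\mathrm{Nrd}$. Put $v_D=v_F\circ\mathrm{Nrd}$ and $U_D^m=1+\mathfrak q^m$ for $m\ge 1$, where $\mathfrak q^m=\{x\in D\mid x=0\text{ or }v_D(x)\ge m\}$. Characters and representations are smooth, over $\overline{\mathbb Q}_2$, or over $\overline{\mathbb F}_2$ when called "mod $2$"; $\mathrm{Ind}$ is smooth induction. Let $n\ge 1$ be an odd integer, $E/F$ a totally ramified quadratic extension with an $F$-embedding $E\to D$, and $\chi$ a character of $E^\times U_D^{(n+1)/2}$. Assume that $\Pi\cong\mathrm{Ind}_{E^\times U_D^{(n+1)/2}}^{D^\times}\chi$ is irreducible of dimension greater than one and not tamely ramified, i.e. there is no non-trivial unramified character $\Phi'$ of $F^\times$ with $(\Phi'\circ\mathrm{Nrd})\otimes\Pi\cong\Pi$. Let $\Phi$ be the central character of $\Pi$. A finite-dimensional representation $V$ over $\overline{\mathbb Q}_2$ of a group is called $2$-integral if it can be realized over a finite extension $K/\mathbb Q_2$ so that the realization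 contains a stable lattice $\Lambda$ over the ring of integers $A$ of $K$. Its reduction is then the semisimplification of $\Lambda/\mathfrak m\Lambda$, with $\mathfrak m$ the maximal ideal of $A$, regarded as a representation over $\overline{\mathbb F}_2$; for a character $\chi$ it is denoted $\overline\chi$. Then $\Pi$ is $2$-integral if and only if $\Phi$ is $2$-integral, and if and only if $\chi$ is $2$-integral. Assume moreover that $\Pi$ is $2$-integral. Then $\overline\Phi=\overline\chi|_{F^\times}$; there is an extension $\overline\chi^{\ddagger}$ of $\overline\chi$ to $E^\times U_D^1$ that is trivial on $U_D^1$; and there is exactly one mod $2$ character $\tilde\chi$ of $D^\times$ extending $\overline\Phi$, which is also the only mod $2$ character of $D^\times$ extending $\overline\chi^{\ddagger}$. Let $I_1$ be the set of isomorphism classes of two-dimensional irreducible mod $2$ representations of $D^\times$ with central character $\overline\Phi$. Then $I_1$ is finite and, for every choice of $K$ and of a stable lattice in $\Pi$, the reduction $\overline\Pi^{\mathrm{ss}}$ satisfies $$\overline\Pi^{\mathrm{ss}}\cong\Bigl(\mathrm{Ind}_{E^\times U_D^1}^{D^\times}\overline\chi^{\ddagger}\Bigr)^{\oplus q^{(n-1)/2}}\cong\Bigl(\bigoplus_{\pi\in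 I_1}\pi^{\oplus q^{(n-1)/2}}\Bigr)\oplus\tilde\chi^{\,\oplus q^{(n-1)/2}}.$$ -/

import Mathlib

open scoped ValuativeRel TensorProduct MonoidAlgebra

noncomputable section

namespace QuatRed

/-! ### Coefficients: `ℚ̄_p`, its ring of integers `ℤ̄_p`, and its residue field `𝔽̄_p` -/

section Coefficients

variable (p : ℕ) [Fact p.Prime]

/-- The ring of integers `ℤ̄_p` of `ℚ̄_p`. -/
abbrev IntBar : ValuationSubring (PadicAlgCl p) := (PadicAlgCl.valued p).v.valuationSubring

/-- `𝔽̄_p`, realised as the residue field of `ℚ̄_p`. -/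
abbrev FpBar : Type := IsLocalRing.ResidueField (IntBar p)

/-- The ring of integers `A = K ∩ ℤ̄_p` of an intermediate field `ℚ_p ⊆ K ⊆ ℚ̄_p`. -/
def ringOfInt (K : IntermediateField ℚ_[p] (PadicAlgCl p)) : Subring (PadicAlgCl p) :=
  (IntBar p).toSubring ⊓ K.toSubfield.toSubring

/-- The reduction map `A → ℤ̄_p → 𝔽̄_p`. It factors through the residue field `A/𝔪` of `K`. -/
def ringOfInt.reduce (K : IntermediateField ℚ_[p] (PadicAlgCl p)) : ringOfInt p K →+* FpBar p :=
  (IsLocalRing.residue (IntBar p)).comp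
    (Subring.inclusion (inf_le_left : ringOfInt p K ≤ (IntBar p).toSubring))

instance (K : IntermediateField ℚ_[p] (PadicAlgCl p)) : Algebra (ringOfInt p K) (FpBar p) :=
  (ringOfInt.reduce p K).toAlgebra

end Coefficients

/-! ### Representations: characters, integrality, reduction, semisimplification -/

section Representations

variable {G : Type*} [Group G]

/-- The one-dimensional representation attached to a character. -/
def charRep {C : Type*} [Field C] (χ : G →* Cˣ) : Representation C G C where
  toFun g := (χ g : C) • LinearMap.id
  map_one' := by ext; simp
  map_mul' g h := by ext; simp [mul_comm]

variable (p : ℕ) [Fact p.Prime]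
variable {V : Type*} [AddCommGroup V] [Module (PadicAlgCl p) V]

/-- A stable lattice in a finite-dimensional representation `V` over `ℚ̄_p`: a finite extension
`K` of `ℚ_p` inside `ℚ̄_p`, with ring of integers `A`, and a `G`-stable `A`-submodule `Λ` of `V`
which is spanned over `A` by a `ℚ̄_p`-basis of `V`. Then `KΛ` is a realization of `V` over `K` and
`Λ` is a stable `A`-lattice in it. -/
structure StableLattice (ρ : Representation (PadicAlgCl p) G V) where
  K : IntermediateField ℚ_[p] (PadicAlgCl p)
  finite : FiniteDimensional ℚ_[p] K
  Λ : Submodule (ringOfInt p K) V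
  lattice : ∃ (d : ℕ) (b : Module.Basis (Fin d) (PadicAlgCl p) V),
    Λ = Submodule.span (ringOfInt p K) (Set.range b)
  stable : ∀ g : G, ∀ v ∈ Λ, ρ g v ∈ Λ

/-- A representation over `ℚ̄_p` is `p`-integral if it has a stable lattice. -/
def IsPIntegral (ρ : Representation (PadicAlgCl p) G V) : Prop :=
  Nonempty (StableLattice p ρ)

variable {p}

/-- The action of `G` on a stable lattice. -/
def StableLattice.rep {ρ : Representation (PadicAlgCl p) G V} (L : StableLattice p ρ) :
    Representation (ringOfInt p L.K) G L.Λ where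
  toFun g := ((ρ g).restrictScalars (ringOfInt p L.K)).restrict (L.stable g)
  map_one' := by ext; simp [LinearMap.restrict_apply]
  map_mul' g h := by
    refine LinearMap.ext fun x => Subtype.ext ?_
    exact congrArg (fun f : V →ₗ[PadicAlgCl p] V => f x) (map_mul ρ g h)

/-- The representation of `G` on `𝔽̄_p ⊗_A Λ = 𝔽̄_p ⊗_{A/𝔪} Λ/𝔪Λ`. -/
def StableLattice.reduction {ρ : Representation (PadicAlgCl p) G V} (L : StableLattice p ρ) :
    Representation (FpBar p) G (FpBar p ⊗[ringOfInt p L.K] L.Λ) where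
  toFun g := (L.rep g).baseChange (FpBar p)
  map_one' := by rw [map_one]; exact LinearMap.baseChange_id
  map_mul' g h := by rw [map_mul]; exact LinearMap.baseChange_mul _ _

/-- `χbar` is the reduction of the character `χ`, whose values are integral. -/
def IsReductionOfChar (χ : G →* (PadicAlgCl p)ˣ) (χbar : G →* (FpBar p)ˣ) : Prop :=
  ∀ g : G, ∃ a : IntBar p,
    (a : PadicAlgCl p) = χ g ∧ IsLocalRing.residue (IntBar p) a = χbar g

/-- `τ` is the semisimplification of `ρ`: the direct sum of the successive quotients of a
composition series of `ρ`. -/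
def IsSemisimplification {C V W : Type*} [Field C] [AddCommGroup V] [Module C V] [AddCommGroup W]
    [Module C W] (ρ : Representation C G V) (τ : Representation C G W) : Prop :=
  ∃ s : CompositionSeries (Submodule C[G] ρ.asModule),
    s.head = ⊥ ∧ s.last = ⊤ ∧
      Nonempty (τ.asModule ≃ₗ[C[G]]
        (Π i : Fin s.length,
          (s i.succ : Submodule C[G] ρ.asModule) ⧸
            (s i.castSucc : Submodule C[G] ρ.asModule).submoduleOf (s i.succ)))

end Representations

/-! ### The quaternion algebra -/

section ReducedNorm

variable (F : Type*) [Field F] (D : Type*) [DivisionRing D] [Algebra F D]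

variable {D} in
/-- The reduced norm of the quaternion division algebra `D`: the constant coefficient of the
reduced characteristic polynomial, which has degree two and is a power of the minimal polynomial. -/
def nrd (x : D) : F := (minpoly F x).coeff 0 ^ (2 / (minpoly F x).natDegree)

theorem nrd_conj (g : Dˣ) (x : D) : nrd F ((g : D) * x * ((g⁻¹ : Dˣ) : D)) = nrd F x := by
  have h : minpoly F ((g : D) * x * ((g⁻¹ : Dˣ) : D)) = minpoly F x := by
    have := minpoly.algEquiv_eq (MulSemiringAction.toAlgEquiv F D (ConjAct.toConjAct g)) x
    simpa [ConjAct.units_smul_def] using this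
  rw [nrd, nrd, h]

end ReducedNorm

section Quaternion

variable (F : Type*) [Field F] [ValuativeRel F] [TopologicalSpace F] [IsNonarchimedeanLocalField F]

/-- `E/F` is a totally ramified quadratic extension: `[E : F] = 2` and `𝔭_F 𝔬_E = 𝔭_E ^ 2`, where
`𝔬_E` is the integral closure of `𝔬_F` in `E` (a discrete valuation ring) and `𝔭_E` is its maximal
ideal. -/
def IsTotallyRamifiedQuadratic (E : Type*) [Field E] [Algebra F E] : Prop :=
  Module.finrank F E = 2 ∧
    ∃ P : Ideal (integralClosure 𝒪[F] E), P.IsMaximal ∧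
      (𝓂[F]).map (algebraMap 𝒪[F] (integralClosure 𝒪[F] E)) = P ^ 2

variable (D : Type*) [DivisionRing D] [Algebra F D]

/-- `U_D^n = 1 + 𝔮^n` for `n ≥ 1`, where `𝔮^n = {x | v_F (Nrd x) ≥ n} = {x | Nrd x ∈ 𝔭_F^n}`.
The elements `u` with `u - 1 ∈ 𝔮^n` already form a subgroup of `Dˣ`, so that taking the generated
subgroup adds no element. -/
def congrSubgroup (n : ℕ) : Subgroup Dˣ :=
  Subgroup.closure {u : Dˣ | ∃ a : 𝒪[F], a ∈ 𝓂[F] ^ n ∧ (a : F) = nrd F ((u : D) - 1)}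

theorem congrSubgroup_anti {m n : ℕ} (h : m ≤ n) : congrSubgroup F D n ≤ congrSubgroup F D m :=
  Subgroup.closure_mono fun _ ⟨a, ha, h'⟩ => ⟨a, Ideal.pow_le_pow_right h ha, h'⟩

theorem conj_mem_congrSubgroup (n : ℕ) (g : Dˣ) {u : Dˣ} (hu : u ∈ congrSubgroup F D n) :
    g * u * g⁻¹ ∈ congrSubgroup F D n := by
  induction hu using Subgroup.closure_induction with
  | mem u hu =>
    obtain ⟨a, ha, h⟩ := hu
    refine Subgroup.subset_closure ⟨a, ha, ?_⟩
    rw [h, ← nrd_conj F D g]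
    congr 1
    simp [mul_sub, sub_mul]
  | one => simp
  | mul u v _ _ hu hv => simpa [mul_assoc] using mul_mem hu hv
  | inv u _ hu => simpa [mul_assoc] using inv_mem hu

/-- The subgroup `E^× U_D^k` of `D^×`, for an `F`-embedding `E → D`. -/
def EU {E : Type*} [Field E] [Algebra F E] (ι : E →ₐ[F] D) (k : ℕ) : Subgroup Dˣ :=
  (Units.map (ι : E →* D)).range ⊔ congrSubgroup F D k

theorem one_le_half_succ {n : ℕ} (hn : Odd n) : 1 ≤ (n + 1) / 2 := by
  obtain ⟨j, rfl⟩ := hn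
  omega

theorem EU_anti {E : Type*} [Field E] [Algebra F E] (ι : E →ₐ[F] D) {k l : ℕ} (h : k ≤ l) :
    EU F D ι l ≤ EU F D ι k :=
  sup_le_sup_left (congrSubgroup_anti F D h) _

/-- The inclusion `F^× → D^×` of the centre. -/
def central : Fˣ →* Dˣ := Units.map (algebraMap F D : F →* D)

theorem central_mem {E : Type*} [Field E] [Algebra F E] (ι : E →ₐ[F] D) (k : ℕ) (a : Fˣ) :
    central F D a ∈ EU F D ι k :=
  Subgroup.mem_sup_left ⟨Units.map (algebraMap F E : F →* E) a, by ext; simp [central]⟩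

/-- The inclusion `F^× → E^× U_D^k`. -/
def centralEU {E : Type*} [Field E] [Algebra F E] (ι : E →ₐ[F] D) (k : ℕ) : Fˣ →* EU F D ι k :=
  (central F D).codRestrict _ (central_mem F D ι k)

/-- A character of a subgroup of `D^×` is smooth if it is trivial on some `U_D^m`
(the groups `U_D^m` form a basis of neighbourhoods of `1` in `D^×`). -/
def IsSmoothChar {C : Type*} [Field C] (H : Subgroup Dˣ) (χ : H →* Cˣ) : Prop :=
  ∃ m : ℕ, ∀ h : H, (h : Dˣ) ∈ congrSubgroup F D m → χ h = 1

variable {D}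

/-- A representation of `D^×` is smooth if every vector is fixed by some `U_D^m`. -/
def IsSmoothRep {C V : Type*} [Field C] [AddCommGroup V] [Module C V]
    (ρ : Representation C Dˣ V) : Prop :=
  ∀ v : V, ∃ m : ℕ, ∀ u ∈ congrSubgroup F D m, ρ u v = v

variable (D)

/-- The space of the smooth induction of a character `χ` of `H ≤ D^×`: functions `f` on `D^×` with
`f (h x) = χ h * f x`, invariant under right translation by some `U_D^m`. -/
def smoothIndSpace {C : Type*} [Field C] (H : Subgroup Dˣ) (χ : H →* Cˣ) :
    Submodule C (Dˣ → C) where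
  carrier := {f | (∀ (h : H) (x : Dˣ), f (h * x) = χ h * f x) ∧
    ∃ m : ℕ, ∀ u ∈ congrSubgroup F D m, ∀ x : Dˣ, f (x * u) = f x}
  zero_mem' := ⟨by simp, 0, by simp⟩
  add_mem' := by
    rintro f f' ⟨hf, m, hm⟩ ⟨hf', m', hm'⟩
    refine ⟨fun h x => by simp [hf, hf', mul_add], max m m', fun u hu x => ?_⟩
    simp [hm u (congrSubgroup_anti F D (le_max_left _ _) hu),
      hm' u (congrSubgroup_anti F D (le_max_right _ _) hu)]
  smul_mem' := by
    rintro c f ⟨hf, m, hm⟩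
    exact ⟨fun h x => by simp [hf, mul_left_comm], m, fun u hu x => by simp [hm u hu]⟩

/-- The smooth induction `Ind_H^{D^×} χ`: the group `D^×` acts by right translation. -/
def smoothInd {C : Type*} [Field C] (H : Subgroup Dˣ) (χ : H →* Cˣ) :
    Representation C Dˣ (smoothIndSpace F D H χ) where
  toFun g := (LinearMap.funLeft C C (fun x : Dˣ => x * g)).restrict (by
    rintro f ⟨hf, m, hm⟩
    refine ⟨fun h x => by simp [LinearMap.funLeft_apply, mul_assoc, hf], m, fun u hu x => ?_⟩
    have := hm _ (conj_mem_congrSubgroup F D m g⁻¹ hu) (x * g)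
    simpa [LinearMap.funLeft_apply, mul_assoc] using this)
  map_one' := by
    ext f x
    simp [LinearMap.funLeft_apply]
  map_mul' g h := by
    ext f x
    simp [LinearMap.funLeft_apply, mul_assoc]

variable {D}

/-- `F^×` acts on the representation through the character `Φ`. -/
def HasCentralChar {C V : Type*} [Field C] [AddCommGroup V] [Module C V]
    (ρ : Representation C Dˣ V) (Φ : Fˣ →* Cˣ) : Prop :=
  ∀ (a : Fˣ) (v : V), ρ (central F D a) v = (Φ a : C) • v

/-- A representation `ρ` of `D^×` is unramified if `(Φ ∘ Nrd) ⊗ ρ ≅ ρ` for some non-trivial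
unramified character `Φ` of `F^×` (one that is trivial on the units of `𝔬_F`). -/
def IsUnramifiedRep {C V : Type*} [Field C] [AddCommGroup V] [Module C V]
    (ρ : Representation C Dˣ V) : Prop :=
  ∃ Φ : Fˣ →* Cˣ, Φ ≠ 1 ∧ (∀ u : Fˣ, ValuativeRel.valuation F (u : F) = 1 → Φ u = 1) ∧
    ∃ T : V ≃ₗ[C] V, ∀ (g : Dˣ) (a : Fˣ), (a : F) = nrd F (g : D) →
      ∀ v : V, T ((Φ a : C) • ρ g v) = ρ g (T v)

/-- A representation of `D^×` is tamely ramified if the residue characteristic of `F` is odd or the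
representation is unramified. -/
def IsTamelyRamifiedRep {C V : Type*} [Field C] [AddCommGroup V] [Module C V]
    (ρ : Representation C Dˣ V) : Prop :=
  ringChar 𝓀[F] ≠ 2 ∨ IsUnramifiedRep F ρ

/-- `π 0, …, π (m - 1)` are representatives, each exactly once, of the isomorphism classes of
two-dimensional smooth irreducible representations of `D^×` over `C` with central character `Φ`. -/
structure IsSystemOfTwoDimReps {C : Type} [Field C] (Φ : Fˣ →* Cˣ) {m : ℕ}
    (π : Fin m → Representation C Dˣ (Fin 2 → C)) : Prop where
  smooth : ∀ i, IsSmoothRep F (π i)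
  irreducible : ∀ i, (π i).IsIrreducible
  central : ∀ i, HasCentralChar F (π i) Φ
  injective : ∀ i j, Nonempty ((π i).Equiv (π j)) → i = j
  exhaustive : ∀ (W : Type) [AddCommGroup W] [Module C W] (τ : Representation C Dˣ W),
    Module.finrank C W = 2 → IsSmoothRep F τ → τ.IsIrreducible → HasCentralChar F τ Φ →
      ∃ i, Nonempty (τ.Equiv (π i))

end Quaternion

/-- The direct sum of `N` copies of a representation. -/
abbrev copies {C G V : Type*} [Field C] [Group G] [AddCommGroup V] [Module C V] (N : ℕ)
    (ρ : Representation C G V) : Representation C G (DirectSum (Fin N) fun _ => V) :=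
  Representation.directSum fun _ => ρ

end QuatRed

end

/-!
The proof reduces everything to representations of a finite dihedral group in characteristic two.

Put `Z = F^× U_D^1`, the subgroup `centreU F D`. Since the residue field of `D` is the quadratic
extension of the residue field of `F`, and conjugation by a uniformizer induces its Frobenius, the
group `D^× / Z` is dihedral of order `2 (q + 1)` (`exists_isDihedralMod`): a generator of the
multiplicative group of the residue field gives a rotation `θ` of odd order `r = q + 1`, a
uniformizer `w` of `E` a reflection. Every `E^× U_D^k` with `k ≥ 1` has image `{1, w}` in
`D^× / Z`, so that `E^× U_D^1` has index `r`, and `E^× U_D^k` has index `q ^ (k - 1)` in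
`E^× U_D^1` (`relIndex_EU`). After replacing `θ` by a `2`-power of itself, `θ ^ r` is the product of
a central element `a` and an element on which `Π` is trivial, and `θ ^ r` acts on `Π` by the scalar
`Φ(a)`.

*Eigenvalues on `Π`.* On a representation induced from `E^× U_D^k`, multiplication by a function
on the cosets that transforms through an `r`-th root of unity permutes the eigenspaces of `θ`
transitively. Hence every solution of `l ^ r = Φ(a)` is an eigenvalue of multiplicity
`N = q ^ ((n - 1) / 2)` on `Π` (`finrank_eigenspace_smoothInd`), and the characteristic polynomial
of `θ` is `(X ^ r - Φ(a)) ^ N`. The characteristic polynomial of `θ` on the reduction of any stable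
lattice is the reduction of this one (`StableLattice.charpoly_reduction`).

*Characteristic two.* A mod `2` representation that is irreducible and smooth is trivial on the
pro-`2`-group `U_D^1`, because commuting involutions in characteristic two have a common fixed
vector (`congrSubgroup_one_trivial`). Square roots are unique, so that a mod `2` character of `D^×`
is determined by its restriction to the centre; it exists because the norm of the left regular
representation is the fourth power on the centre (`exists_extension_central`). Twisting by this
character `ψ`, irreducible representations with the given central character become irreducible
representations of the dihedral group. Up to the twist, `w` exchanges the eigenspaces of `θ` for `l`
and `ψ(θ)² / l`, and acts trivially on the remaining one: these are the representations
`IsDihedralRep`. They are determined up to isomorphism by the dimensions of the eigenspaces of `θ`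
(`nonempty_equiv_of_finrank_eigenspace`), and so is the semisimplification of a representation all
of whose composition factors are of this form (`isSemisimplification_of_finrank_eigenspace`).

All three sides of the isomorphism to be proved are therefore compared by counting eigenvalues. The
representation induced from `E^× U_D^1` has each root of `X ^ r - ψ(θ) ^ r` as an eigenvalue of
multiplicity one; the two-dimensional irreducible representations correspond to the pairs
`l ≠ ψ(θ)² / l`, and the character `ψ` to the remaining root `ψ(θ)`
(`exists_system_two_dimensional`).

*Integrality.* A stable lattice in `Π` is preserved by the centre, which gives the integrality of
`Φ`. Conversely the values of `χ` are, up to the value at `w`, products of values of `Φ` and roots of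
unity of bounded `2`-power order (`isPIntegral_char_of_central`), and an induced representation of
an integral character has the lattice of integral functions (`isPIntegral_of_equiv_smoothInd`).
-/

open scoped ValuativeRel TensorProduct MonoidAlgebra

noncomputable section

namespace QuatRed

/-! ### The normalised valuation of `F` -/

section BaseField

open WithZero Polynomial

variable (F : Type*) [Field F] [ValuativeRel F] [TopologicalSpace F] [IsNonarchimedeanLocalField F]

/-- The normalised valuation of `F`, written multiplicatively: `vF F x = exp (-v_F x)`, with value
`0` at `0`. -/
def vF : Valuation F ℤᵐ⁰ :=
  (ValuativeRel.valuation F).map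
    { toFun := IsNonarchimedeanLocalField.valueGroupWithZeroIsoInt F
      map_zero' := map_zero _
      map_one' := map_one _
      map_mul' := map_mul _ }
    (IsNonarchimedeanLocalField.valueGroupWithZeroIsoInt F).strictMono.monotone

variable {F}

theorem vF_apply (x : F) : vF F x =
    IsNonarchimedeanLocalField.valueGroupWithZeroIsoInt F (ValuativeRel.valuation F x) := rfl

theorem vF_le_one_iff {x : F} : vF F x ≤ 1 ↔ ValuativeRel.valuation F x ≤ 1 := by
  rw [vF_apply, ← map_one (IsNonarchimedeanLocalField.valueGroupWithZeroIsoInt F)]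
  exact (IsNonarchimedeanLocalField.valueGroupWithZeroIsoInt F).strictMono.le_iff_le

theorem vF_lt_one_iff {x : F} : vF F x < 1 ↔ ValuativeRel.valuation F x < 1 := by
  rw [vF_apply, ← map_one (IsNonarchimedeanLocalField.valueGroupWithZeroIsoInt F)]
  exact (IsNonarchimedeanLocalField.valueGroupWithZeroIsoInt F).strictMono.lt_iff_lt

theorem vF_surjective (γ : ℤᵐ⁰) : ∃ x : F, vF F x = γ := by
  obtain ⟨δ, rfl⟩ := (IsNonarchimedeanLocalField.valueGroupWithZeroIsoInt F).surjective γ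
  obtain ⟨x, rfl⟩ := ValuativeRel.valuation_surjective δ
  exact ⟨x, rfl⟩

theorem mem_integer_iff {x : F} : x ∈ 𝒪[F] ↔ vF F x ≤ 1 := vF_le_one_iff.symm

theorem mem_maximalIdeal_iff (a : 𝒪[F]) : a ∈ 𝓂[F] ↔ vF F a < 1 := by
  rw [vF_lt_one_iff, IsLocalRing.mem_maximalIdeal, mem_nonunits_iff,
    Valuation.integer.integers (ValuativeRel.valuation F) |>.isUnit_iff_valuation_eq_one]
  exact ⟨fun h => lt_of_le_of_ne a.2 h, fun h => h.ne⟩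

theorem lt_one_iff_le_exp (γ : ℤᵐ⁰) : γ < 1 ↔ γ ≤ exp (-1) := by
  induction γ using expRecOn with
  | zero => simp
  | exp a =>
    rw [← exp_zero, exp_lt_exp, exp_le_exp]
    omega

theorem mem_maximalIdeal_pow_iff (a : 𝒪[F]) (n : ℕ) : a ∈ 𝓂[F] ^ n ↔ vF F a ≤ exp (-(n : ℤ)) := by
  obtain ⟨t, ht⟩ := vF_surjective (F := F) (exp (-1))
  have ht1 : vF F t < 1 := by rw [lt_one_iff_le_exp, ht]
  have ht0 : t ≠ 0 := by rintro rfl; exact exp_ne_zero (ht.symm.trans (map_zero _))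
  let t' : 𝒪[F] := ⟨t, mem_integer_iff.2 ht1.le⟩
  have key (m : ℕ) (c : 𝒪[F]) : c ∈ Ideal.span {t' ^ m} ↔ vF F c ≤ exp (-(m : ℤ)) := by
    have hm : vF F (t ^ m) = exp (-(m : ℤ)) := by
      rw [map_pow, ht, ← exp_nsmul]; simp
    rw [Ideal.mem_span_singleton, ← hm]
    constructor
    · rintro ⟨d, rfl⟩
      have : vF F d ≤ 1 := mem_integer_iff.1 d.2
      simpa [t'] using mul_le_of_le_one_right' this
    · intro h
      have h0 : t ^ m ≠ 0 := pow_ne_zero _ ht0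
      refine ⟨⟨(c : F) / t ^ m, mem_integer_iff.2 ?_⟩, Subtype.ext ?_⟩
      · rw [map_div₀]
        exact div_le_one_of_le₀ h zero_le
      · simp [t', mul_div_cancel₀ _ h0]
  have hmax : 𝓂[F] = Ideal.span {t'} := by
    ext c
    rw [mem_maximalIdeal_iff, lt_one_iff_le_exp]
    simpa using (key 1 c).symm
  rw [hmax, Ideal.span_singleton_pow, key]

/-- Hensel's lemma: a monic quadratic polynomial without a root in `F` has its linear coefficient
controlled by its constant coefficient. -/
theorem vF_sq_le_of_no_root {a b : F} (h : ∀ x : F, x ^ 2 + a * x + b ≠ 0) :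
    vF F a ^ 2 ≤ vF F b := by
  by_contra! hlt
  have ha : a ≠ 0 := by rintro rfl; simp at hlt
  have hva : vF F a ≠ 0 := by simpa using ha
  -- substituting `x = a y` turns the polynomial into `y ^ 2 + y + b / a ^ 2`
  have hc : vF F (b / a ^ 2) < 1 := by
    rw [map_div₀, map_pow]
    exact (div_lt_one₀ (by simpa [zero_lt_iff] using ha)).2 hlt
  let c : 𝒪[F] := ⟨b / a ^ 2, mem_integer_iff.2 hc.le⟩
  let := IsTopologicalAddGroup.rightUniformSpace F
  have := isUniformAddGroup_of_addCommGroup (G := F)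
  obtain ⟨y, hy, -⟩ := HenselianRing.is_henselian (I := 𝓂[F]) (X ^ 2 + X + C c : 𝒪[F][X])
    (by monicity!) 0 (by
      have : eval 0 (X ^ 2 + X + C c : 𝒪[F][X]) = c := by simp
      rw [this, mem_maximalIdeal_iff]
      exact hc) (by simp)
  have hy' : (y : F) ^ 2 + y + b / a ^ 2 = 0 := by
    simpa [c] using congrArg (Subtype.val) (by simpa [IsRoot.def] using hy : y ^ 2 + y + c = 0)
  refine h (a * y) ?_
  have : (a * y) ^ 2 + a * (a * y) + b = a ^ 2 * ((y : F) ^ 2 + y + b / a ^ 2) := by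
    field_simp
  rw [this, hy', mul_zero]

end BaseField

/-! ### The reduced norm -/

section ReducedNormPower

open Polynomial

variable {F : Type*} [Field F] {D : Type*} [DivisionRing D] [Algebra F D]

/-- The simple extension `F[X]/(minpoly x)` as a subfield of `D`. -/
def simpleHom (x : D) : AdjoinRoot (minpoly F x) →ₐ[F] D :=
  Ideal.Quotient.liftₐ (Ideal.span {minpoly F x}) (aeval x) (by
    intro p hp
    obtain ⟨r, rfl⟩ := Ideal.mem_span_singleton.1 hp
    simp)

theorem simpleHom_root (x : D) : simpleHom (F := F) x (AdjoinRoot.root (minpoly F x)) = x := by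
  change aeval x X = x
  simp

/-- The subfield generated by `x` acts on `D` by left multiplication; transitivity of norms along
`F ⊆ F[x] ⊆ D` computes the determinant of the multiplication by `x`. -/
theorem natDegree_minpoly_mul_and_norm [FiniteDimensional F D] (x : D) :
    ∃ k : ℕ, (minpoly F x).natDegree * k = Module.finrank F D ∧
      Algebra.norm F x = ((-1) ^ (minpoly F x).natDegree * (minpoly F x).coeff 0) ^ k ∧
      (k = 1 → ∀ y : D, Commute x y) := by
  have hx : IsIntegral F x := (Algebra.IsIntegral.of_finite F D).isIntegral x
  have hirr : Irreducible (minpoly F x) := minpoly.irreducible hx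
  have : Fact (Irreducible (minpoly F x)) := ⟨hirr⟩
  let K := AdjoinRoot (minpoly F x)
  let f : K →ₐ[F] D := simpleHom x
  have hf : f (AdjoinRoot.root (minpoly F x)) = x := simpleHom_root x
  let _ : Module K D := Module.compHom D f.toRingHom
  have hsmul (k : K) (d : D) : k • d = f k * d := rfl
  have : IsScalarTower F K D := ⟨fun a k d => by
    rw [hsmul, hsmul, map_smul, smul_mul_assoc]⟩
  let pb := AdjoinRoot.powerBasis hirr.ne_zero
  have : FiniteDimensional F K := pb.finite
  have hgen : pb.gen = AdjoinRoot.root (minpoly F x) := AdjoinRoot.powerBasis_gen _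
  have hmin : minpoly F pb.gen = minpoly F x := by
    rw [hgen, AdjoinRoot.minpoly_root hirr.ne_zero, (minpoly.monic hx).leadingCoeff]
    simp
  have hdim : pb.dim = (minpoly F x).natDegree := rfl
  refine ⟨Module.finrank K D, ?_, ?_, ?_⟩
  · rw [← hdim, ← pb.finrank, Module.finrank_mul_finrank]
  · have h1 : Algebra.lmul F D x =
        ((AdjoinRoot.root (minpoly F x)) • (LinearMap.id : D →ₗ[K] D)).restrictScalars F := by
      ext d
      simp [hsmul, hf]
    have : FiniteDimensional K D := FiniteDimensional.right F K D
    rw [Algebra.norm_apply]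
    change LinearMap.det (Algebra.lmul F D x) = _
    rw [h1, LinearMap.det_restrictScalars, LinearMap.det_smul, LinearMap.det_id, mul_one, map_pow,
      ← hgen, Algebra.PowerBasis.norm_gen_eq_coeff_zero_minpoly, hmin, hdim]
  · intro hk y
    obtain ⟨c, hc⟩ := (finrank_eq_one_iff_of_nonzero' (1 : D) one_ne_zero).1 hk y
    rw [hsmul, mul_one] at hc
    have := (Commute.all (AdjoinRoot.root (minpoly F x)) c).map f
    rwa [hc, hf] at this

theorem minpoly_algebraMap (a : F) : minpoly F (algebraMap F D a) = X - C a := by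
  rw [minpoly.algebraMap_eq (algebraMap F D).injective, minpoly.eq_X_sub_C']

/-- If `F[x]` had degree four, it would be a maximal commutative subring equal to `D`. -/
theorem natDegree_minpoly_le_two [Algebra.IsCentral F D] (hD : Module.finrank F D = 4) (x : D) :
    (minpoly F x).natDegree = 1 ∨ (minpoly F x).natDegree = 2 := by
  have : FiniteDimensional F D := .of_finrank_pos (by omega)
  obtain ⟨k, hk, -, hc⟩ := natDegree_minpoly_mul_and_norm (F := F) x
  rw [hD] at hk
  have hdvd : (minpoly F x).natDegree ∣ 4 := ⟨k, hk.symm⟩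
  have hle := Nat.le_of_dvd (by norm_num) hdvd
  by_cases hk1 : k = 1
  · have hmem : x ∈ Subalgebra.center F D :=
      Subalgebra.mem_center_iff.2 fun y => ((hc hk1 y).eq).symm
    obtain ⟨a, rfl⟩ := Algebra.mem_bot.1 (Algebra.IsCentral.out hmem)
    left
    rw [minpoly_algebraMap, natDegree_X_sub_C]
  · interval_cases h : (minpoly F x).natDegree <;> omega

theorem norm_eq_nrd_sq [Algebra.IsCentral F D] (hD : Module.finrank F D = 4) (x : D) :
    Algebra.norm F x = nrd F x ^ 2 := by
  have : FiniteDimensional F D := .of_finrank_pos (by omega)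
  obtain ⟨k, hk, hN, -⟩ := natDegree_minpoly_mul_and_norm (F := F) x
  rw [hD] at hk
  rw [hN, nrd]
  rcases natDegree_minpoly_le_two hD x with h | h <;> rw [h] at hk ⊢
  · obtain rfl : k = 4 := by omega
    ring
  · obtain rfl : k = 2 := by omega
    ring

theorem nrd_algebraMap (a : F) : nrd F (algebraMap F D a) = a ^ 2 := by
  rw [nrd, minpoly_algebraMap]
  simp

theorem nrd_of_quadratic {x : D} (hx : x ∉ Set.range (algebraMap F D)) {a b : F}
    (h : x * x + a • x + algebraMap F D b = 0) : nrd F x = b := by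
  have hmonic : (X ^ 2 + C a * X + C b : F[X]).Monic := by monicity!
  have hdeg : (X ^ 2 + C a * X + C b : F[X]).natDegree = 2 := by compute_degree!
  have hroot : aeval x (X ^ 2 + C a * X + C b : F[X]) = 0 := by
    simpa [Algebra.smul_def, sq] using h
  have hint : IsIntegral F x := ⟨_, hmonic, by simpa [aeval_def] using hroot⟩
  have h2 : 2 ≤ (minpoly F x).natDegree := (minpoly.two_le_natDegree_iff hint).2 hx
  have hmin : X ^ 2 + C a * X + C b = minpoly F x :=
    eq_of_monic_of_dvd_of_natDegree_le (minpoly.monic hint) hmonic (minpoly.dvd F x hroot)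
      (by rw [hdeg]; exact h2)
  rw [nrd, ← hmin, hdeg]
  simp

theorem exists_quadratic [Algebra.IsCentral F D] (hD : Module.finrank F D = 4) {x : D}
    (hx : x ∉ Set.range (algebraMap F D)) :
    ∃ a : F, x * x + a • x + algebraMap F D (nrd F x) = 0 ∧
      ∀ t : F, t ^ 2 + a * t + nrd F x ≠ 0 := by
  have : FiniteDimensional F D := .of_finrank_pos (by omega)
  have hint : IsIntegral F x := (Algebra.IsIntegral.of_finite F D).isIntegral x
  have h2 : 2 ≤ (minpoly F x).natDegree := (minpoly.two_le_natDegree_iff hint).2 hx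
  have hdeg : (minpoly F x).natDegree = 2 :=
    (natDegree_minpoly_le_two hD x).resolve_left (by omega)
  have hn : nrd F x = (minpoly F x).coeff 0 := by rw [nrd, hdeg]; simp
  have hlead : (minpoly F x).coeff 2 = 1 := by
    have := (minpoly.monic hint).coeff_natDegree
    rwa [hdeg] at this
  have hmin : minpoly F x = X ^ 2 + C ((minpoly F x).coeff 1) * X + C (nrd F x) := by
    conv_lhs => rw [(minpoly F x).as_sum_range_C_mul_X_pow, hdeg]
    rw [Finset.sum_range_succ, Finset.sum_range_succ, Finset.sum_range_one, hlead, hn]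
    simp
    ring
  refine ⟨(minpoly F x).coeff 1, ?_, fun t ht => ?_⟩
  · have := minpoly.aeval F x
    rw [hmin] at this
    simpa [Algebra.smul_def, sq] using this
  · have hr : (minpoly F x).IsRoot t := by
      rw [hmin, IsRoot.def]
      simpa using ht
    exact hx ⟨t, minpoly.root hint hr⟩

end ReducedNormPower

/-! ### The valuation of the quaternion algebra -/

section ValuationD

open WithZero

variable (F : Type*) [Field F] [ValuativeRel F] [TopologicalSpace F] [IsNonarchimedeanLocalField F]
variable (D : Type*) [DivisionRing D] [Algebra F D] [Algebra.IsCentral F D]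
variable [hD : Fact (Module.finrank F D = 4)]

variable {F D}

/-- The square of the reduced norm is multiplicative, being the norm of the left regular
representation; this determines the reduced norm of a product up to a sign. -/
theorem vF_nrd_mul (x y : D) : vF F (nrd F (x * y)) = vF F (nrd F x) * vF F (nrd F y) := by
  have h : nrd F (x * y) ^ 2 = (nrd F x * nrd F y) ^ 2 := by
    rw [mul_pow, ← norm_eq_nrd_sq hD.out, ← norm_eq_nrd_sq hD.out, ← norm_eq_nrd_sq hD.out, map_mul]
  rw [← map_mul]
  rcases sq_eq_sq_iff_eq_or_eq_neg.1 h with h | h <;> rw [h]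
  rw [Valuation.map_neg]

/-- The reduced norm of `1 + x`, in terms of the reduced norm and the reduced trace of `x`. For
`x ∉ F` the trace is bounded by Hensel's lemma; for `x = a ∈ F` it is `a + a`. -/
theorem exists_nrd_one_add (x : D) :
    ∃ a : F, nrd F (1 + x) = 1 + a + nrd F x ∧ vF F a ^ 2 ≤ vF F (nrd F x) ∨
      nrd F (1 + x) = 1 + (a + a) + nrd F x ∧ vF F a ^ 2 = vF F (nrd F x) := by
  by_cases hx : x ∈ Set.range (algebraMap F D)
  · obtain ⟨a, rfl⟩ := hx
    refine ⟨a, Or.inr ⟨?_, ?_⟩⟩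
    · rw [← map_one (algebraMap F D), ← map_add, nrd_algebraMap, nrd_algebraMap]
      ring
    · rw [nrd_algebraMap, map_pow]
  · obtain ⟨a, ha, hroot⟩ := exists_quadratic hD.out hx
    refine ⟨-a, Or.inl ⟨?_, ?_⟩⟩
    · refine nrd_of_quadratic (a := a - (1 + 1)) ?_ ?_
      · rintro ⟨c, hc⟩
        exact hx ⟨c - 1, by rw [map_sub, hc, map_one]; abel⟩
      · rw [map_add, map_add, map_neg, map_one]
        rw [Algebra.smul_def] at ha ⊢
        rw [map_sub, map_add, map_one, ← ha]
        noncomm_ring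
    · rw [Valuation.map_neg]
      exact vF_sq_le_of_no_root hroot

theorem sq_le_one_imp {γ : ℤᵐ⁰} (h : γ ^ 2 ≤ 1) : γ ≤ 1 :=
  (pow_le_one_iff two_ne_zero).1 h

theorem sq_lt_one_imp {γ : ℤᵐ⁰} (h : γ ^ 2 < 1) : γ < 1 :=
  (pow_lt_one_iff two_ne_zero).1 h

theorem vF_nrd_one_add_le {x : D} (hx : vF F (nrd F x) ≤ 1) : vF F (nrd F (1 + x)) ≤ 1 := by
  obtain ⟨a, ⟨h, ha⟩ | ⟨h, ha⟩⟩ := exists_nrd_one_add (F := F) x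
  · have := sq_le_one_imp (ha.trans hx)
    rw [h]
    exact (vF F).map_add_le ((vF F).map_add_le (by simp) this) hx
  · have := sq_le_one_imp (ha.le.trans hx)
    rw [h]
    exact (vF F).map_add_le ((vF F).map_add_le (by simp) ((vF F).map_add_le this this)) hx

variable (F D) in
/-- The valuation `v_D = v_F ∘ Nrd` of the quaternion algebra, written multiplicatively; on `F` it
is the square of `vF`. -/
def vD : Valuation D ℤᵐ⁰ where
  toFun x := vF F (nrd F x)
  map_zero' := by rw [← map_zero (algebraMap F D), nrd_algebraMap]; simp
  map_one' := by rw [← map_one (algebraMap F D), nrd_algebraMap]; simp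
  map_mul' := vF_nrd_mul
  map_add_le_max' x y := by
    wlog h : vF F (nrd F x) ≤ vF F (nrd F y) generalizing x y
    · rw [add_comm, max_comm]
      exact this y x (le_of_not_ge h)
    rw [max_eq_right h]
    by_cases hy : y = 0
    · subst hy
      rwa [add_zero]
    have hy' : vF F (nrd F y) ≠ 0 := by
      intro h0
      have := vF_nrd_mul (F := F) y y⁻¹
      rw [mul_inv_cancel₀ hy, h0, zero_mul, ← map_one (algebraMap F D), nrd_algebraMap] at this
      simp at this
    have h1 : vF F (nrd F (x * y⁻¹)) ≤ 1 := by
      have h2 : vF F (nrd F (x * y⁻¹)) * vF F (nrd F y) = vF F (nrd F x) := by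
        rw [← vF_nrd_mul, inv_mul_cancel_right₀ hy]
      refine le_of_mul_le_mul_right ?_ (zero_lt_iff.2 hy')
      rwa [h2, one_mul]
    have h3 : x + y = (1 + x * y⁻¹) * y := by
      rw [add_mul, one_mul, inv_mul_cancel_right₀ hy, add_comm]
    rw [h3, vF_nrd_mul]
    exact mul_le_of_le_one_left' (vF_nrd_one_add_le h1)

theorem vD_apply (x : D) : vD F D x = vF F (nrd F x) := rfl

theorem vD_algebraMap (a : F) : vD F D (algebraMap F D a) = vF F a ^ 2 := by
  rw [vD_apply, nrd_algebraMap, map_pow]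

/-- The norm of the left regular representation carries `U_D^1` into the principal units of `F`. -/
theorem vF_norm_sub_one_lt {x : D} (hx : vD F D x < 1) : vF F (Algebra.norm F (1 + x) - 1) < 1 := by
  have h1 : vF F (nrd F (1 + x) - 1) < 1 := by
    rw [vD_apply] at hx
    obtain ⟨a, ⟨h, ha⟩ | ⟨h, ha⟩⟩ := exists_nrd_one_add (F := F) x <;> rw [h]
    · have := sq_lt_one_imp (ha.trans_lt hx)
      rw [add_assoc, add_sub_cancel_left]
      exact (vF F).map_add_lt this hx
    · have := sq_lt_one_imp (ha.le.trans_lt hx)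
      rw [add_assoc, add_sub_cancel_left]
      exact (vF F).map_add_lt ((vF F).map_add_lt this this) hx
  rw [norm_eq_nrd_sq hD.out]
  set c := nrd F (1 + x) - 1 with hc
  have : nrd F (1 + x) ^ 2 - 1 = c * (c + (1 + 1)) := by rw [hc]; ring
  rw [this, map_mul]
  refine mul_lt_one_of_lt_of_le h1 ?_
  exact (vF F).map_add_le h1.le ((vF F).map_add_le (by simp) (by simp))

/-- The generators of `congrSubgroup F D m` already form a group. -/
theorem mem_congrSubgroup_iff {m : ℕ} (hm : 1 ≤ m) (u : Dˣ) :
    u ∈ congrSubgroup F D m ↔ vD F D ((u : D) - 1) ≤ exp (-(m : ℤ)) := by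
  have hgen (u : Dˣ) : (∃ a : 𝒪[F], a ∈ 𝓂[F] ^ m ∧ (a : F) = nrd F ((u : D) - 1)) ↔
      vD F D ((u : D) - 1) ≤ exp (-(m : ℤ)) := by
    rw [vD_apply]
    constructor
    · rintro ⟨a, ha, h⟩
      rw [← h]
      exact (mem_maximalIdeal_pow_iff a m).1 ha
    · intro h
      have h1 : vF F (nrd F ((u : D) - 1)) ≤ 1 :=
        h.trans (by rw [← exp_zero, exp_le_exp]; omega)
      exact ⟨⟨_, mem_integer_iff.2 h1⟩, (mem_maximalIdeal_pow_iff _ m).2 h, rfl⟩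
  have hlt : exp (-(m : ℤ)) < (1 : ℤᵐ⁰) := by
    rw [← exp_zero, exp_lt_exp]
    omega
  have hone {u : Dˣ} (hu : vD F D ((u : D) - 1) ≤ exp (-(m : ℤ))) : vD F D u = 1 := by
    have := (vD F D).map_one_add_of_lt (hu.trans_lt hlt)
    rwa [add_sub_cancel] at this
  rw [congrSubgroup]
  refine ⟨fun hu => ?_, fun hu => Subgroup.subset_closure ((hgen u).2 hu)⟩
  induction hu using Subgroup.closure_induction with
  | mem u hu => exact (hgen u).1 hu
  | one => simp
  | mul u v _ _ hu hv =>
    have : ((u * v : Dˣ) : D) - 1 = u * (v - 1) + (u - 1) := by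
      rw [Units.val_mul, mul_sub, mul_one]; abel
    rw [this]
    refine (vD F D).map_add_le ?_ hu
    rwa [map_mul, hone hu, one_mul]
  | inv u _ hu =>
    have : ((u⁻¹ : Dˣ) : D) - 1 = -((u⁻¹ : Dˣ) * ((u : D) - 1)) := by
      rw [mul_sub, mul_one, Units.inv_mul]; abel
    have h1 : vD F D ((u⁻¹ : Dˣ) : D) = 1 := by
      rw [Units.val_inv_eq_inv_val, map_inv₀, hone hu, inv_one]
    rwa [this, Valuation.map_neg, map_mul, h1, one_mul]

end ValuationD

/-! ### Uniformizer of `E` and structure of `D` -/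

section StructureD

open WithZero Polynomial

variable {F : Type*} [Field F] [ValuativeRel F] [TopologicalSpace F] [IsNonarchimedeanLocalField F]
variable {D : Type*} [DivisionRing D] [Algebra F D] [Algebra.IsCentral F D]
variable [hD : Fact (Module.finrank F D = 4)]
variable {E : Type*} [Field E] [Algebra F E]

/-- Only zero is divisible by all powers of the uniformizer. -/
theorem eq_zero_of_forall_le_mul_exp {γ δ : ℤᵐ⁰} (h : ∀ k : ℕ, γ ≤ δ * exp (-(k : ℤ))) : γ = 0 := by
  induction γ using expRecOn with
  | zero => rfl
  | exp a =>
    induction δ using expRecOn with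
    | zero => simpa using h 0
    | exp b =>
      exfalso
      have := h (b - a + 1).toNat
      rw [← exp_add, exp_le_exp] at this
      omega

/-- Even valuations are not odd. -/
theorem sq_ne_sq_mul_exp_neg_one {γ δ : ℤᵐ⁰} (hγ : γ ≠ 0) : γ ^ 2 ≠ δ ^ 2 * exp (-1) := by
  induction γ using expRecOn with
  | zero => exact absurd rfl hγ
  | exp a =>
    induction δ using expRecOn with
    | zero => simp
    | exp b =>
      rw [← exp_nsmul, ← exp_nsmul, ← exp_add, Ne, exp_inj, nsmul_eq_mul, nsmul_eq_mul]
      push_cast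
      omega

theorem eq_exp_of_ne_zero {γ : ℤᵐ⁰} (h : γ ≠ 0) : ∃ k : ℤ, γ = exp k := ⟨log γ, (exp_log h).symm⟩

/-- The integral closure of `𝔬_F` in `E` is the valuation ring of the restriction of `v_D`. -/
theorem isIntegral_iff_vD_le_one (ι : E →ₐ[F] D) (x : E) :
    IsIntegral 𝒪[F] x ↔ vD F D (ι x) ≤ 1 := by
  have hι : Function.Injective ι := ι.toRingHom.injective
  let vE : Valuation E ℤᵐ⁰ := (vD F D).comap ι.toRingHom
  constructor
  · rintro ⟨p, hp, hx⟩
    let j : 𝒪[F] →+* vE.integer := ((algebraMap F E).comp (𝒪[F]).subtype).codRestrict _ (by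
      intro c
      have hc : vF F c ≤ 1 := mem_integer_iff.1 c.2
      change vD F D (ι (algebraMap F E c)) ≤ 1
      rw [AlgHom.commutes, vD_algebraMap]
      exact pow_le_one' hc 2)
    have : IsIntegral vE.integer x := ⟨p.map j, hp.map j, by
      rw [eval₂_map]
      exact hx⟩
    exact (Valuation.integer.integers vE).mem_of_integral this
  · intro h
    by_cases hx : ι x ∈ Set.range (algebraMap F D)
    · obtain ⟨c, hc⟩ := hx
      have hxc : x = algebraMap F E c := hι (by rw [AlgHom.commutes, hc])
      have hc1 : vF F c ≤ 1 := by
        rw [← hc, vD_algebraMap] at h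
        exact sq_le_one_imp h
      rw [hxc]
      exact isIntegral_algebraMap (R := 𝒪[F]) (A := E) (x := ⟨c, mem_integer_iff.2 hc1⟩)
    · obtain ⟨a, ha, hroot⟩ := exists_quadratic hD.out hx
      have hb : vF F (nrd F (ι x)) ≤ 1 := h
      have ha1 : vF F a ≤ 1 := sq_le_one_imp ((vF_sq_le_of_no_root hroot).trans hb)
      let a' : 𝒪[F] := ⟨a, mem_integer_iff.2 ha1⟩
      let b' : 𝒪[F] := ⟨nrd F (ι x), mem_integer_iff.2 hb⟩
      refine ⟨X ^ 2 + C a' * X + C b', by monicity!, ?_⟩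
      apply hι
      rw [map_zero, ← ha]
      simp only [eval₂_add, eval₂_X, eval₂_mul, eval₂_C, map_add, map_mul, sq,
        Algebra.smul_def]
      have h1 (c : 𝒪[F]) : ι (algebraMap 𝒪[F] E c) = algebraMap F D c := by
        rw [IsScalarTower.algebraMap_apply 𝒪[F] F E, AlgHom.commutes]
        rfl
      rw [h1, h1]

/-- If `v_D` had no value one on `E`, the maximal ideal `𝔭_E` would lie in `v_D ≥ 2`, and its square,
which contains a uniformizer of `F`, in `v_D ≥ 4`; but uniformizers of `F` have `v_D = 2`. -/
theorem exists_uniformizer (ι : E →ₐ[F] D) (hE : IsTotallyRamifiedQuadratic F E) :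
    ∃ w : E, vD F D (ι w) = exp (-1) := by
  obtain ⟨-, P, hP, hPsq⟩ := hE
  have hlt (x : integralClosure 𝒪[F] E) (hx : x ∈ P) : vD F D (ι x) < 1 := by
    have h1 := (isIntegral_iff_vD_le_one ι (x : E)).1 x.2
    refine lt_of_le_of_ne h1 fun h => hP.ne_top (Ideal.eq_top_of_isUnit_mem P hx ?_)
    have hx0 : (x : E) ≠ 0 := by
      intro h0
      rw [h0, map_zero, map_zero] at h
      exact zero_ne_one h
    refine IsUnit.of_mul_eq_one
      (⟨(x : E)⁻¹, (isIntegral_iff_vD_le_one ι _).2 ?_⟩ : integralClosure 𝒪[F] E) ?_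
    · rw [map_inv₀, map_inv₀, h, inv_one]
    · exact Subtype.ext (mul_inv_cancel₀ hx0)
  by_contra! hno
  have hle (x : integralClosure 𝒪[F] E) (hx : x ∈ P) : vD F D (ι x) ≤ exp (-2) := by
    have h1 := hlt x hx
    have h2 := hno x
    induction h : vD F D (ι x) using expRecOn with
    | zero => simp
    | exp a =>
      rw [h] at h1 h2
      rw [← exp_zero, exp_lt_exp] at h1
      rw [Ne, exp_inj] at h2
      rw [exp_le_exp]
      omega
  have hle4 (x : integralClosure 𝒪[F] E) (hx : x ∈ P ^ 2) : vD F D (ι x) ≤ exp (-4) := by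
    rw [sq] at hx
    refine Submodule.mul_induction_on hx (fun m hm n hn => ?_) fun x y hx hy => ?_
    · have h4 : exp (-4 : ℤ) = exp (-2) * exp (-2) := by rw [← exp_add]; norm_num
      rw [h4, MulMemClass.coe_mul, map_mul, map_mul]
      exact mul_le_mul' (hle m hm) (hle n hn)
    · rw [AddMemClass.coe_add, map_add]
      exact (vD F D).map_add_le hx hy
  obtain ⟨t, ht⟩ := vF_surjective (F := F) (exp (-1))
  have ht1 : vF F t < 1 := by rw [lt_one_iff_le_exp, ht]
  let t' : 𝒪[F] := ⟨t, mem_integer_iff.2 ht1.le⟩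
  have hmem : algebraMap 𝒪[F] (integralClosure 𝒪[F] E) t' ∈ P ^ 2 := by
    rw [← hPsq]
    exact Ideal.mem_map_of_mem _ ((mem_maximalIdeal_iff t').2 ht1)
  have := hle4 _ hmem
  have h1 : ι (algebraMap 𝒪[F] (integralClosure 𝒪[F] E) t' : E) = algebraMap F D t :=
    ι.commutes t
  rw [h1, vD_algebraMap, ht, ← exp_nsmul, exp_le_exp] at this
  norm_num at this

/-- The valuation `v_D` is even on the centre. -/
theorem not_central_of_vD_eq {w : D} (hw : vD F D w = exp (-1)) : ∃ y : D, w * y ≠ y * w := by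
  by_contra! h
  have hmem : w ∈ Subalgebra.center F D := Subalgebra.mem_center_iff.2 fun y => (h y).symm
  obtain ⟨a, rfl⟩ := Algebra.mem_bot.1 (Algebra.IsCentral.out hmem)
  rw [vD_algebraMap] at hw
  have h0 : vF F a ≠ 0 := by
    intro h0
    rw [h0, zero_pow two_ne_zero] at hw
    exact exp_ne_zero hw.symm
  refine sq_ne_sq_mul_exp_neg_one (δ := 1) h0 ?_
  rw [hw, one_pow, one_mul]

theorem vD_zpow {w : D} (hw : vD F D w = exp (-1)) (j : ℤ) : vD F D (w ^ j) = exp (-j) := by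
  rw [map_zpow₀, hw, ← exp_zsmul]
  simp

/-- The residue field of `D` is larger than that of `F`: otherwise every element of `D` would be
approximated by elements of `E`, hence commute with a uniformizer of `E`. -/
theorem exists_residue_generator (ι : E →ₐ[F] D) {w : E} (hw : vD F D (ι w) = exp (-1)) :
    ∃ x : D, vD F D x = 1 ∧ ∀ a : F, 1 ≤ vD F D (x - algebraMap F D a) := by
  suffices ∃ x : D, vD F D x ≤ 1 ∧ ∀ a : F, 1 ≤ vD F D (x - algebraMap F D a) by
    obtain ⟨x, h1, h2⟩ := this
    exact ⟨x, le_antisymm h1 (by simpa using h2 0), h2⟩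
  by_contra! H
  have happrox (y : D) (k : ℕ) : ∃ e : E, vD F D (y - ι e) ≤ vD F D y * exp (-(k : ℤ)) := by
    induction k with
    | zero => exact ⟨0, by simp⟩
    | succ k ih =>
      obtain ⟨e, he⟩ := ih
      by_cases hz : y - ι e = 0
      · exact ⟨e, by rw [hz, map_zero]; exact zero_le⟩
      obtain ⟨j, hj⟩ := eq_exp_of_ne_zero ((vD F D).ne_zero_iff.2 hz)
      have h1 : vD F D ((y - ι e) * ι w ^ j) = 1 := by
        rw [map_mul, hj, vD_zpow hw, ← exp_add, add_neg_cancel, exp_zero]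
      obtain ⟨a, ha⟩ := H _ h1.le
      rw [lt_one_iff_le_exp] at ha
      refine ⟨e + algebraMap F E a * w ^ (-j), ?_⟩
      have hw0 : ι w ≠ 0 := by
        intro h0
        rw [h0, map_zero] at hw
        exact exp_ne_zero hw.symm
      have h2 : y - ι (e + algebraMap F E a * w ^ (-j)) =
          ((y - ι e) * ι w ^ j - algebraMap F D a) * ι w ^ (-j) := by
        rw [sub_mul, mul_assoc, ← zpow_add₀ hw0, add_neg_cancel, zpow_zero, mul_one, map_add,
          map_mul, AlgHom.commutes, map_zpow₀, sub_add_eq_sub_sub]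
      rw [h2, map_mul, vD_zpow hw, neg_neg]
      rw [hj] at he
      calc _ ≤ exp (-1) * exp j := mul_le_mul' ha le_rfl
        _ ≤ exp (-1) * (vD F D y * exp (-(k : ℤ))) := mul_le_mul' le_rfl he
        _ = vD F D y * exp (-((k + 1 : ℕ) : ℤ)) := by
          rw [mul_left_comm, ← exp_add]
          congr 2
          push_cast
          ring
  obtain ⟨y, hy⟩ := not_central_of_vD_eq hw
  refine hy (sub_eq_zero.1 ((vD F D).zero_iff.1 (eq_zero_of_forall_le_mul_exp
    (δ := vD F D y * exp (-1)) fun k => ?_)))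
  obtain ⟨e, he⟩ := happrox y k
  have h1 : ι w * y - y * ι w = ι w * (y - ι e) - (y - ι e) * ι w := by
    rw [mul_sub, sub_mul, ← map_mul, ← map_mul, mul_comm e w]
    abel
  rw [h1]
  refine (vD F D).map_sub_le ?_ ?_
  · rw [map_mul, hw, mul_comm, mul_right_comm]
    exact mul_le_mul' he le_rfl
  · rw [map_mul, hw, mul_right_comm]
    exact mul_le_mul' he le_rfl

end StructureD

/-! ### The residue field of `D` -/

section ResidueD

open WithZero Polynomial

variable {F : Type*} [Field F] [ValuativeRel F] [TopologicalSpace F] [IsNonarchimedeanLocalField F]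
variable {D : Type*} [DivisionRing D] [Algebra F D] [Algebra.IsCentral F D]
variable [hD : Fact (Module.finrank F D = 4)]

/-- `x` is a unit of `𝔬_D` whose residue does not lie in the residue field of `F`; the residue
then generates the residue field of `D`. -/
structure IsResidueGenerator (F : Type*) [Field F] [ValuativeRel F] [TopologicalSpace F]
    [IsNonarchimedeanLocalField F] {D : Type*} [DivisionRing D] [Algebra F D]
    [Algebra.IsCentral F D] [Fact (Module.finrank F D = 4)] (x : D) : Prop where
  vD_eq_one : vD F D x = 1
  one_le : ∀ a : F, 1 ≤ vD F D (x - algebraMap F D a)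

variable {x w : D}

theorem vD_smul (a : F) (y : D) : vD F D (a • y) = vF F a ^ 2 * vD F D y := by
  rw [Algebra.smul_def, map_mul, vD_algebraMap]

/-- On `F + F x` the valuation `v_D` is the Gauss valuation with respect to `1, x`. -/
theorem IsResidueGenerator.vD_add_smul (hx : IsResidueGenerator F x) (a b : F) :
    vD F D (algebraMap F D a + b • x) = max (vF F a) (vF F b) ^ 2 := by
  rcases le_or_gt (vF F a) (vF F b) with h | h
  · rw [max_eq_right h]
    by_cases hb : b = 0
    · subst hb
      have : a = 0 := by simpa using h
      simp [this]
    · have h1 : algebraMap F D a + b • x = b • (x - algebraMap F D (-(a / b))) := by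
        rw [smul_sub, Algebra.smul_def b (algebraMap F D _), ← map_mul, mul_neg,
          mul_div_cancel₀ _ hb, map_neg]
        abel
      rw [h1, vD_smul]
      refine mul_eq_left₀ (pow_ne_zero _ ((vF F).ne_zero_iff.2 hb)) |>.2 (le_antisymm ?_ (hx.one_le _))
      refine (vD F D).map_sub_le hx.vD_eq_one.le ?_
      rw [vD_algebraMap, Valuation.map_neg, map_div₀]
      exact pow_le_one' (div_le_one_of_le₀ h zero_le) 2
  · rw [max_eq_left h.le, Valuation.map_add_eq_of_lt_left, vD_algebraMap]
    rw [vD_smul, vD_algebraMap, hx.vD_eq_one, mul_one]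
    exact pow_lt_pow_left₀ h zero_le two_ne_zero

/-- On `D` the elements `1, x, w, x w` are orthogonal for `v_D`, because the values on `F + F x` are
even and those on `(F + F x) w` are odd. -/
theorem IsResidueGenerator.vD_add_mul (hx : IsResidueGenerator F x) (hw : vD F D w = exp (-1))
    (a b c d : F) : vD F D ((algebraMap F D a + b • x) + (algebraMap F D c + d • x) * w) =
      max (max (vF F a) (vF F b) ^ 2) (max (vF F c) (vF F d) ^ 2 * exp (-1)) := by
  by_cases h : max (vF F a) (vF F b) = 0
  · have h0 : algebraMap F D a + b • x = 0 := by
      rw [← (vD F D).zero_iff, hx.vD_add_smul, h]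
      simp
    rw [h0, zero_add, h, map_mul, hx.vD_add_smul, hw]
    simp
  · rw [Valuation.map_add_of_distinct_val, map_mul, hx.vD_add_smul, hx.vD_add_smul, hw]
    rw [map_mul, hx.vD_add_smul, hx.vD_add_smul, hw]
    exact sq_ne_sq_mul_exp_neg_one h

/-- Coordinates on `D` with respect to `1, x, w, x w`. -/
def coordMap (F : Type*) [Field F] {D : Type*} [DivisionRing D] [Algebra F D] (x w : D) :
    (F × F) × (F × F) →ₗ[F] D where
  toFun p := (algebraMap F D p.1.1 + p.1.2 • x) + (algebraMap F D p.2.1 + p.2.2 • x) * w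
  map_add' p p' := by simp only [Prod.fst_add, Prod.snd_add, map_add, add_smul, add_mul]; abel
  map_smul' t p := by
    simp only [Prod.smul_fst, Prod.smul_snd, smul_eq_mul, RingHom.id_apply]
    simp only [map_mul, Algebra.smul_def]
    noncomm_ring

theorem IsResidueGenerator.coordMap_bijective (hx : IsResidueGenerator F x)
    (hw : vD F D w = exp (-1)) : Function.Bijective (coordMap F x w) := by
  have hφ : Function.Injective (coordMap F x w) := by
    rw [injective_iff_map_eq_zero]
    rintro ⟨⟨a, b⟩, ⟨c, d⟩⟩ h
    have h1 := hx.vD_add_mul hw a b c d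
    have h2 : (algebraMap F D a + b • x) + (algebraMap F D c + d • x) * w = 0 := h
    rw [h2, map_zero, eq_comm, ← le_zero_iff, max_le_iff, le_zero_iff, le_zero_iff,
      mul_eq_zero_iff_right exp_ne_zero, pow_eq_zero_iff two_ne_zero, pow_eq_zero_iff two_ne_zero,
      ← le_zero_iff, max_le_iff, ← le_zero_iff, max_le_iff] at h1
    simp only [le_zero_iff, (vF F).zero_iff] at h1
    simp [h1]
  have : FiniteDimensional F D := .of_finrank_pos (by rw [hD.out]; omega)
  exact ⟨hφ, (LinearMap.injective_iff_surjective_of_finrank_eq_finrank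
    (by rw [hD.out]; simp)).1 hφ⟩

theorem IsResidueGenerator.exists_coords (hx : IsResidueGenerator F x)
    (hw : vD F D w = exp (-1)) (y : D) : ∃ a b c d : F,
      y = (algebraMap F D a + b • x) + (algebraMap F D c + d • x) * w := by
  obtain ⟨⟨⟨a, b⟩, ⟨c, d⟩⟩, h⟩ := (hx.coordMap_bijective hw).2 y
  exact ⟨a, b, c, d, h.symm⟩

/-- The coordinate along `x` in the basis `1, x, w, x w`. -/
theorem IsResidueGenerator.exists_coord_functional (hx : IsResidueGenerator F x)
    (hw : vD F D w = exp (-1)) : ∃ B : D →ₗ[F] F, ∀ a b c d : F,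
      B ((algebraMap F D a + b • x) + (algebraMap F D c + d • x) * w) = b := by
  let e := LinearEquiv.ofBijective _ (hx.coordMap_bijective hw)
  refine ⟨LinearMap.snd F F F ∘ₗ LinearMap.fst F _ _ ∘ₗ e.symm.toLinearMap, fun a b c d => ?_⟩
  have : e.symm ((algebraMap F D a + b • x) + (algebraMap F D c + d • x) * w) =
      ((a, b), (c, d)) := e.symm_apply_apply ((a, b), (c, d))
  simp [this]

/-- The residue field of `D` is spanned over that of `F` by `1` and the residue of `x`. -/
theorem IsResidueGenerator.exists_residue (hx : IsResidueGenerator F x)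
    (hw : vD F D w = exp (-1)) {y : D} (hy : vD F D y ≤ 1) : ∃ a b : F, vF F a ≤ 1 ∧ vF F b ≤ 1 ∧
      vD F D (y - (algebraMap F D a + b • x)) < 1 := by
  obtain ⟨a, b, c, d, rfl⟩ := hx.exists_coords hw y
  rw [hx.vD_add_mul hw, max_le_iff] at hy
  have h1 := sq_le_one_imp hy.1
  rw [max_le_iff] at h1
  refine ⟨a, b, h1.1, h1.2, ?_⟩
  rw [add_sub_cancel_left, map_mul, hx.vD_add_smul, hw]
  refine lt_of_le_of_ne hy.2 fun h => ?_
  exact sq_ne_sq_mul_exp_neg_one (γ := 1) one_ne_zero ((one_pow 2).trans h.symm)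

theorem vF_two_lt_one (hp : ringChar 𝓀[F] = 2) : vF F (1 + 1) < 1 := by
  have h : (((1 + 1 : 𝒪[F]) : 𝒪[F]) : F) = 1 + 1 := rfl
  rw [← h, ← mem_maximalIdeal_iff, ← IsLocalRing.residue_eq_zero_iff, map_add, map_one]
  have h2 : ((2 : ℕ) : 𝓀[F]) = 0 := (ringChar.spec _ _).2 (by rw [hp])
  rwa [Nat.cast_two, ← one_add_one_eq_two] at h2

/-- The residue of `x` is separable over the perfect residue field of `F`: if its trace vanished, its
minimal polynomial would be the square `(X - γ) ^ 2`, and `x` would be congruent to an element of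
`F`. -/
theorem IsResidueGenerator.vF_trace_eq_one (hp : ringChar 𝓀[F] = 2) (hx : IsResidueGenerator F x)
    {a b : F} (h : x * x + a • x + algebraMap F D b = 0) (ha : vF F a ≤ 1) (hb : vF F b ≤ 1) :
    vF F a = 1 := by
  refine le_antisymm ha (le_of_not_gt fun hlt => ?_)
  have : CharP 𝓀[F] 2 := by rw [← hp]; infer_instance
  obtain ⟨γ, hγ⟩ := FiniteField.isSquare_of_char_two (F := 𝓀[F]) (ringChar.eq 𝓀[F] 2)
    (IsLocalRing.residue 𝒪[F] (-⟨b, mem_integer_iff.2 hb⟩))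
  obtain ⟨c, rfl⟩ := IsLocalRing.residue_surjective γ
  rw [← map_mul, ← sub_eq_zero, ← map_sub, IsLocalRing.residue_eq_zero_iff,
    mem_maximalIdeal_iff] at hγ
  have hc : vF F (c : F) ≤ 1 := mem_integer_iff.1 c.2
  have hγ' : vF F (-b - c * c) < 1 := hγ
  have h2 := vF_two_lt_one hp
  have hsq : (x - algebraMap F D c) * (x - algebraMap F D c) =
      algebraMap F D (-b - c * c) - (a + (1 + 1) * c) • x + algebraMap F D ((1 + 1) * (c * c)) := by
    have : x * x = - (a • x + algebraMap F D b) := by rw [eq_neg_iff_add_eq_zero, ← add_assoc, h]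
    rw [sub_mul, mul_sub, mul_sub, this, ← Algebra.commutes (c : F) x]
    simp only [Algebra.smul_def, map_add, map_mul, map_sub, map_neg, map_one]
    noncomm_ring
  have hval : vD F D ((x - algebraMap F D c) * (x - algebraMap F D c)) < 1 := by
    rw [hsq]
    refine (vD F D).map_add_lt ((vD F D).map_sub_lt ?_ ?_) ?_
    · rw [vD_algebraMap]
      exact pow_lt_one₀ zero_le hγ' two_ne_zero
    · rw [vD_smul, hx.vD_eq_one, mul_one]
      refine pow_lt_one₀ zero_le ((vF F).map_add_lt hlt ?_) two_ne_zero
      rw [map_mul]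
      exact mul_lt_one_of_lt_of_le h2 hc
    · rw [vD_algebraMap, map_mul]
      refine pow_lt_one₀ zero_le (mul_lt_one_of_lt_of_le h2 ?_) two_ne_zero
      rw [map_mul]
      exact mul_le_one' hc hc
  rw [map_mul, ← sq] at hval
  exact absurd (sq_lt_one_imp hval) (not_lt.2 (hx.one_le c))

/-- Conjugation by a uniformizer exchanges the two roots of the residual polynomial of `x`. The
residue of `y = w x w⁻¹` is a root of it; if that were the residue of `x`, conjugation would be
trivial on the residue field, and conjugating `x` by `y - x` would give a contradiction to the
separability of the residue of `x`. -/
theorem IsResidueGenerator.vD_conj_add_lt (hp : ringChar 𝓀[F] = 2) (hx : IsResidueGenerator F x)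
    (hw : vD F D w = exp (-1)) {a b : F} (h : x * x + a • x + algebraMap F D b = 0)
    (ha : vF F a ≤ 1) (hb : vF F b ≤ 1) :
    vD F D (w * x * w⁻¹ + algebraMap F D a + x) < 1 := by
  have hw0 : w ≠ 0 := by
    rintro rfl
    rw [map_zero] at hw
    exact exp_ne_zero hw.symm
  have hone := hx.vF_trace_eq_one hp h ha hb
  set y := w * x * w⁻¹ with hy
  have hyy : y * y + a • y + algebraMap F D b = 0 := by
    have h1 : w * (x * x + a • x + algebraMap F D b) * w⁻¹ = 0 := by rw [h]; simp
    rw [← h1, hy, mul_add, add_mul, mul_add, add_mul, ← Algebra.commutes, mul_assoc _ w w⁻¹,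
      mul_inv_cancel₀ hw0, mul_one]
    congr 2
    · simp only [mul_assoc, inv_mul_cancel_left₀ hw0]
    · rw [mul_smul_comm, smul_mul_assoc]
  have hy1 : vD F D y = 1 := by
    rw [hy, map_mul, map_mul, map_inv₀, hx.vD_eq_one, mul_one, mul_inv_cancel₀]
    rwa [(vD F D).ne_zero_iff]
  have hx1 := hx.vD_eq_one
  have hcomm (z : D) (hz : vD F D z ≤ 1) : vD F D (z * x - x * z) < 1 := by
    obtain ⟨c, d, -, -, hcd⟩ := hx.exists_residue hw hz
    set l := algebraMap F D c + d • x with hl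
    have h1 : z * x - x * z = (z - l) * x - x * (z - l) := by
      have : l * x = x * l := by
        rw [hl, add_mul, mul_add, Algebra.commutes, smul_mul_assoc, mul_smul_comm]
      rw [sub_mul, mul_sub, this]
      abel
    rw [h1]
    refine (vD F D).map_sub_lt ?_ ?_
    · rwa [map_mul, hx1, mul_one]
    · rwa [map_mul, hx1, one_mul]
  have hprod : (y - x) * (y + algebraMap F D a + x) = y * x - x * y := by
    have h1 : y * y = -(a • y + algebraMap F D b) := by
      rw [eq_neg_iff_add_eq_zero, ← add_assoc, hyy]
    have h2 : x * x = -(a • x + algebraMap F D b) := by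
      rw [eq_neg_iff_add_eq_zero, ← add_assoc, h]
    rw [sub_mul, mul_add, mul_add, mul_add, mul_add, h1, h2, ← Algebra.commutes, ← Algebra.commutes,
      Algebra.smul_def, Algebra.smul_def]
    abel
  have hδle : vD F D (y - x) ≤ 1 := (vD F D).map_sub_le hy1.le hx1.le
  rcases hδle.lt_or_eq with hδ | hδ
  swap
  · have := hcomm y hy1.le
    rwa [← hprod, map_mul, hδ, one_mul] at this
  exfalso
  -- if `y = x`, then `w` commutes with the generators `x` and `w` of `D`
  by_cases hδ0 : y - x = 0
  · have hwx : w * x = x * w := by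
      have h3 : y * w = x * w := by rw [sub_eq_zero.1 hδ0]
      rwa [hy, mul_assoc, inv_mul_cancel₀ hw0, mul_one] at h3
    obtain ⟨z, hz⟩ := not_central_of_vD_eq hw
    refine hz ?_
    obtain ⟨c, d, e, f, rfl⟩ := hx.exists_coords hw z
    have key (c d : F) : w * (algebraMap F D c + d • x) = (algebraMap F D c + d • x) * w := by
      rw [mul_add, add_mul, Algebra.commutes, mul_smul_comm, smul_mul_assoc, hwx]
    rw [mul_add w (_ + _), add_mul (_ + _) _ w, key, ← mul_assoc, key]
  · -- the elements of `Dˣ` that commute with the residue of `x` form a subgroup, which contains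
    -- the units of `𝔬_D` and `w`
    let S : Subgroup Dˣ :=
      { carrier := {u | vD F D (u * x * ((u⁻¹ : Dˣ) : D) - x) < 1}
        one_mem' := by simp
        mul_mem' := by
          intro u v hu hv
          have h1 : ((u * v : Dˣ) : D) * x * (((u * v)⁻¹ : Dˣ) : D) - x =
              u * (v * x * ((v⁻¹ : Dˣ) : D) - x) * ((u⁻¹ : Dˣ) : D) +
                (u * x * ((u⁻¹ : Dˣ) : D) - x) := by
            rw [mul_inv_rev, Units.val_mul, Units.val_mul]
            noncomm_ring
          rw [Set.mem_ofPred_eq, h1]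
          refine (vD F D).map_add_lt ?_ hu
          rw [map_mul, map_mul, mul_right_comm, ← map_mul, Units.mul_inv, map_one, one_mul]
          exact hv
        inv_mem' := by
          intro u hu
          have h1 : ((u⁻¹ : Dˣ) : D) * x * (((u⁻¹)⁻¹ : Dˣ) : D) - x =
              -(((u⁻¹ : Dˣ) : D) * (u * x * ((u⁻¹ : Dˣ) : D) - x) * u) := by
            rw [inv_inv, mul_sub, sub_mul]
            simp [mul_assoc]
          rw [Set.mem_ofPred_eq, h1, Valuation.map_neg, map_mul, map_mul, mul_right_comm, ← map_mul,
            Units.inv_mul, map_one, one_mul]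
          exact hu }
    have hwS : Units.mk0 w hw0 ∈ S := by
      change vD F D (w * x * ((Units.mk0 w hw0)⁻¹ : Dˣ) - x) < 1
      rw [Units.val_inv_eq_inv_val]
      exact hδ
    have hunit (u : Dˣ) (hu : vD F D u = 1) : u ∈ S := by
      have h1 : (u : D) * x * ((u⁻¹ : Dˣ) : D) - x = (u * x - x * u) * ((u⁻¹ : Dˣ) : D) := by
        rw [sub_mul, mul_assoc x, Units.mul_inv, mul_one]
      change vD F D (u * x * ((u⁻¹ : Dˣ) : D) - x) < 1
      rw [h1, map_mul, Units.val_inv_eq_inv_val, map_inv₀, hu, inv_one, mul_one]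
      exact hcomm _ hu.le
    have hall (u : Dˣ) : u ∈ S := by
      obtain ⟨j, hj⟩ := eq_exp_of_ne_zero ((vD F D).ne_zero_iff.2 u.ne_zero)
      have h1 : u * Units.mk0 w hw0 ^ j ∈ S := by
        refine hunit _ ?_
        rw [Units.val_mul, Units.val_zpow_eq_zpow_val, map_mul, Units.val_mk0, vD_zpow hw, hj,
          ← exp_add, add_neg_cancel, exp_zero]
      exact (Subgroup.mul_mem_cancel_right S (S.zpow_mem hwS j)).1 h1
    have hε := hall (Units.mk0 (y - x) hδ0)
    change vD F D ((y - x) * x * ((Units.mk0 (y - x) hδ0)⁻¹ : Dˣ) - x) < 1 at hε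
    rw [Units.val_inv_eq_inv_val, Units.val_mk0] at hε
    set δ := y - x with hδdef
    have hyx : y = x + δ := by rw [hδdef]; abel
    have h3 : x * δ + δ * x + δ * δ + a • δ = 0 := by
      have : x * δ + δ * x + δ * δ + a • δ =
          (y * y + a • y + algebraMap F D b) - (x * x + a • x + algebraMap F D b) := by
        rw [hyx, mul_add, add_mul, add_mul, smul_add]
        abel
      rw [this, hyy, h, sub_zero]
    -- comparing the quadratic equations of `x` and `x + δ` gives that the trace `a` is small
    have h4 : algebraMap F D a = -(((1 + 1 : F) • x) + (δ * x * δ⁻¹ - x) + δ) := by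
      have h5 : (x * δ + δ * x + δ * δ + a • δ) * δ⁻¹ = 0 := by rw [h3, zero_mul]
      rw [add_mul, add_mul, add_mul, mul_inv_cancel_right₀ hδ0, mul_inv_cancel_right₀ hδ0,
        Algebra.smul_def, mul_inv_cancel_right₀ hδ0] at h5
      rw [eq_neg_iff_add_eq_zero, add_smul, one_smul, ← h5]
      abel
    have h6 : vD F D (algebraMap F D a) < 1 := by
      rw [h4, Valuation.map_neg]
      refine (vD F D).map_add_lt ((vD F D).map_add_lt ?_ hε) hδ
      rw [vD_smul, hx1, mul_one]
      exact pow_lt_one₀ zero_le (vF_two_lt_one hp) two_ne_zero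
    rw [vD_algebraMap, hone, one_pow] at h6
    exact lt_irrefl _ h6

end ResidueD

/-! ### A generator of the residue field of `D` -/

section DihedralDef

/-- The quotient of `G` by the normal subgroup `Z` is dihedral of order `2 r`, with `r` odd: it is
generated by the rotation `θ` of order `r` and the reflection `w`. -/
structure IsDihedralMod {G : Type*} [Group G] (Z : Subgroup G) [Z.Normal] (θ w : G) (r : ℕ) :
    Prop where
  odd : Odd r
  pow_eq_one_iff : ∀ k : ℕ, (θ : G ⧸ Z) ^ k = 1 ↔ r ∣ k
  w_mul_w : (w : G ⧸ Z) * w = 1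
  conj : (w : G ⧸ Z) * θ * w * θ = 1
  gen : ∀ g : G ⧸ Z, ∃ i : ℕ, g = (θ : G ⧸ Z) ^ i ∨ g = (θ : G ⧸ Z) ^ i * w

end DihedralDef

section ResidueGroup

open WithZero Polynomial

variable {F : Type*} [Field F] [ValuativeRel F] [TopologicalSpace F] [IsNonarchimedeanLocalField F]
variable {D : Type*} [DivisionRing D] [Algebra F D] [Algebra.IsCentral F D]
variable [hD : Fact (Module.finrank F D = 4)]
variable {x w : D}

/-- An element of `D` generating the multiplicative group of the residue field of `D`. It is found
in the field `F[x]`, whose residue field is that of `D`; the group is cyclic of order `q ^ 2 - 1`,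
and the units of the residue field of `F` have index `q + 1` in it. -/
theorem IsResidueGenerator.exists_generator (hx : IsResidueGenerator F x)
    (hw : vD F D w = exp (-1)) : ∃ θ : Dˣ, vD F D θ = 1 ∧
      (∀ k : ℕ, (∃ a : F, vD F D ((θ : D) ^ k - algebraMap F D a) < 1) ↔ Nat.card 𝓀[F] + 1 ∣ k) ∧
      ∀ u : D, vD F D u = 1 → ∃ i : ℕ, vD F D (u - (θ : D) ^ i) < 1 := by
  have : FiniteDimensional F D := .of_finrank_pos (by rw [hD.out]; omega)
  have hint : IsIntegral F x := (Algebra.IsIntegral.of_finite F D).isIntegral x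
  have : Fact (Irreducible (minpoly F x)) := ⟨minpoly.irreducible hint⟩
  let f : AdjoinRoot (minpoly F x) →ₐ[F] D := simpleHom x
  have hf : f (AdjoinRoot.root (minpoly F x)) = x := simpleHom_root x
  let vL : Valuation (AdjoinRoot (minpoly F x)) ℤᵐ⁰ := (vD F D).comap f.toRingHom
  have hvL (l) : vL l = vD F D (f l) := rfl
  have hvLF (a : F) : vL (algebraMap F _ a) = vF F a ^ 2 := by
    rw [hvL, AlgHom.commutes, vD_algebraMap]
  let R := vL.integer
  let k := IsLocalRing.ResidueField R
  have hres (l : R) : IsLocalRing.residue R l = 0 ↔ vL l < 1 := by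
    rw [IsLocalRing.residue_eq_zero_iff, IsLocalRing.mem_maximalIdeal, mem_nonunits_iff,
      (Valuation.integer.integers vL).isUnit_iff_valuation_eq_one]
    exact ⟨fun h => lt_of_le_of_ne l.2 h, fun h => h.ne⟩
  let i : 𝒪[F] →+* R := ((algebraMap F (AdjoinRoot (minpoly F x))).comp (𝒪[F]).subtype).codRestrict
    _ (by
      intro c
      change vL (algebraMap F _ (c : F)) ≤ 1
      rw [hvLF]
      exact pow_le_one' (mem_integer_iff.1 c.2) 2)
  have hi (c : 𝒪[F]) : (i c : AdjoinRoot (minpoly F x)) = algebraMap F _ (c : F) := rfl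
  let j : 𝓀[F] →+* k := Ideal.Quotient.lift 𝓂[F] ((IsLocalRing.residue R).comp i) (by
    intro c hc
    rw [RingHom.comp_apply, hres, hi, hvLF]
    exact pow_lt_one₀ zero_le ((mem_maximalIdeal_iff c).1 hc) two_ne_zero)
  have hj (c : 𝒪[F]) : j (IsLocalRing.residue 𝒪[F] c) = IsLocalRing.residue R (i c) := rfl
  let ξ : R := ⟨AdjoinRoot.root (minpoly F x), by
    change vL _ ≤ 1
    rw [hvL, hf, hx.vD_eq_one]⟩
  have hlift {y : D} (hy : vD F D y ≤ 1) : ∃ a b : 𝒪[F],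
      vD F D (y - f (i a + i b * ξ : R)) < 1 := by
    obtain ⟨a, b, ha, hb, h⟩ := hx.exists_residue hw hy
    refine ⟨⟨a, mem_integer_iff.2 ha⟩, ⟨b, mem_integer_iff.2 hb⟩, ?_⟩
    have h1 : f ((i ⟨a, mem_integer_iff.2 ha⟩ + i ⟨b, mem_integer_iff.2 hb⟩ * ξ : R)) =
        algebraMap F D a + b • x := by
      change f (algebraMap F _ a + algebraMap F _ b * AdjoinRoot.root _) = _
      rw [map_add, map_mul, AlgHom.commutes, AlgHom.commutes, hf, Algebra.smul_def]
    rwa [h1]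
  -- the residue field has `q ^ 2` elements
  let φ : 𝓀[F] × 𝓀[F] →+ k :=
    { toFun p := j p.1 + j p.2 * IsLocalRing.residue R ξ
      map_zero' := by simp
      map_add' p p' := by simp only [Prod.fst_add, Prod.snd_add, map_add]; ring }
  have hφ : Function.Bijective φ := by
    constructor
    · rw [injective_iff_map_eq_zero]
      rintro ⟨α, β⟩ h
      obtain ⟨a, rfl⟩ := IsLocalRing.residue_surjective α
      obtain ⟨b, rfl⟩ := IsLocalRing.residue_surjective β
      change j _ + j _ * _ = 0 at h
      rw [hj, hj, ← map_mul, ← map_add, hres] at h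
      change vL (algebraMap F _ (a : F) + algebraMap F _ (b : F) * AdjoinRoot.root _) < 1 at h
      rw [hvL, map_add, map_mul, AlgHom.commutes, AlgHom.commutes, hf, ← Algebra.smul_def,
        hx.vD_add_smul] at h
      have h1 := max_lt_iff.1 (sq_lt_one_imp h)
      exact Prod.ext ((IsLocalRing.residue_eq_zero_iff _).2 ((mem_maximalIdeal_iff a).2 h1.1))
        ((IsLocalRing.residue_eq_zero_iff _).2 ((mem_maximalIdeal_iff b).2 h1.2))
    · intro y
      obtain ⟨l, rfl⟩ := IsLocalRing.residue_surjective y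
      obtain ⟨a, b, hab⟩ := hlift (y := f l) l.2
      refine ⟨(IsLocalRing.residue _ a, IsLocalRing.residue _ b), ?_⟩
      change j _ + j _ * _ = _
      rw [hj, hj, ← map_mul, ← map_add, eq_comm, ← sub_eq_zero, ← map_sub, hres, hvL]
      rw [← map_sub] at hab
      exact hab
  have hfin : Finite k := Finite.of_surjective φ hφ.2
  set q := Nat.card 𝓀[F] with hq
  have hcard : Nat.card k = q * q := by
    rw [← Nat.card_congr (Equiv.ofBijective φ hφ), Nat.card_prod]
  have hq1 : 1 < q := Finite.one_lt_card
  have hcardu : Nat.card kˣ = (q - 1) * (q + 1) := by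
    rw [Nat.card_units, hcard]
    obtain ⟨m, hm⟩ : ∃ m, q = m + 1 := ⟨q - 1, by omega⟩
    rw [hm]
    simp only [Nat.add_sub_cancel]
    have : (m + 1) * (m + 1) = m * (m + 1 + 1) + 1 := by ring
    omega
  let J : Subgroup kˣ := (Units.map (j : 𝓀[F] →* k)).range
  have hJ : Nat.card J = q - 1 := by
    have hinj : Function.Injective (Units.map (j : 𝓀[F] →* k)) :=
      Units.map_injective j.injective
    rw [← Nat.card_congr (MonoidHom.ofInjective hinj).toEquiv, Nat.card_units]
  have hJi : J.index = q + 1 := by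
    have := J.card_mul_index
    rw [hJ, hcardu] at this
    exact Nat.eq_of_mul_eq_mul_left (by omega) this
  obtain ⟨ζ, hζ⟩ := IsCyclic.exists_generator (α := kˣ)
  have hpow (m : ℕ) : ζ ^ m ∈ J ↔ q + 1 ∣ m := by
    constructor
    · intro h
      have h1 : (ζ ^ m) ^ (q - 1) = 1 := by
        have := pow_card_eq_one' (x := (⟨ζ ^ m, h⟩ : J))
        rw [hJ] at this
        simpa using congrArg Subtype.val this
      rw [← pow_mul] at h1
      have h2 := orderOf_dvd_of_pow_eq_one h1
      rw [orderOf_eq_card_of_forall_mem_zpowers hζ, hcardu, mul_comm m] at h2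
      exact Nat.dvd_of_mul_dvd_mul_left (by omega) h2
    · rintro ⟨c, rfl⟩
      rw [pow_mul, ← hJi]
      exact J.pow_mem (J.pow_index_mem ζ) c
  obtain ⟨l, hl⟩ := IsLocalRing.residue_surjective (ζ : k)
  have hl1 : vL l = 1 := by
    refine le_antisymm l.2 (le_of_not_gt fun h => ?_)
    rw [← hres, hl] at h
    exact ζ.ne_zero h
  have hfl : vD F D (f l) = 1 := hl1
  have hfl0 : f l ≠ 0 := by
    rw [← (vD F D).ne_zero_iff, hfl]
    exact one_ne_zero
  refine ⟨Units.mk0 (f l) hfl0, hfl, fun m => ?_, fun u hu => ?_⟩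
  · rw [← hpow, Units.val_mk0]
    constructor
    · rintro ⟨a, ha⟩
      have ha1 : vF F a ≤ 1 := by
        refine sq_le_one_imp ?_
        rw [← vD_algebraMap (D := D)]
        have : algebraMap F D a = f l ^ m - (f l ^ m - algebraMap F D a) := by abel
        rw [this]
        refine (vD F D).map_sub_le ?_ ha.le
        rw [map_pow, hfl, one_pow]
      have h1 : (ζ : k) ^ m = j (IsLocalRing.residue _ ⟨a, mem_integer_iff.2 ha1⟩) := by
        rw [hj, ← hl, ← map_pow, ← sub_eq_zero, ← map_sub, hres, hvL]
        change vD F D (f (l ^ m - algebraMap F _ a)) < 1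
        rwa [map_sub, map_pow, AlgHom.commutes]
      have h2 : IsLocalRing.residue _ (⟨a, mem_integer_iff.2 ha1⟩ : 𝒪[F]) ≠ 0 := by
        intro h0
        rw [h0, map_zero] at h1
        exact (ζ ^ m).ne_zero (by rw [Units.val_pow_eq_pow_val, h1])
      exact ⟨Units.mk0 _ h2, Units.ext (by simpa using h1.symm)⟩
    · rintro ⟨α, hα⟩
      obtain ⟨a, ha⟩ := IsLocalRing.residue_surjective (α : 𝓀[F])
      refine ⟨a, ?_⟩
      have h1 : j (IsLocalRing.residue _ a) = (ζ : k) ^ m := by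
        rw [ha, ← Units.val_pow_eq_pow_val, ← hα]
        rfl
      rw [hj, ← hl, ← map_pow, eq_comm, ← sub_eq_zero, ← map_sub, hres, hvL] at h1
      change vD F D (f (l ^ m - algebraMap F _ (a : F))) < 1 at h1
      rwa [map_sub, map_pow, AlgHom.commutes] at h1
  · obtain ⟨a, b, hab⟩ := hlift hu.le
    have hne : IsLocalRing.residue R (i a + i b * ξ) ≠ 0 := by
      rw [Ne, hres, hvL]
      intro h
      have := (vD F D).map_add_lt hab h
      rw [sub_add_cancel, hu] at this
      exact lt_irrefl _ this
    obtain ⟨m, hm⟩ := mem_powers_iff_mem_zpowers.2 (hζ (Units.mk0 _ hne))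
    refine ⟨m, ?_⟩
    have h1 : (ζ : k) ^ m = IsLocalRing.residue R (i a + i b * ξ) := by
      have := congrArg Units.val hm
      simpa using this
    rw [← hl, ← map_pow, eq_comm, ← sub_eq_zero, ← map_sub, hres, hvL] at h1
    rw [Units.val_mk0]
    have h2 : u - f l ^ m = (u - f (i a + i b * ξ : R)) + f ((i a + i b * ξ : R) - (l ^ m : R)) := by
      rw [map_sub]
      simp
    rw [h2]
    exact (vD F D).map_add_lt hab h1

end ResidueGroup

/-! ### The dihedral group `D^× / F^× U_D^1` -/

section DihedralD

open WithZero

variable {F : Type*} [Field F] [ValuativeRel F] [TopologicalSpace F] [IsNonarchimedeanLocalField F]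
variable {D : Type*} [DivisionRing D] [Algebra F D]

instance congrSubgroup_normal (m : ℕ) : (congrSubgroup F D m).Normal :=
  ⟨fun _ hu g => conj_mem_congrSubgroup F D m g hu⟩

instance central_range_normal : (central F D).range.Normal := by
  refine ⟨?_⟩
  rintro _ ⟨a, rfl⟩ g
  refine ⟨a, Units.ext ?_⟩
  have h : (g : D) * algebraMap F D a = algebraMap F D a * g := (Algebra.commutes _ _).symm
  change algebraMap F D a = g * algebraMap F D a * ((g⁻¹ : Dˣ) : D)
  rw [h, Units.mul_inv_cancel_right]

variable (F D) in
/-- The subgroup `F^× U_D^1` of `D^×`, the kernel of the map to the dihedral group. -/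
def centreU : Subgroup Dˣ := (central F D).range ⊔ congrSubgroup F D 1

instance : (centreU F D).Normal := inferInstanceAs ((central F D).range ⊔ _).Normal

theorem central_mem_centreU (a : Fˣ) : central F D a ∈ centreU F D :=
  Subgroup.mem_sup_left ⟨a, rfl⟩

theorem congrSubgroup_le_centreU {m : ℕ} (hm : 1 ≤ m) : congrSubgroup F D m ≤ centreU F D :=
  (congrSubgroup_anti F D hm).trans le_sup_right

theorem mem_centreU_iff (g : Dˣ) :
    g ∈ centreU F D ↔ ∃ a : Fˣ, ∃ u ∈ congrSubgroup F D 1, g = central F D a * u := by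
  rw [centreU, Subgroup.mem_sup_of_normal_right]
  constructor
  · rintro ⟨_, ⟨a, rfl⟩, u, hu, rfl⟩
    exact ⟨a, u, hu, rfl⟩
  · rintro ⟨a, u, hu, rfl⟩
    exact ⟨_, ⟨a, rfl⟩, u, hu, rfl⟩

variable [Algebra.IsCentral F D] [hD : Fact (Module.finrank F D = 4)]
variable {x w : D}

theorem mem_congrSubgroup_one_iff (u : Dˣ) :
    u ∈ congrSubgroup F D 1 ↔ vD F D ((u : D) - 1) < 1 := by
  rw [mem_congrSubgroup_iff le_rfl, lt_one_iff_le_exp, Nat.cast_one]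

/-- The elements of `F^× U_D^1` are those with the same leading term as an element of `F`. -/
theorem mem_centreU_iff_exists_vD_sub_lt (g : Dˣ) :
    g ∈ centreU F D ↔ ∃ a : F, vD F D ((g : D) - algebraMap F D a) < vD F D g := by
  rw [mem_centreU_iff]
  constructor
  · rintro ⟨a, u, hu, rfl⟩
    have h1 := (mem_congrSubgroup_one_iff u).1 hu
    have h2 : vD F D u = 1 := by
      have := (vD F D).map_one_add_of_lt h1
      rwa [add_sub_cancel] at this
    refine ⟨a, ?_⟩
    have h3 : ((central F D a * u : Dˣ) : D) - algebraMap F D a = algebraMap F D a * (u - 1) := by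
      rw [mul_sub, mul_one]
      rfl
    have h4 : ((central F D a * u : Dˣ) : D) = algebraMap F D a * u := rfl
    rw [h3, h4, map_mul, map_mul, h2, mul_one]
    refine mul_lt_of_lt_one_right ?_ h1
    rw [zero_lt_iff, (vD F D).ne_zero_iff, map_ne_zero]
    exact a.ne_zero
  · rintro ⟨a, ha⟩
    have ha0 : a ≠ 0 := by
      rintro rfl
      rw [map_zero, sub_zero] at ha
      exact lt_irrefl _ ha
    have hag : vD F D (algebraMap F D a) = vD F D g := by
      have := Valuation.map_add_eq_of_lt_right (vD F D) (x := -((g : D) - algebraMap F D a)) (y := g)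
        (by rwa [Valuation.map_neg])
      rwa [neg_sub, sub_add_cancel] at this
    refine ⟨Units.mk0 a ha0, (central F D (Units.mk0 a ha0))⁻¹ * g, ?_, by group⟩
    rw [mem_congrSubgroup_one_iff]
    have h1 : (((central F D (Units.mk0 a ha0))⁻¹ * g : Dˣ) : D) - 1 =
        (algebraMap F D a)⁻¹ * (g - algebraMap F D a) := by
      have h0 : algebraMap F D a ≠ 0 := by rwa [Ne, map_eq_zero]
      rw [mul_sub, inv_mul_cancel₀ h0, Units.val_mul, Units.val_inv_eq_inv_val]
      rfl
    rw [h1, map_mul, map_inv₀, hag]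
    rw [hag.symm] at ha ⊢
    have h0 : 0 < vD F D (algebraMap F D a) := by
      rw [zero_lt_iff, (vD F D).ne_zero_iff, map_ne_zero]
      exact ha0
    rwa [inv_mul_lt_one₀ h0]

theorem not_mem_centreU_of_vD_eq {g : Dˣ} (hg : vD F D g = exp (-1)) : g ∉ centreU F D := by
  rw [mem_centreU_iff_exists_vD_sub_lt]
  rintro ⟨a, ha⟩
  have hag : vD F D (algebraMap F D a) = vD F D g := by
    have := Valuation.map_add_eq_of_lt_right (vD F D) (x := -((g : D) - algebraMap F D a)) (y := g)
      (by rwa [Valuation.map_neg])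
    rwa [neg_sub, sub_add_cancel] at this
  rw [vD_algebraMap, hg] at hag
  have h0 : vF F a ≠ 0 := by
    intro h0
    rw [h0, zero_pow two_ne_zero] at hag
    exact exp_ne_zero hag.symm
  exact sq_ne_sq_mul_exp_neg_one (δ := 1) h0 (by rw [hag, one_pow, one_mul])

theorem even_card_residueField (hp : ringChar 𝓀[F] = 2) : Even (Nat.card 𝓀[F]) := by
  have : CharP 𝓀[F] 2 := by rw [← hp]; infer_instance
  have := Fintype.ofFinite 𝓀[F]
  rw [Nat.card_eq_fintype_card]
  obtain ⟨n, hn, h⟩ := FiniteField.card 𝓀[F] 2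
  rw [h]
  exact Nat.even_pow.2 ⟨even_two, n.ne_zero⟩

/-- The group `D^× / F^× U_D^1` is dihedral of order `2 (q + 1)`: the square of a uniformizer has
the leading term of a central element, and `w θ w⁻¹ θ` has the leading term of the norm of the
residue of `θ`. -/
theorem exists_isDihedralMod (hp : ringChar 𝓀[F] = 2) (hx : IsResidueGenerator F x) (w : Dˣ)
    (hw : vD F D w = exp (-1)) :
    ∃ θ : Dˣ, IsDihedralMod (centreU F D) θ w (Nat.card 𝓀[F] + 1) := by
  obtain ⟨θ, hθ1, hθpow, hθgen⟩ := hx.exists_generator hw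
  have hmk {g : Dˣ} : (g : Dˣ ⧸ centreU F D) = 1 ↔
      ∃ a : F, vD F D ((g : D) - algebraMap F D a) < vD F D g := by
    rw [QuotientGroup.eq_one_iff, mem_centreU_iff_exists_vD_sub_lt]
  have hw2 : (w : Dˣ ⧸ centreU F D) * w = 1 := by
    have hwF : (w : D) ∉ Set.range (algebraMap F D) := by
      rintro ⟨a, ha⟩
      refine not_mem_centreU_of_vD_eq hw ?_
      rw [mem_centreU_iff_exists_vD_sub_lt]
      exact ⟨a, by rw [ha, sub_self, map_zero, hw]; exact exp_pos⟩
    obtain ⟨a, ha, hroot⟩ := exists_quadratic hD.out hwF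
    have hav := vF_sq_le_of_no_root hroot
    rw [← vD_apply, hw] at hav
    have hav1 : vF F a < 1 := sq_lt_one_imp (hav.trans_lt (by rw [← exp_zero, exp_lt_exp]; omega))
    rw [← QuotientGroup.mk_mul, hmk]
    refine ⟨-nrd F (w : D), ?_⟩
    have h1 : ((w * w : Dˣ) : D) - algebraMap F D (-nrd F (w : D)) = -(a • (w : D)) := by
      rw [map_neg, sub_neg_eq_add, eq_neg_iff_add_eq_zero, ← ha, Units.val_mul]
      abel
    rw [h1, Valuation.map_neg, vD_smul, Units.val_mul, map_mul]
    refine mul_lt_mul_of_pos_right ?_ (by rw [hw]; exact exp_pos)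
    rw [lt_one_iff_le_exp] at hav1
    refine (pow_le_pow_left' hav1 2).trans_lt ?_
    rw [hw, ← exp_nsmul, exp_lt_exp, nsmul_eq_mul]
    norm_num
  refine ⟨θ, ⟨?_, fun k => ?_, hw2, ?_, fun g => ?_⟩⟩
  · exact (even_card_residueField hp).add_one
  · rw [← QuotientGroup.mk_pow, hmk, Units.val_pow_eq_pow_val, map_pow, hθ1, one_pow, hθpow]
  · have hw0 : (w : D) ≠ 0 := w.ne_zero
    have hxF : x ∉ Set.range (algebraMap F D) := by
      rintro ⟨a, rfl⟩
      have := hx.one_le a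
      rw [sub_self, map_zero] at this
      exact absurd this (by simp)
    obtain ⟨a, ha, hroot⟩ := exists_quadratic hD.out hxF
    have hb : vF F (nrd F x) ≤ 1 := hx.vD_eq_one.le
    have ha1 : vF F a ≤ 1 := sq_le_one_imp ((vF_sq_le_of_no_root hroot).trans hb)
    have hconj := hx.vD_conj_add_lt hp hw ha ha1 hb
    obtain ⟨α, β, hα, hβ, hαβ⟩ := hx.exists_residue hw hθ1.le
    have hww : (w : Dˣ ⧸ centreU F D) = (w⁻¹ : Dˣ) := by
      rw [QuotientGroup.mk_inv]
      exact eq_inv_of_mul_eq_one_left hw2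
    have h0 : (w : Dˣ ⧸ centreU F D) * θ * w * θ = ((w * θ * w⁻¹ * θ : Dˣ) : Dˣ ⧸ centreU F D) := by
      rw [QuotientGroup.mk_mul, QuotientGroup.mk_mul, QuotientGroup.mk_mul, ← hww]
    rw [h0, hmk]
    have hval : vD F D ((w * θ * w⁻¹ * θ : Dˣ) : D) = 1 := by
      simp only [Units.val_mul, map_mul, hθ1, mul_one, Units.val_inv_eq_inv_val, map_inv₀]
      exact mul_inv_cancel₀ ((vD F D).ne_zero_iff.2 hw0)
    rw [hval]
    -- for `θ` congruent to `α + β x`, this is the norm of `α + β x`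
    refine ⟨α * α - α * β * a + β * β * nrd F x, ?_⟩
    set l := algebraMap F D α + β • x with hl
    set A := (w : D) * θ * (w : D)⁻¹ with hA
    set A' := algebraMap F D (α - β * a) - β • x with hA'
    have h1 : algebraMap F D (α * α - α * β * a + β * β * nrd F x) = A' * l := by
      have h2 : x * x = -(a • x + algebraMap F D (nrd F x)) := by
        rw [eq_neg_iff_add_eq_zero, ← add_assoc, ha]
      have hcx (c : F) : x * algebraMap F D c = algebraMap F D c * x := (Algebra.commutes _ _).symm
      rw [hA', hl]
      simp only [Algebra.smul_def, map_add, map_sub, map_mul, sub_mul, mul_add] at h2 ⊢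
      have h3 : algebraMap F D β * x * (algebraMap F D β * x) =
          algebraMap F D β * algebraMap F D β * (x * x) := by
        rw [mul_assoc, ← mul_assoc x, hcx, mul_assoc, mul_assoc]
      have h4 : algebraMap F D β * x * algebraMap F D α = algebraMap F D α * algebraMap F D β * x := by
        rw [mul_assoc, hcx, ← mul_assoc, ← map_mul, ← map_mul, mul_comm]
      have h5 (c d : F) : algebraMap F D c * algebraMap F D d = algebraMap F D d * algebraMap F D c :=
        Algebra.commutes _ _
      rw [h3, h4, h2, mul_neg, mul_add]
      have h6 : algebraMap F D β * algebraMap F D a * (algebraMap F D β * x) =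
          algebraMap F D β * algebraMap F D β * (algebraMap F D a * x) := by
        rw [mul_assoc, ← mul_assoc (algebraMap F D a), h5 a β, mul_assoc, mul_assoc]
      have h7 : algebraMap F D β * algebraMap F D a * algebraMap F D α =
          algebraMap F D α * algebraMap F D β * algebraMap F D a := by
        simp only [← map_mul]
        congr 1
        ring
      rw [h6, h7, ← mul_assoc (algebraMap F D α)]
      abel
    have h2 : ((w * θ * w⁻¹ * θ : Dˣ) : D) = A * θ := by
      simp only [Units.val_mul, Units.val_inv_eq_inv_val, hA]
    rw [h2, h1]
    have h3 (A A' t l : D) : A * t - A' * l = (A - A') * t + A' * (t - l) := by noncomm_ring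
    have h4 : A - A' = w * (θ - l) * (w : D)⁻¹ + β • ((w : D) * x * (w : D)⁻¹ + algebraMap F D a + x) := by
      rw [hA, hA', hl, mul_sub, sub_mul, mul_add, add_mul, ← Algebra.commutes, mul_assoc _ (w : D) _,
        mul_inv_cancel₀ hw0, mul_one, mul_smul_comm, smul_mul_assoc, smul_add, smul_add, map_sub,
        map_mul, ← Algebra.smul_def]
      abel
    rw [h3]
    refine (vD F D).map_add_lt ?_ ?_
    · rw [map_mul, hθ1, mul_one, h4]
      refine (vD F D).map_add_lt ?_ ?_
      · rw [map_mul, map_mul, mul_right_comm, ← map_mul, mul_inv_cancel₀ hw0, map_one, one_mul]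
        exact hαβ
      · rw [vD_smul]
        exact mul_lt_one_of_nonneg_of_lt_one_right (pow_le_one' hβ 2) zero_le hconj
    · rw [map_mul]
      refine mul_lt_one_of_nonneg_of_lt_one_right ((vD F D).map_sub_le ?_ ?_) zero_le hαβ
      · rw [vD_algebraMap]
        refine pow_le_one' ((vF F).map_sub_le hα ?_) 2
        rw [map_mul]
        exact mul_le_one' hβ ha1
      · rw [vD_smul, hx.vD_eq_one, mul_one]
        exact pow_le_one' hβ 2
  · obtain ⟨g, rfl⟩ := QuotientGroup.mk_surjective g
    obtain ⟨j, hj⟩ := eq_exp_of_ne_zero ((vD F D).ne_zero_iff.2 g.ne_zero)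
    have hu : vD F D ((g * w ^ j : Dˣ) : D) = 1 := by
      rw [Units.val_mul, Units.val_zpow_eq_zpow_val, map_mul, vD_zpow hw, hj, ← exp_add,
        add_neg_cancel, exp_zero]
    obtain ⟨i, hi⟩ := hθgen _ hu
    have h1 : ((g * w ^ j : Dˣ) : Dˣ ⧸ centreU F D) = (θ ^ i : Dˣ) := by
      rw [eq_comm, QuotientGroup.eq]
      refine congrSubgroup_le_centreU le_rfl ?_
      rw [mem_congrSubgroup_one_iff]
      have h2 : (((θ ^ i)⁻¹ * (g * w ^ j) : Dˣ) : D) - 1 =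
          (((θ ^ i)⁻¹ : Dˣ) : D) * (((g * w ^ j : Dˣ) : D) - (θ : D) ^ i) := by
        rw [mul_sub, ← Units.val_mul, ← Units.val_pow_eq_pow_val, Units.inv_mul]
      rw [h2, map_mul, Units.val_inv_eq_inv_val, map_inv₀, Units.val_pow_eq_pow_val, map_pow, hθ1,
        one_pow, inv_one, one_mul]
      exact hi
    refine ⟨i, ?_⟩
    rw [QuotientGroup.mk_mul, QuotientGroup.mk_zpow, QuotientGroup.mk_pow] at h1
    rw [eq_mul_inv_of_mul_eq h1, ← zpow_neg]
    have hsq : (w : Dˣ ⧸ centreU F D) ^ (2 : ℤ) = 1 := by rw [zpow_two, hw2]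
    obtain ⟨m, hm | hm⟩ := (-j).even_or_odd'
    · left
      rw [hm, zpow_mul, hsq, one_zpow, mul_one]
    · right
      rw [hm, zpow_add, zpow_mul, hsq, one_zpow, one_mul, zpow_one]

/-- A uniformizer generates the totally ramified extension `E` over `F`. -/
theorem exists_coords_quadratic {E : Type*} [Field E] [Algebra F E]
    (hE : Module.finrank F E = 2) (ι : E →ₐ[F] D) (w₀ : E) (hw : vD F D (ι w₀) = exp (-1)) (e : E) :
    ∃ a b : F, e = algebraMap F E a + b • w₀ := by
  have : FiniteDimensional F E := .of_finrank_pos (by omega)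
  let φ : F × F →ₗ[F] E :=
    { toFun p := algebraMap F E p.1 + p.2 • w₀
      map_add' p p' := by simp only [Prod.fst_add, Prod.snd_add, map_add, add_smul]; abel
      map_smul' t p := by
        simp only [Prod.smul_fst, Prod.smul_snd, smul_eq_mul, map_mul, mul_smul,
          RingHom.id_apply, smul_add, Algebra.smul_def t (algebraMap F E _)] }
  have hφ : Function.Injective φ := by
    rw [injective_iff_map_eq_zero]
    rintro ⟨a, b⟩ h
    have h2 : algebraMap F D a = -(b • ι w₀) := by
      rw [eq_neg_iff_add_eq_zero, ← map_smul, ← ι.commutes, ← map_add]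
      exact (congrArg ι h).trans (map_zero ι)
    have h3 := congrArg (vD F D) h2
    rw [Valuation.map_neg, vD_algebraMap, vD_smul, hw] at h3
    have ha : a = 0 := by
      by_contra ha
      exact sq_ne_sq_mul_exp_neg_one ((vF F).ne_zero_iff.2 ha) h3
    have hb : b = 0 := by
      rw [ha, map_zero, eq_comm, neg_eq_zero, smul_eq_zero] at h2
      exact h2.resolve_right fun h0 => by
        rw [h0, map_zero] at hw
        exact exp_ne_zero hw.symm
    rw [ha, hb]
    rfl
  have hsurj := (LinearMap.injective_iff_surjective_of_finrank_eq_finrank (f := φ)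
    (by rw [hE]; simp)).1 hφ
  obtain ⟨⟨a, b⟩, h⟩ := hsurj e
  exact ⟨a, b, h.symm⟩

/-- The leading term of an element `a + b w₀` of `E` is that of `a` or that of `b w₀`. -/
theorem EU_eq_or (E : Type*) [Field E] [Algebra F E] (hE : Module.finrank F E = 2) (ι : E →ₐ[F] D)
    (w₀ : E) (w : Dˣ) (hw₀ : (w : D) = ι w₀) (hw : vD F D w = exp (-1)) {k : ℕ} (hk : 1 ≤ k) (h : Dˣ)
    (hh : h ∈ EU F D ι k) : (h : Dˣ ⧸ centreU F D) = 1 ∨ (h : Dˣ ⧸ centreU F D) = w := by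
  rw [EU, Subgroup.mem_sup_of_normal_right] at hh
  obtain ⟨_, ⟨e, rfl⟩, u, hu, rfl⟩ := hh
  have hu1 : (u : Dˣ ⧸ centreU F D) = 1 :=
    (QuotientGroup.eq_one_iff u).2 (congrSubgroup_le_centreU hk hu)
  rw [QuotientGroup.mk_mul, hu1, mul_one]
  obtain ⟨a, b, hab⟩ := exists_coords_quadratic hE ι w₀ (hw₀ ▸ hw) (e : E)
  set g : Dˣ := Units.map (ι : E →* D) e with hg
  have hgD : (g : D) = algebraMap F D a + b • (w : D) := by
    change ι e = _
    rw [hab, map_add, map_smul, AlgHom.commutes, hw₀]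
  have hne : vF F a ^ 2 ≠ vF F b ^ 2 * exp (-1) := by
    intro heq
    by_cases ha : vF F a = 0
    · rw [ha, zero_pow two_ne_zero, eq_comm, mul_eq_zero_iff_right exp_ne_zero,
        pow_eq_zero_iff two_ne_zero, (vF F).zero_iff] at heq
      rw [(vF F).zero_iff] at ha
      refine g.ne_zero ?_
      rw [hgD, ha, heq, map_zero, zero_smul, add_zero]
    · exact sq_ne_sq_mul_exp_neg_one ha heq
  have hva : vD F D (algebraMap F D a) = vF F a ^ 2 := vD_algebraMap a
  have hvb : vD F D (b • (w : D)) = vF F b ^ 2 * exp (-1) := by rw [vD_smul, hw]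
  rcases lt_or_gt_of_ne hne with hlt | hlt
  · right
    rw [← hva, ← hvb] at hlt
    rw [← mul_inv_eq_one, ← QuotientGroup.mk_inv, ← QuotientGroup.mk_mul, QuotientGroup.eq_one_iff,
      mem_centreU_iff_exists_vD_sub_lt]
    refine ⟨b, ?_⟩
    have h1 : ((g * w⁻¹ : Dˣ) : D) - algebraMap F D b = algebraMap F D a * ((w⁻¹ : Dˣ) : D) := by
      rw [Units.val_mul, hgD, add_mul, smul_mul_assoc, Units.mul_inv, Algebra.smul_def, mul_one]
      abel
    rw [h1, Units.val_mul, map_mul, map_mul, hgD, Valuation.map_add_eq_of_lt_right _ hlt]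
    refine mul_lt_mul_of_pos_right hlt ?_
    rw [zero_lt_iff, (vD F D).ne_zero_iff]
    exact (w⁻¹).ne_zero
  · left
    rw [← hva, ← hvb] at hlt
    rw [QuotientGroup.eq_one_iff, mem_centreU_iff_exists_vD_sub_lt]
    refine ⟨a, ?_⟩
    rw [hgD, add_sub_cancel_left, Valuation.map_add_eq_of_lt_left _ hlt]
    exact hlt

theorem sq_mem_congrSubgroup (hp : ringChar 𝓀[F] = 2) {m : ℕ} (hm : 1 ≤ m) {u : Dˣ}
    (hu : u ∈ congrSubgroup F D m) : u * u ∈ congrSubgroup F D (m + 1) := by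
  rw [mem_congrSubgroup_iff hm] at hu
  rw [mem_congrSubgroup_iff (by omega)]
  set y := (u : D) - 1 with hy
  have h1 : ((u * u : Dˣ) : D) - 1 = (1 + 1 : F) • y + y * y := by
    have : (u : D) = y + 1 := by rw [hy]; abel
    rw [Units.val_mul, this, add_smul, one_smul]
    noncomm_ring
  rw [h1]
  have h2 := vF_two_lt_one hp
  rw [lt_one_iff_le_exp] at h2
  refine (vD F D).map_add_le ?_ ?_
  · rw [vD_smul]
    refine (mul_le_mul' (pow_le_pow_left' h2 2) hu).trans ?_
    rw [← exp_nsmul, ← exp_add, exp_le_exp, nsmul_eq_mul]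
    push_cast
    omega
  · rw [map_mul]
    refine (mul_le_mul' hu hu).trans ?_
    rw [← exp_add, exp_le_exp]
    push_cast
    omega

theorem commutator_mem_congrSubgroup {m : ℕ} (hm : 1 ≤ m) {u v : Dˣ}
    (hu : u ∈ congrSubgroup F D m) (hv : v ∈ congrSubgroup F D m) :
    u * v * (v * u)⁻¹ ∈ congrSubgroup F D (m + 1) := by
  have hone {u : Dˣ} (hu : u ∈ congrSubgroup F D m) : vD F D u = 1 := by
    have h1 := (mem_congrSubgroup_one_iff u).1 (congrSubgroup_anti F D hm hu)
    have := (vD F D).map_one_add_of_lt h1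
    rwa [add_sub_cancel] at this
  have hvu := hone (mul_mem hv hu)
  rw [mem_congrSubgroup_iff hm] at hu hv
  rw [mem_congrSubgroup_iff (by omega)]
  have h1 : ((u * v * (v * u)⁻¹ : Dˣ) : D) - 1 =
      (((u : D) - 1) * (v - 1) - (v - 1) * (u - 1)) * (((v * u)⁻¹ : Dˣ) : D) := by
    have h2 : ((u : D) - 1) * (v - 1) - (v - 1) * (u - 1) = u * v - v * u := by noncomm_ring
    rw [h2, sub_mul, ← Units.val_mul v u, Units.mul_inv, Units.val_mul, Units.val_mul]
  rw [h1, map_mul, Units.val_inv_eq_inv_val (v * u), map_inv₀, hvu, inv_one, mul_one]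
  have h3 : exp (-(m : ℤ)) * exp (-(m : ℤ)) ≤ exp (-((m + 1 : ℕ) : ℤ)) := by
    rw [← exp_add, exp_le_exp]
    push_cast
    omega
  refine (vD F D).map_sub_le ?_ ?_ <;> rw [map_mul]
  · exact (mul_le_mul' hu hv).trans h3
  · exact (mul_le_mul' hv hu).trans h3

theorem pow_two_pow_mem_congrSubgroup (hp : ringChar 𝓀[F] = 2) {u : Dˣ}
    (hu : u ∈ congrSubgroup F D 1) (m : ℕ) : u ^ 2 ^ m ∈ congrSubgroup F D (m + 1) := by
  induction m with
  | zero => simpa using hu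
  | succ m ih =>
    rw [pow_succ, pow_mul, sq]
    exact sq_mem_congrSubgroup hp (by omega) ih

theorem central_norm_mem_congrSubgroup {u : Dˣ} (hu : u ∈ congrSubgroup F D 1) :
    central F D (Units.map (Algebra.norm F) u) ∈ congrSubgroup F D 1 := by
  rw [mem_congrSubgroup_one_iff] at hu ⊢
  have h1 := vF_norm_sub_one_lt hu
  rw [add_sub_cancel] at h1
  have h2 : ((central F D (Units.map (Algebra.norm F) u) : Dˣ) : D) - 1 =
      algebraMap F D (Algebra.norm F (u : D) - 1) := by
    rw [map_sub, map_one]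
    rfl
  rw [h2, vD_algebraMap]
  exact pow_lt_one₀ zero_le h1 two_ne_zero

end DihedralD

/-! ### The index of `E^× U_D^k` -/

section Index

open WithZero

/-- If `U` is normal and `U' ≤ U`, then `A U / A U'` has the same cardinality as
`U / (U ∩ A U')`. -/
theorem relIndex_sup_sup {G : Type*} [Group G] (A U U' : Subgroup G) [U.Normal] :
    (A ⊔ U').relIndex (A ⊔ U) = (A ⊔ U').relIndex U := by
  have hle : U ≤ A ⊔ U := le_sup_right
  let f := Subgroup.quotientSubgroupOfEmbeddingOfLE (A ⊔ U') hle
  refine (Nat.card_congr (Equiv.ofBijective f ⟨f.injective, fun y => ?_⟩)).symm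
  obtain ⟨⟨k, hk⟩, rfl⟩ := QuotientGroup.mk_surjective y
  have hk' := hk
  rw [sup_comm, Subgroup.mem_sup_of_normal_left] at hk'
  obtain ⟨u, hu, a, ha, rfl⟩ := hk'
  refine ⟨((⟨u, hu⟩ : U) : U ⧸ (A ⊔ U').subgroupOf U), ?_⟩
  rw [Subgroup.quotientSubgroupOfEmbeddingOfLE_apply_mk, QuotientGroup.eq, Subgroup.mem_subgroupOf]
  have : ((Subgroup.inclusion hle ⟨u, hu⟩)⁻¹ * ⟨u * a, hk⟩ : (A ⊔ U : Subgroup G)).1 = a := by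
    change u⁻¹ * (u * a) = a
    group
  rw [this]
  exact Subgroup.mem_sup_left ha

variable {F : Type*} [Field F] [ValuativeRel F] [TopologicalSpace F] [IsNonarchimedeanLocalField F]
variable {D : Type*} [DivisionRing D] [Algebra F D]
variable [Algebra.IsCentral F D] [hD : Fact (Module.finrank F D = 4)]
variable {x w : D}

theorem vF_coord_sq_le (hx : IsResidueGenerator F x) (hw : vD F D w = exp (-1)) {B : D →ₗ[F] F}
    (hB : ∀ a b c d : F, B ((algebraMap F D a + b • x) + (algebraMap F D c + d • x) * w) = b)
    (y : D) : vF F (B y) ^ 2 ≤ vD F D y := by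
  obtain ⟨a, b, c, d, rfl⟩ := hx.exists_coords hw y
  rw [hB, hx.vD_add_mul hw]
  exact le_max_of_le_left (pow_le_pow_left' (le_max_right _ _) 2)

/-- The residue of the coordinate of `(u - 1) / w ^ k` along `x` is a surjective homomorphism from
`U_D^k` to the additive group of the residue field of `F`, and its kernel is the intersection with
`E^× U_D^(k+1)`. -/
theorem relIndex_EU_succ {E : Type*} [Field E] [Algebra F E] (hE : Module.finrank F E = 2)
    (ι : E →ₐ[F] D) (w₀ : E) (hw : vD F D (ι w₀) = exp (-1)) (hx : IsResidueGenerator F x)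
    {k : ℕ} (hk : 1 ≤ k) : (EU F D ι (k + 1)).relIndex (EU F D ι k) = Nat.card 𝓀[F] := by
  obtain ⟨B, hB⟩ := hx.exists_coord_functional hw
  set w : D := ι w₀ with hwdef
  have hw0 : w ≠ 0 := by
    intro h0
    rw [h0, map_zero] at hw
    exact exp_ne_zero hw.symm
  have hBle := vF_coord_sq_le hx hw hB
  have hBE (e : E) : B (ι e) = 0 := by
    obtain ⟨a, b, rfl⟩ := exists_coords_quadratic hE ι w₀ hw e
    have := hB a 0 b 0
    rwa [zero_smul, add_zero, add_zero, ← ι.commutes, ← Algebra.smul_def, hwdef,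
      ← map_smul, ← map_add] at this
  have hwk : vD F D (w ^ k) = exp (-(k : ℤ)) := by
    rw [map_pow, hw, ← exp_nsmul]
    simp
  have hwk0 : w ^ k ≠ 0 := pow_ne_zero _ hw0
  -- `u ↦ (u - 1) / w ^ k` maps `U_D^k` to the integers of `D`
  let c : D → D := fun u => (u - 1) * (w ^ k)⁻¹
  have hcval (u : D) (m : ℤ) : vD F D (c u) ≤ exp m ↔ vD F D (u - 1) ≤ exp (m - k) := by
    change vD F D ((u - 1) * (w ^ k)⁻¹) ≤ _ ↔ _
    rw [map_mul, map_inv₀, hwk, exp_neg, inv_inv, exp_sub, le_div_iff₀ exp_pos]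
  have hc (u : congrSubgroup F D k) : vD F D (c (u : Dˣ)) ≤ 1 := by
    rw [← exp_zero, hcval, zero_sub]
    exact (mem_congrSubgroup_iff hk _).1 u.2
  have hc1 (u : congrSubgroup F D k) : vF F (B (c (u : Dˣ))) ≤ 1 :=
    sq_le_one_imp ((hBle _).trans (hc u))
  let f : congrSubgroup F D k →* Multiplicative 𝓀[F] := MonoidHom.mk' (fun u =>
      Multiplicative.ofAdd (IsLocalRing.residue 𝒪[F] ⟨B (c (u : Dˣ)), mem_integer_iff.2 (hc1 u)⟩)) (by
    intro u v
    rw [← ofAdd_add, ← map_add]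
    congr 1
    rw [← sub_eq_zero, ← map_sub, IsLocalRing.residue_eq_zero_iff, mem_maximalIdeal_iff]
    change vF F (B (c ((u : Dˣ) * (v : Dˣ) : D)) - (B (c (u : Dˣ)) + B (c (v : Dˣ)))) < 1
    rw [← map_add, ← map_sub]
    refine sq_lt_one_imp ((hBle _).trans_lt ?_)
    have h1 : c ((u : Dˣ) * (v : Dˣ) : D) - (c (u : Dˣ) + c (v : Dˣ)) = (((u : Dˣ) : D) - 1) * c (v : Dˣ) := by
      change (_ - 1) * _ - ((_ - 1) * _ + (_ - 1) * _) = _ * ((_ - 1) * _)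
      noncomm_ring
    rw [h1, map_mul]
    refine mul_lt_one_of_lt_of_le ?_ (hc v)
    exact (mem_congrSubgroup_one_iff _).1 (congrSubgroup_anti F D hk u.2))
  have hf (u : congrSubgroup F D k) : f u = 1 ↔ vF F (B (c (u : Dˣ))) < 1 := by
    change Multiplicative.ofAdd (IsLocalRing.residue 𝒪[F] _) = Multiplicative.ofAdd 0 ↔ _
    rw [Multiplicative.ofAdd.injective.eq_iff, IsLocalRing.residue_eq_zero_iff,
      mem_maximalIdeal_iff]
  have hf' (u : congrSubgroup F D k) (hu : (u : Dˣ) ∈ congrSubgroup F D (k + 1)) : f u = 1 := by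
    rw [hf]
    refine sq_lt_one_imp ((hBle _).trans_lt ?_)
    rw [lt_one_iff_le_exp, hcval]
    refine ((mem_congrSubgroup_iff (by omega) _).1 hu).trans_eq ?_
    push_cast
    congr 1
    ring
  have hker : f.ker = (EU F D ι (k + 1)).subgroupOf (congrSubgroup F D k) := by
    ext u
    rw [MonoidHom.mem_ker, Subgroup.mem_subgroupOf, EU, Subgroup.mem_sup_of_normal_right]
    constructor
    · intro h
      rw [hf] at h
      obtain ⟨a, b, s, t, hy⟩ := hx.exists_coords hw (c (u : Dˣ))
      have hb : vF F b < 1 := by rwa [hy, hB] at h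
      have hmax := hx.vD_add_mul hw a b s t
      rw [← hy] at hmax
      have hle := hc u
      rw [hmax, max_le_iff] at hle
      have hsmall : vD F D (c (u : Dˣ) - algebraMap F D a) < 1 := by
        have h1 : c (u : Dˣ) - algebraMap F D a = b • x + (algebraMap F D s + t • x) * w := by
          rw [hy]; abel
        rw [h1]
        refine (vD F D).map_add_lt ?_ ?_
        · rw [vD_smul, hx.vD_eq_one, mul_one]
          exact pow_lt_one₀ zero_le hb two_ne_zero
        · rw [map_mul, hx.vD_add_smul, hw]
          exact lt_of_le_of_ne hle.2 fun h => sq_ne_sq_mul_exp_neg_one (γ := 1) one_ne_zero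
            ((one_pow 2).trans h.symm)
      have ha : vF F a ≤ 1 := (max_le_iff.1 (sq_le_one_imp hle.1)).1
      -- the element of `E` with the same residue as `u`
      have hev : vD F D (ι (1 + a • w₀ ^ k) - 1) ≤ exp (-(k : ℤ)) := by
        rw [map_add, map_one, add_sub_cancel_left, map_smul, map_pow, vD_smul, hwk]
        exact mul_le_of_le_one_left' (pow_le_one' ha 2)
      have he1 : vD F D (ι (1 + a • w₀ ^ k)) = 1 := by
        have := (vD F D).map_one_add_of_lt (hev.trans_lt (by rw [← exp_zero, exp_lt_exp]; omega))
        rwa [add_sub_cancel] at this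
      have he0 : (1 + a • w₀ ^ k : E) ≠ 0 := by
        intro h0
        rw [h0, map_zero, map_zero] at he1
        exact zero_ne_one he1
      set e : Dˣ := Units.map (ι : E →* D) (Units.mk0 _ he0) with hedef
      have he : (e : D) = ι (1 + a • w₀ ^ k) := rfl
      refine ⟨e, ⟨_, rfl⟩, e⁻¹ * u, ?_, by group⟩
      rw [mem_congrSubgroup_iff (by omega)]
      have h2 : ((e⁻¹ * u : Dˣ) : D) - 1 =
          ((e⁻¹ : Dˣ) : D) * ((c (u : Dˣ) - algebraMap F D a) * w ^ k) := by
        have h3 : (c (u : Dˣ) - algebraMap F D a) * w ^ k = (u : Dˣ) - e := by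
          change ((_ - 1) * (w ^ k)⁻¹ - _) * w ^ k = _
          rw [sub_mul, inv_mul_cancel_right₀ hwk0, he, map_add, map_one, map_smul, map_pow,
            Algebra.smul_def]
          abel
        rw [h3, mul_sub, Units.inv_mul, Units.val_mul]
      rw [lt_one_iff_le_exp] at hsmall
      rw [h2, map_mul, Units.val_inv_eq_inv_val, map_inv₀, he, he1, inv_one, one_mul, map_mul, hwk]
      refine (mul_le_mul' hsmall le_rfl).trans_eq ?_
      rw [← exp_add]
      congr 1
      push_cast
      ring
    · rintro ⟨_, ⟨e, rfl⟩, u', hu', h⟩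
      have hu'' : u' ∈ congrSubgroup F D k := congrSubgroup_anti F D (Nat.le_succ k) hu'
      have hmem : Units.map (ι : E →* D) e ∈ congrSubgroup F D k := by
        rw [eq_mul_inv_of_mul_eq h]
        exact mul_mem u.2 (inv_mem hu'')
      have hu : u = ⟨_, hmem⟩ * ⟨u', hu''⟩ := Subtype.ext h.symm
      rw [hu, map_mul, hf' ⟨u', hu''⟩ hu', mul_one, hf]
      have h1 : c (ι e) = ι ((e - 1) * (w₀ ^ k)⁻¹) := by
        rw [map_mul, map_sub, map_one, map_inv₀, map_pow]
      change vF F (B (c (ι e))) < 1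
      rw [h1, hBE, map_zero]
      exact zero_lt_one
  have hsurj : Function.Surjective f := by
    intro β
    obtain ⟨b, hb⟩ := IsLocalRing.residue_surjective (Multiplicative.toAdd β)
    have hbv : vD F D ((b : F) • x * w ^ k) ≤ exp (-(k : ℤ)) := by
      rw [map_mul, vD_smul, hx.vD_eq_one, mul_one, hwk]
      exact mul_le_of_le_one_left' (pow_le_one' (mem_integer_iff.1 b.2) 2)
    have hu0 : 1 + (b : F) • x * w ^ k ≠ 0 := by
      intro h0
      have := (vD F D).map_one_add_of_lt (hbv.trans_lt (by rw [← exp_zero, exp_lt_exp]; omega))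
      rw [h0, map_zero] at this
      exact zero_ne_one this
    have hmem : Units.mk0 _ hu0 ∈ congrSubgroup F D k := by
      rw [mem_congrSubgroup_iff hk, Units.val_mk0, add_sub_cancel_left]
      exact hbv
    refine ⟨⟨_, hmem⟩, ?_⟩
    change Multiplicative.ofAdd (IsLocalRing.residue 𝒪[F] _) = _
    rw [← ofAdd_toAdd β, ← hb]
    congr 2
    refine Subtype.ext ?_
    change B ((1 + (b : F) • x * w ^ k - 1) * (w ^ k)⁻¹) = b
    rw [add_sub_cancel_left, mul_inv_cancel_right₀ hwk0]
    simpa using hB 0 b 0 0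
  rw [EU, EU, relIndex_sup_sup, Subgroup.relIndex]
  have := Subgroup.index_ker f
  rw [hker, EU] at this
  rw [this, MonoidHom.range_eq_top.2 hsurj, Subgroup.card_top]
  rfl

theorem relIndex_EU {E : Type*} [Field E] [Algebra F E] (hE : Module.finrank F E = 2)
    (ι : E →ₐ[F] D) (w₀ : E) (hw : vD F D (ι w₀) = exp (-1)) (hx : IsResidueGenerator F x)
    (k : ℕ) : (EU F D ι (k + 1)).relIndex (EU F D ι 1) = Nat.card 𝓀[F] ^ k := by
  induction k with
  | zero => simp
  | succ k ih =>
    rw [← Subgroup.relIndex_mul_relIndex _ (EU F D ι (k + 1)) _ (EU_anti F D ι (by omega))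
      (EU_anti F D ι (by omega)), ih, relIndex_EU_succ hE ι w₀ hw hx (by omega), pow_succ, mul_comm]

end Index

/-! ### Operators with a scalar power -/

section Eigenspaces

open Polynomial Module

variable {K : Type*} [Field K] {r : ℕ} {c : K}

theorem eq_of_pow_two_pow_eq [CharP K 2] {a b : K} (m : ℕ) (h : a ^ 2 ^ m = b ^ 2 ^ m) :
    a = b :=
  iterateFrobenius_inj K 2 m h

theorem nodup_roots_X_pow_sub_C (hr : (r : K) ≠ 0) (hc : c ≠ 0) : (X ^ r - C c : K[X]).roots.Nodup :=
  nodup_roots (separable_X_pow_sub_C c hr hc)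

theorem mem_roots_X_pow_sub_C (hr : (r : K) ≠ 0) {l : K} :
    l ∈ (X ^ r - C c : K[X]).roots ↔ l ^ r = c := by
  have hr0 : 0 < r := Nat.pos_of_ne_zero fun h => hr (by simp [h])
  rw [mem_roots (X_pow_sub_C_ne_zero hr0 c)]
  simp [sub_eq_zero]

variable {V : Type*} [AddCommGroup V] [Module K V] {t : End K V}

/-- A polynomial `q` such that `q(t)`, for an operator with `t ^ r = c`, projects to the eigenspace
for `l`. It allows eigenvectors in a quotient to be lifted. -/
theorem exists_projector (hr : (r : K) ≠ 0) (hc : c ≠ 0) {l : K} (hl : l ^ r = c) :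
    ∃ q : K[X], q.eval l = 1 ∧ X ^ r - C c ∣ (X - C l) * q := by
  have hl0 : l ≠ 0 := by
    rintro rfl
    have hr0 : r ≠ 0 := fun h => hr (by simp [h])
    exact hc (by rw [← hl, zero_pow hr0])
  have hroot : (X ^ r - C c : K[X]).IsRoot l := by simp [hl]
  obtain ⟨q, hq⟩ := dvd_iff_isRoot.2 hroot
  have hql : q.eval l = r * l ^ (r - 1) := by
    have := congrArg (fun f => (derivative f).eval l) hq
    simpa [derivative_X_pow] using this.symm
  have hql0 : q.eval l ≠ 0 := by
    rw [hql]
    exact mul_ne_zero hr (pow_ne_zero _ hl0)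
  refine ⟨C (q.eval l)⁻¹ * q, by simp [hql0], ?_⟩
  rw [hq]
  exact ⟨C (q.eval l)⁻¹, by ring⟩

theorem aeval_X_pow_sub_C (ht : t ^ r = algebraMap K _ c) : aeval t (X ^ r - C c) = 0 := by
  simp [ht]

theorem eigenspace_eq_bot (ht : t ^ r = algebraMap K _ c) {l : K} (hl : l ^ r ≠ c) :
    t.eigenspace l = ⊥ := by
  rw [eq_bot_iff]
  intro v hv
  rw [End.mem_eigenspace_iff] at hv
  have h : ∀ n : ℕ, (t ^ n) v = l ^ n • v := by
    intro n
    induction n with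
    | zero => simp
    | succ n ih => rw [pow_succ', Module.End.mul_apply, ih, map_smul, hv, smul_smul, pow_succ]
  have h1 := h r
  rw [ht, Module.algebraMap_end_apply, ← sub_eq_zero, ← sub_smul, smul_eq_zero, sub_eq_zero] at h1
  exact h1.resolve_left fun h => hl h.symm

/-- The dimension of an eigenspace is additive in short exact sequences. -/
theorem finrank_eigenspace_of_exact [FiniteDimensional K V] {A Q : Type*} [AddCommGroup A]
    [Module K A] [AddCommGroup Q] [Module K Q] {tA : End K A} {tQ : End K Q}
    (hr : (r : K) ≠ 0) (hc : c ≠ 0) (ht : t ^ r = algebraMap K _ c) (i : A →ₗ[K] V) (π : V →ₗ[K] Q)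
    (hi : ∀ a, i (tA a) = t (i a)) (hπ : ∀ v, π (t v) = tQ (π v)) (hinj : Function.Injective i)
    (hsurj : Function.Surjective π) (hex : LinearMap.range i = LinearMap.ker π) (l : K) :
    finrank K (t.eigenspace l) =
      finrank K (tA.eigenspace l) + finrank K (tQ.eigenspace l) := by
  have hA : tA ^ r = algebraMap K _ c := by
    have h : ∀ n a, i ((tA ^ n) a) = (t ^ n) (i a) := by
      intro n
      induction n with
      | zero => simp
      | succ n ih => intro a; rw [pow_succ', pow_succ', Module.End.mul_apply, hi, ih]; rfl
    ext a
    apply hinj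
    rw [h, ht]
    simp
  have hQn : ∀ n v, π ((t ^ n) v) = (tQ ^ n) (π v) := by
    intro n
    induction n with
    | zero => simp
    | succ n ih => intro a; rw [pow_succ', pow_succ', Module.End.mul_apply, hπ, ih]; rfl
  have hQ : tQ ^ r = algebraMap K _ c := by
    ext y
    obtain ⟨v, rfl⟩ := hsurj y
    rw [← hQn, ht]
    simp
  by_cases hl : l ^ r = c
  swap
  · rw [eigenspace_eq_bot ht hl, eigenspace_eq_bot hA hl, eigenspace_eq_bot hQ hl]
    simp
  let π' : t.eigenspace l →ₗ[K] tQ.eigenspace l := π.restrict (by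
    intro v hv
    rw [End.mem_eigenspace_iff] at hv ⊢
    rw [← hπ, hv, map_smul])
  have hπ' : LinearMap.range π' = ⊤ := by
    rw [LinearMap.range_eq_top]
    rintro ⟨y, hy⟩
    obtain ⟨v, rfl⟩ := hsurj y
    obtain ⟨q, hq1, g, hg⟩ := exists_projector hr hc hl
    refine ⟨⟨aeval t q v, ?_⟩, Subtype.ext ?_⟩
    · rw [End.mem_eigenspace_iff, ← sub_eq_zero]
      have h := congrArg (fun f => aeval t f v) hg
      simpa [ht] using h
    · change π (aeval t q v) = π v
      have h : ∀ f : K[X], π (aeval t f v) = f.eval l • π v := by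
        intro f
        induction f using Polynomial.induction_on' with
        | add f g hf hg => simp [hf, hg, add_smul]
        | monomial n a =>
          rw [End.mem_eigenspace_iff] at hy
          have hn : (tQ ^ n) (π v) = l ^ n • π v := by
            induction n with
            | zero => simp
            | succ n ih => rw [pow_succ', Module.End.mul_apply, ih, map_smul, hy, smul_smul, pow_succ]
          rw [aeval_monomial, eval_monomial, Module.End.mul_apply, Module.algebraMap_end_apply,
            map_smul, hQn, hn, smul_smul]
      rw [h, hq1, one_smul]
  let i' : tA.eigenspace l →ₗ[K] LinearMap.ker π' := LinearMap.codRestrict _ (i.restrict (by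
    intro v hv
    rw [End.mem_eigenspace_iff] at hv ⊢
    rw [← hi, hv, map_smul])) (by
    intro v
    rw [LinearMap.mem_ker]
    refine Subtype.ext ?_
    change π (i v) = 0
    rw [← LinearMap.mem_ker, ← hex]
    exact ⟨_, rfl⟩)
  have hi'v (v) : ((i' v : t.eigenspace l) : V) = i v := rfl
  have hi' : Function.Bijective i' := by
    refine ⟨fun a b h => Subtype.ext (hinj ?_), ?_⟩
    · rw [← hi'v, ← hi'v, h]
    · rintro ⟨⟨v, hv⟩, hv'⟩
      have h1 : v ∈ LinearMap.ker π := congrArg Subtype.val hv'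
      rw [← hex] at h1
      obtain ⟨a, rfl⟩ := h1
      refine ⟨⟨a, ?_⟩, rfl⟩
      rw [End.mem_eigenspace_iff] at hv ⊢
      apply hinj
      rw [hi, hv, map_smul]
  rw [← LinearMap.finrank_range_add_finrank_ker π', hπ', finrank_top, add_comm,
    (LinearEquiv.ofBijective i' hi').finrank_eq]

theorem finrank_eigenspace_congr {W : Type*} [AddCommGroup W] [Module K W] {t' : End K W}
    (e : V ≃ₗ[K] W) (he : ∀ v, e (t v) = t' (e v)) (l : K) :
    finrank K (t.eigenspace l) = finrank K (t'.eigenspace l) := by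
  have : (t.eigenspace l).map (e : V →ₗ[K] W) = t'.eigenspace l := by
    ext y
    rw [Submodule.mem_map_equiv, End.mem_eigenspace_iff, End.mem_eigenspace_iff]
    rw [← e.injective.eq_iff, he, map_smul, e.apply_symm_apply]
  rw [← this]
  exact (e.submoduleMap _).finrank_eq

theorem finrank_eigenspace_prod [FiniteDimensional K V] {W : Type*} [AddCommGroup W] [Module K W]
    [FiniteDimensional K W] {t' : End K W} (l : K) :
    finrank K (End.eigenspace (t.prodMap t') l) =
      finrank K (t.eigenspace l) + finrank K (t'.eigenspace l) := by
  have h : End.eigenspace (t.prodMap t') l = (t.eigenspace l).prod (t'.eigenspace l) := by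
    ext ⟨v, w⟩
    simp
  rw [← finrank_prod, h]
  exact LinearEquiv.finrank_eq
    { toFun := fun v => (⟨v.1.1, v.2.1⟩, ⟨v.1.2, v.2.2⟩)
      invFun := fun v => ⟨(v.1, v.2), v.1.2, v.2.2⟩
      map_add' := fun _ _ => rfl
      map_smul' := fun _ _ => rfl
      left_inv := fun _ => rfl
      right_inv := fun _ => rfl }

theorem finrank_eigenspace_pi {ι : Type*} [Finite ι] {W : ι → Type*} [∀ i, AddCommGroup (W i)]
    [∀ i, Module K (W i)] [∀ i, FiniteDimensional K (W i)] (f : ∀ i, End K (W i))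
    (T : End K (∀ i, W i)) (hT : ∀ v i, T v i = f i (v i)) [Fintype ι] (l : K) :
    finrank K (T.eigenspace l) = ∑ i, finrank K ((f i).eigenspace l) := by
  rw [← finrank_pi_fintype]
  refine LinearEquiv.finrank_eq
    { toFun := fun v i => ⟨v.1 i, ?_⟩
      invFun := fun v => ⟨fun i => (v i).1, ?_⟩
      map_add' := fun _ _ => rfl
      map_smul' := fun _ _ => rfl
      left_inv := fun _ => rfl
      right_inv := fun _ => rfl }
  · have := v.2
    rw [End.mem_eigenspace_iff] at this ⊢
    rw [← hT, this]
    rfl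
  · rw [End.mem_eigenspace_iff]
    funext i
    rw [hT]
    exact End.mem_eigenspace_iff.1 (v i).2

theorem finrank_eigenspace_directSum {ι : Type*} [Fintype ι] {W : ι → Type*}
    [∀ i, AddCommGroup (W i)] [∀ i, Module K (W i)] [∀ i, FiniteDimensional K (W i)]
    (f : ∀ i, End K (W i)) (T : End K (DirectSum ι W)) (hT : ∀ v i, T v i = f i (v i)) (l : K) :
    finrank K (T.eigenspace l) = ∑ i, finrank K ((f i).eigenspace l) := by
  rw [← finrank_eigenspace_pi f (LinearMap.pi fun i => f i ∘ₗ LinearMap.proj i) (fun _ _ => rfl)]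
  refine finrank_eigenspace_congr (DirectSum.linearEquivFunOnFintype K ι W) (fun v => ?_) l
  funext i
  exact hT v i

theorem isSemisimple_of_pow_eq (hr : (r : K) ≠ 0) (hc : c ≠ 0) (ht : t ^ r = algebraMap K _ c) :
    t.IsSemisimple :=
  End.isSemisimple_of_squarefree_aeval_eq_zero (separable_X_pow_sub_C c hr hc).squarefree
    (aeval_X_pow_sub_C ht)

variable [FiniteDimensional K V]

theorem iSup_eigenspace_eq_top [IsAlgClosed K] (hr : (r : K) ≠ 0) (hc : c ≠ 0) (ht : t ^ r = algebraMap K _ c) :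
    ⨆ l, t.eigenspace l = ⊤ :=
  (isSemisimple_of_pow_eq hr hc ht).iSup_eigenspace_eq_top

theorem finrank_eigenspace_eq_count (hr : (r : K) ≠ 0) (hc : c ≠ 0)
    (ht : t ^ r = algebraMap K _ c) [DecidableEq K] (l : K) :
    finrank K (t.eigenspace l) = t.charpoly.roots.count l := by
  rw [count_roots, ← LinearMap.finrank_maxGenEigenspace_eq,
    (isSemisimple_of_pow_eq hr hc ht).isFinitelySemisimple.maxGenEigenspace_eq_eigenspace]

theorem finrank_eigenspace_of_charpoly (hr : (r : K) ≠ 0) (hc : c ≠ 0)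
    (ht : t ^ r = algebraMap K _ c) {N : ℕ} (hN : t.charpoly = (X ^ r - C c) ^ N) {l : K}
    (hl : l ^ r = c) : finrank K (t.eigenspace l) = N := by
  classical
  rw [finrank_eigenspace_eq_count hr hc ht, hN, roots_pow, Multiset.count_nsmul,
    Multiset.count_eq_one_of_mem (nodup_roots_X_pow_sub_C hr hc)
      ((mem_roots_X_pow_sub_C hr).2 hl), mul_one]

variable [IsAlgClosed K]

theorem finrank_eq_sum_eigenspace (hr : (r : K) ≠ 0) (hc : c ≠ 0)
    (ht : t ^ r = algebraMap K _ c) [DecidableEq K] :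
    finrank K V = ∑ l ∈ (X ^ r - C c : K[X]).roots.toFinset, finrank K (t.eigenspace l) := by
  simp_rw [finrank_eigenspace_eq_count hr hc ht]
  rw [Multiset.sum_count_eq_card, ← LinearMap.charpoly_natDegree (f := t),
    (IsAlgClosed.splits _).natDegree_eq_card_roots]
  intro l hl
  rw [Multiset.mem_toFinset, mem_roots_X_pow_sub_C hr]
  by_contra h
  rw [← Multiset.one_le_count_iff_mem, ← finrank_eigenspace_eq_count hr hc ht,
    eigenspace_eq_bot ht h] at hl
  simp at hl

theorem charpoly_eq_pow (hr : (r : K) ≠ 0) (hc : c ≠ 0) (ht : t ^ r = algebraMap K _ c) (N : ℕ)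
    (hN : ∀ l, l ^ r = c → finrank K (t.eigenspace l) = N) : t.charpoly = (X ^ r - C c) ^ N := by
  classical
  have hr0 : r ≠ 0 := fun h => hr (by simp [h])
  have hmonic : ((X ^ r - C c : K[X]) ^ N).Monic := (monic_X_pow_sub_C c hr0).pow N
  rw [(IsAlgClosed.splits t.charpoly).eq_prod_roots_of_monic t.charpoly_monic,
    (IsAlgClosed.splits ((X ^ r - C c : K[X]) ^ N)).eq_prod_roots_of_monic hmonic]
  congr 2
  ext l
  rw [← finrank_eigenspace_eq_count hr hc ht, roots_pow, Multiset.count_nsmul]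
  by_cases hl : l ^ r = c
  · rw [hN l hl, Multiset.count_eq_one_of_mem (nodup_roots_X_pow_sub_C hr hc)
      ((mem_roots_X_pow_sub_C hr).2 hl), mul_one]
  · rw [eigenspace_eq_bot ht hl, Multiset.count_eq_zero_of_notMem
      (fun h => hl ((mem_roots_X_pow_sub_C hr).1 h))]
    simp

end Eigenspaces

/-! ### Twisted representations of dihedral groups -/

section DihedralRep

open Module

variable {G : Type*} [Group G] {Z : Subgroup G} [Z.Normal] {θ w : G} {r : ℕ}

namespace IsDihedralMod

variable (h : IsDihedralMod Z θ w r)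
include h

theorem pow_mem : θ ^ r ∈ Z := by
  rw [← QuotientGroup.eq_one_iff, QuotientGroup.mk_pow]
  exact (h.pow_eq_one_iff r).2 dvd_rfl

theorem mul_self_mem : w * w ∈ Z := by
  rw [← QuotientGroup.eq_one_iff]
  exact h.w_mul_w

theorem conj_mem : w * θ * w⁻¹ * θ ∈ Z := by
  rw [← QuotientGroup.eq_one_iff, ← h.conj]
  simp only [QuotientGroup.mk_mul, QuotientGroup.mk_inv]
  rw [inv_eq_of_mul_eq_one_left h.w_mul_w]

/-- Normal forms modulo `Z`. -/
theorem exists_eq (g : G) : ∃ i : ℕ, ∃ z ∈ Z, g = θ ^ i * z ∨ g = θ ^ i * w * z := by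
  obtain ⟨i, hi⟩ := h.gen g
  rcases hi with hi | hi
  · refine ⟨i, (θ ^ i)⁻¹ * g, ?_, Or.inl (by group)⟩
    rw [← QuotientGroup.eq, hi, QuotientGroup.mk_pow]
  · refine ⟨i, (θ ^ i * w)⁻¹ * g, ?_, Or.inr (by group)⟩
    rw [← QuotientGroup.eq, hi, QuotientGroup.mk_mul, QuotientGroup.mk_pow]

/-- Replacing the rotation by a power of it prime to its order. -/
theorem pow_left {m : ℕ} (hm : Nat.Coprime m r) : IsDihedralMod Z (θ ^ m) w r where
  odd := h.odd
  pow_eq_one_iff k := by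
    rw [QuotientGroup.mk_pow, ← pow_mul, h.pow_eq_one_iff, hm.symm.dvd_mul_left]
  w_mul_w := h.w_mul_w
  conj := by
    have hw : (w : G ⧸ Z)⁻¹ = w := inv_eq_of_mul_eq_one_left h.w_mul_w
    have h1 : (w : G ⧸ Z) * θ * (w : G ⧸ Z)⁻¹ = (θ : G ⧸ Z)⁻¹ := by
      rw [hw]
      exact eq_inv_of_mul_eq_one_left h.conj
    rw [QuotientGroup.mk_pow]
    nth_rw 2 [← hw]
    rw [← conj_pow, h1, inv_pow, inv_mul_cancel]
  gen g := by
    have hord : m.Coprime (orderOf (θ : G ⧸ Z)) :=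
      hm.coprime_dvd_right (orderOf_dvd_of_pow_eq_one ((h.pow_eq_one_iff r).2 dvd_rfl))
    obtain ⟨m', hm'⟩ := exists_pow_eq_self_of_coprime hord
    obtain ⟨i, hi⟩ := h.gen g
    exact ⟨m' * i, by rwa [QuotientGroup.mk_pow, pow_mul, hm']⟩

variable {K : Type*} [Field K] {V : Type*} [AddCommGroup V] [Module K V]
  {ρ : Representation K G V}

/-- Stability under `G` is checked on `Z`, `θ` and `w`. -/
theorem apply_mem (W : Submodule K V) (hZ : ∀ z ∈ Z, ∀ v ∈ W, ρ z v ∈ W)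
    (hθ : ∀ v ∈ W, ρ θ v ∈ W) (hw : ∀ v ∈ W, ρ w v ∈ W) (g : G) {v : V} (hv : v ∈ W) :
    ρ g v ∈ W := by
  have hpow : ∀ i : ℕ, ∀ v ∈ W, ρ (θ ^ i) v ∈ W := by
    intro i
    induction i with
    | zero => simp
    | succ i ih =>
      intro v hv
      rw [pow_succ, map_mul]
      exact ih _ (hθ v hv)
  obtain ⟨i, z, hz, rfl | rfl⟩ := h.exists_eq g
  · rw [map_mul]
    exact hpow i _ (hZ z hz v hv)
  · rw [map_mul, map_mul]
    exact hpow i _ (hw _ (hZ z hz v hv))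

/-- Equivariance under `G` is checked on `Z`, `θ` and `w`. -/
theorem map_apply {V' : Type*} [AddCommGroup V'] [Module K V'] {ρ' : Representation K G V'}
    (T : V →ₗ[K] V') (hZ : ∀ z ∈ Z, ∀ v, T (ρ z v) = ρ' z (T v))
    (hθ : ∀ v, T (ρ θ v) = ρ' θ (T v)) (hw : ∀ v, T (ρ w v) = ρ' w (T v)) (g : G) (v : V) :
    T (ρ g v) = ρ' g (T v) := by
  have hpow : ∀ i : ℕ, ∀ v, T (ρ (θ ^ i) v) = ρ' (θ ^ i) (T v) := by
    intro i
    induction i with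
    | zero => simp
    | succ i ih =>
      intro v
      rw [pow_succ, map_mul, map_mul, Module.End.mul_apply, ih, hθ]
      rfl
  obtain ⟨i, z, hz, rfl | rfl⟩ := h.exists_eq g
  · rw [map_mul, map_mul, Module.End.mul_apply, hpow, hZ z hz]
    rfl
  · rw [map_mul, map_mul, map_mul, map_mul, Module.End.mul_apply, Module.End.mul_apply, hpow, hw,
      hZ z hz]
    rfl

end IsDihedralMod

variable {K : Type*} [Field K] {ψ : G →* Kˣ}
variable {V : Type*} [AddCommGroup V] [Module K V] {ρ : Representation K G V}

variable (Z) in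
/-- The subgroup `Z` acts through the character `ψ` of `G`. -/
def ActsBy (ψ : G →* Kˣ) (ρ : Representation K G V) : Prop :=
  ∀ z ∈ Z, ∀ v, ρ z v = (ψ z : K) • v

variable (Z θ w) in
/-- A representation of `G` which is the twist by the character `ψ` of a semisimple
representation of the dihedral group `G ⧸ Z` in characteristic two: the subgroup `Z` acts
through `ψ`, and on the eigenspace of `θ` that `w` preserves, `w` acts as a scalar. -/
structure IsDihedralRep (ψ : G →* Kˣ) (ρ : Representation K G V) : Prop where
  central : ActsBy Z ψ ρ
  refl : ∀ v, ρ θ v = (ψ θ : K) • v → ρ w v = (ψ w : K) • v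

namespace ActsBy

variable (hρ : ActsBy Z ψ ρ) (h : IsDihedralMod Z θ w r)
include hρ h

theorem pow_eq : (ρ θ) ^ r = algebraMap K _ ((ψ θ : K) ^ r) := by
  ext v
  rw [← map_pow, hρ _ h.pow_mem, map_pow, Units.val_pow_eq_pow_val, Module.algebraMap_end_apply]

theorem apply_w_w (v : V) : ρ w (ρ w v) = ((ψ w : K) * ψ w) • v := by
  rw [← Module.End.mul_apply, ← map_mul, hρ _ h.mul_self_mem, map_mul, Units.val_mul]

/-- The reflection exchanges the eigenspaces of `θ` for `l` and `ψ(θ)² / l`. -/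
theorem apply_w_of_mem_eigenspace {l : K} {v : V} (hv : ρ θ v = l • v) :
    ρ θ (ρ w v) = ((ψ θ : K) ^ 2 / l) • ρ w v := by
  by_cases hv0 : v = 0
  · simp [hv0]
  have hinv (g : G) (v : V) : ρ g⁻¹ (ρ g v) = v := by
    rw [← Module.End.mul_apply, ← map_mul]
    simp
  have hinv' (g : G) (v : V) : ρ g (ρ g⁻¹ v) = v := by
    rw [← Module.End.mul_apply, ← map_mul]
    simp
  have hl : l ≠ 0 := by
    rintro rfl
    rw [zero_smul] at hv
    apply hv0
    rw [← hinv θ v, hv, map_zero]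
  -- apply `w θ w⁻¹ θ` to the vector `θ⁻¹ w v`
  have h1 := hρ _ h.conj_mem (ρ θ⁻¹ (ρ w v))
  rw [map_mul, map_mul, map_mul, Module.End.mul_apply, Module.End.mul_apply,
    Module.End.mul_apply, hinv', hinv, hv, map_smul] at h1
  have h2 := congrArg (ρ θ) h1
  rw [map_smul, map_smul, hinv'] at h2
  rw [div_eq_inv_mul, mul_smul, eq_inv_smul_iff₀ hl, h2]
  congr 1
  simp only [map_mul, map_inv, Units.val_mul, Units.val_inv_eq_inv_val]
  field_simp

theorem finrank_eigenspace_div (l : K) :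
    finrank K (End.eigenspace (ρ θ) ((ψ θ : K) ^ 2 / l)) = finrank K (End.eigenspace (ρ θ) l) := by
  have h0 : ((ψ θ : K) ^ 2) ≠ 0 := pow_ne_zero _ (ψ θ).ne_zero
  have key (μ : K) : (End.eigenspace (ρ θ) μ).map (ρ w) ≤ End.eigenspace (ρ θ) ((ψ θ : K) ^ 2 / μ) := by
    rintro _ ⟨v, hv, rfl⟩
    exact End.mem_eigenspace_iff.2 (hρ.apply_w_of_mem_eigenspace h (End.mem_eigenspace_iff.1 hv))
  let e : V ≃ₗ[K] V := LinearEquiv.ofLinearMap (ρ w) (ρ w⁻¹)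
    (by rw [← Module.End.mul_eq_comp, ← map_mul]; simp; rfl)
    (by rw [← Module.End.mul_eq_comp, ← map_mul]; simp; rfl)
  have : (End.eigenspace (ρ θ) l).map (e : V →ₗ[K] V) = End.eigenspace (ρ θ) ((ψ θ : K) ^ 2 / l) := by
    refine le_antisymm (key l) fun v hv => ?_
    refine ⟨((ψ w : K) * ψ w)⁻¹ • ρ w v, Submodule.smul_mem _ _ ?_, ?_⟩
    · have := key _ (Submodule.mem_map_of_mem hv)
      rwa [div_div_cancel₀ h0] at this
    · change ρ w _ = _
      rw [map_smul, hρ.apply_w_w h, inv_smul_smul₀ (by simp)]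
  rw [← this]
  exact (e.submoduleMap _).finrank_eq.symm

end ActsBy

/-- A family of isomorphisms between the eigenspaces of `θ`, compatible with `w`: one of each pair
`l`, `ψ(θ)² / l` of eigenvalues is singled out by a linear order on the field, the isomorphism
there is arbitrary, and `w` carries it to the other one. -/
theorem exists_eigenspace_maps [CharP K 2] (h : IsDihedralMod Z θ w r) [FiniteDimensional K V]
    {V' : Type*} [AddCommGroup V'] [Module K V'] [FiniteDimensional K V']
    {ρ' : Representation K G V'} (hρ : IsDihedralRep Z θ w ψ ρ) (hρ' : IsDihedralRep Z θ w ψ ρ')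
    (hd : ∀ l, finrank K (End.eigenspace (ρ θ) l) = finrank K (End.eigenspace (ρ' θ) l)) :
    ∃ f : K → V →ₗ[K] V', ∀ l v, ρ θ v = l • v →
      ρ' θ (f l v) = l • f l v ∧ (f l v = 0 → v = 0) ∧
      f ((ψ θ : K) ^ 2 / l) (ρ w v) = ρ' w (f l v) := by
  classical
  have hψθ : ((ψ θ : K) ^ 2) ≠ 0 := pow_ne_zero _ (ψ θ).ne_zero
  have hψw : ((ψ w : K) * ψ w) ≠ 0 := by simp
  -- arbitrary isomorphisms
  have he : ∀ l : K, ∃ f : V →ₗ[K] V', ∀ v, ρ θ v = l • v →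
      ρ' θ (f v) = l • f v ∧ (f v = 0 → v = 0) := by
    intro l
    let e := LinearEquiv.ofFinrankEq _ _ (hd l)
    obtain ⟨f, hf⟩ := LinearMap.exists_extend
      ((End.eigenspace (ρ' θ) l).subtype ∘ₗ e.toLinearMap)
    refine ⟨f, fun v hv => ?_⟩
    have hfv : f v = e ⟨v, End.mem_eigenspace_iff.2 hv⟩ := LinearMap.congr_fun hf ⟨v, _⟩
    rw [hfv]
    refine ⟨End.mem_eigenspace_iff.1 (e ⟨v, _⟩).2, fun h0 => ?_⟩
    have := (e.map_eq_zero_iff).1 (Subtype.ext h0)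
    exact congrArg Subtype.val this
  choose e he using he
  let : LinearOrder K := WellOrderingRel.isWellOrder.linearOrder
  refine ⟨fun l => if l ≤ (ψ θ : K) ^ 2 / l then e l
    else ((ψ w : K) * ψ w)⁻¹ • ((ρ' w) ∘ₗ (e ((ψ θ : K) ^ 2 / l)) ∘ₗ (ρ w) : V →ₗ[K] V'), fun l v hv => ?_⟩
  by_cases hv0 : v = 0
  · simp [hv0]
  have hl : l ≠ 0 := by
    rintro rfl
    apply hv0
    have : ρ θ⁻¹ (ρ θ v) = v := by
      rw [← Module.End.mul_apply, ← map_mul]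
      simp
    rw [← this, hv, zero_smul, map_zero]
  have hwv := hρ.central.apply_w_of_mem_eigenspace h hv
  have hdd : (ψ θ : K) ^ 2 / ((ψ θ : K) ^ 2 / l) = l := div_div_cancel₀ hψθ
  rcases lt_trichotomy l ((ψ θ : K) ^ 2 / l) with hlt | heq | hlt
  · refine ⟨?_, ?_, ?_⟩
    · simpa only [if_pos hlt.le] using (he l v hv).1
    · simpa only [if_pos hlt.le] using (he l v hv).2
    · simp only [if_pos hlt.le, hdd, if_neg (not_le.2 hlt)]
      rw [LinearMap.smul_apply, LinearMap.comp_apply, LinearMap.comp_apply, hρ.central.apply_w_w h, map_smul, map_smul, inv_smul_smul₀ hψw]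
  · have hl2 : l = ψ θ := by
      refine eq_of_pow_two_pow_eq 1 ?_
      rw [eq_div_iff hl] at heq
      rw [pow_one, ← heq, sq]
    refine ⟨?_, ?_, ?_⟩
    · simpa only [if_pos heq.le] using (he l v hv).1
    · simpa only [if_pos heq.le] using (he l v hv).2
    · simp only [← heq, le_refl, if_true]
      have h1 := (he l v hv).1
      rw [hρ.refl v (by rw [hv, hl2]), map_smul, hρ'.refl _ (by rw [h1, hl2])]
  · have he' := he _ _ hwv
    refine ⟨?_, ?_, ?_⟩
    · simp only [if_neg (not_le.2 hlt)]
      rw [LinearMap.smul_apply, LinearMap.comp_apply, LinearMap.comp_apply]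
      have := hρ'.central.apply_w_of_mem_eigenspace h he'.1
      rw [map_smul, this, hdd, smul_comm]
    · simp only [if_neg (not_le.2 hlt)]
      intro h0
      have h1 : ρ' w (e ((ψ θ : K) ^ 2 / l) (ρ w v)) = 0 := (smul_eq_zero.1 h0).resolve_left (inv_ne_zero hψw)
      have h2 : e ((ψ θ : K) ^ 2 / l) (ρ w v) = 0 := by
        have := hρ'.central.apply_w_w h (e ((ψ θ : K) ^ 2 / l) (ρ w v))
        rw [h1, map_zero] at this
        exact (smul_eq_zero.1 this.symm).resolve_left hψw
      have h3 := hρ.central.apply_w_w h v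
      rw [he'.2 h2, map_zero] at h3
      exact (smul_eq_zero.1 h3.symm).resolve_left hψw
    · simp only [hdd, if_pos hlt.le, if_neg (not_le.2 hlt)]
      rw [LinearMap.smul_apply, LinearMap.comp_apply, LinearMap.comp_apply, map_smul, hρ'.central.apply_w_w h, inv_smul_smul₀ hψw]

/-- Twists of semisimple representations of a dihedral group of order `2 r`, `r` odd, in
characteristic two are determined by the dimensions of the eigenspaces of the rotation. -/
theorem nonempty_equiv_of_finrank_eigenspace [CharP K 2] [IsAlgClosed K]
    (h : IsDihedralMod Z θ w r) [FiniteDimensional K V]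
    {V' : Type*} [AddCommGroup V'] [Module K V'] [FiniteDimensional K V']
    {ρ' : Representation K G V'} (hρ : IsDihedralRep Z θ w ψ ρ) (hρ' : IsDihedralRep Z θ w ψ ρ')
    (hd : ∀ l, l ^ r = (ψ θ : K) ^ r →
      finrank K (End.eigenspace (ρ θ) l) = finrank K (End.eigenspace (ρ' θ) l)) :
    Nonempty (ρ.Equiv ρ') := by
  classical
  have hr : (r : K) ≠ 0 := by
    rw [Ne, CharP.cast_eq_zero_iff K 2]
    exact fun h2 => Nat.not_even_iff_odd.2 h.odd (even_iff_two_dvd.2 h2)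
  have hc : ((ψ θ : K) ^ r) ≠ 0 := pow_ne_zero _ (ψ θ).ne_zero
  have ht := hρ.central.pow_eq h
  have ht' := hρ'.central.pow_eq h
  have hd' : ∀ l, finrank K (End.eigenspace (ρ θ) l) = finrank K (End.eigenspace (ρ' θ) l) := by
    intro l
    by_cases hl : l ^ r = (ψ θ : K) ^ r
    · exact hd l hl
    · rw [eigenspace_eq_bot ht hl, eigenspace_eq_bot ht' hl]
      simp
  obtain ⟨f, hf⟩ := exists_eigenspace_maps h hρ hρ' hd'
  have hint := DirectSum.isInternal_submodule_of_iSupIndep_of_iSup_eq_top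
    (End.eigenspaces_iSupIndep (ρ θ)) (iSup_eigenspace_eq_top hr hc ht)
  have hind' := End.eigenspaces_iSupIndep (ρ' θ)
  let e := LinearEquiv.ofBijective (DirectSum.coeLinearMap fun l => End.eigenspace (ρ θ) l) hint
  let g : ∀ l, End.eigenspace (ρ θ) l →ₗ[K] End.eigenspace (ρ' θ) l := fun l =>
    (f l).restrict fun v hv =>
      End.mem_eigenspace_iff.2 (hf l v (End.mem_eigenspace_iff.1 hv)).1
  have hg (l) : Function.Injective (g l) := by
    rw [injective_iff_map_eq_zero]
    intro v hv
    exact Subtype.ext ((hf l v (End.mem_eigenspace_iff.1 v.2)).2.1 (congrArg Subtype.val hv))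
  let T : V →ₗ[K] V' := (DirectSum.coeLinearMap fun l => End.eigenspace (ρ' θ) l) ∘ₗ
    (DFinsupp.mapRange.linearMap g) ∘ₗ (e.symm : V →ₗ[K] DirectSum K fun l => End.eigenspace (ρ θ) l)
  have hT (l v) (hv : ρ θ v = l • v) : T v = f l v := by
    have : e.symm v = DirectSum.lof K K (fun l => End.eigenspace (ρ θ) l) l
        ⟨v, End.mem_eigenspace_iff.2 hv⟩ := by
      rw [LinearEquiv.symm_apply_eq]
      exact (DirectSum.coeLinearMap_lof (fun l => End.eigenspace (ρ θ) l) l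
        ⟨v, End.mem_eigenspace_iff.2 hv⟩).symm
    change DirectSum.coeLinearMap _ (DFinsupp.mapRange.linearMap g (e.symm v)) = _
    rw [this]
    have h2 := DFinsupp.mapRange_single (f := fun l => g l) (hf := fun l => map_zero (g l)) (i := l)
      (b := (⟨v, End.mem_eigenspace_iff.2 hv⟩ : End.eigenspace (ρ θ) l))
    change DirectSum.coeLinearMap _ (DFinsupp.mapRange (fun l => g l) (fun l => map_zero (g l))
      (DFinsupp.single l _)) = _
    rw [h2]
    exact DirectSum.coeLinearMap_lof _ _ _
  have hTinj : Function.Injective T :=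
    hind'.dfinsupp_lsum_injective.comp
      (((DFinsupp.mapRange_injective _ fun l => map_zero (g l)).2 hg).comp e.symm.injective)
  have hspan (P : V → Prop) (h1 : ∀ (l : K) v, ρ θ v = l • v → P v) (h2 : ∀ v v', P v → P v' → P (v + v'))
      (v : V) : P v := by
    have hv : v ∈ ⨆ l, End.eigenspace (ρ θ) l := by
      rw [iSup_eigenspace_eq_top hr hc ht]
      trivial
    refine Submodule.iSup_induction _ (motive := P) hv (fun l v hv => h1 l v (End.mem_eigenspace_iff.1 hv))
      (h1 0 0 (by simp)) h2
  have hTθ (v) : T (ρ θ v) = ρ' θ (T v) := by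
    refine hspan (fun v => T (ρ θ v) = ρ' θ (T v)) (fun l v hv => ?_)
      (fun v v' hv hv' => by simp only [map_add, hv, hv']) v
    rw [hv, map_smul, hT l v hv, (hf l v hv).1]
  have hTw (v) : T (ρ w v) = ρ' w (T v) := by
    refine hspan (fun v => T (ρ w v) = ρ' w (T v)) (fun l v hv => ?_)
      (fun v v' hv hv' => by simp only [map_add, hv, hv']) v
    rw [hT l v hv, hT _ _ (hρ.central.apply_w_of_mem_eigenspace h hv), (hf l v hv).2.2]
  have hTg := h.map_apply (ρ := ρ) (ρ' := ρ') T
    (fun z hz v => by rw [hρ.central z hz, hρ'.central z hz, map_smul]) hTθ hTw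
  have hfr : finrank K V = finrank K V' := by
    rw [finrank_eq_sum_eigenspace hr hc ht, finrank_eq_sum_eigenspace hr hc ht']
    exact Finset.sum_congr rfl fun l _ => hd' l
  refine ⟨Representation.Equiv.mk (T.linearEquivOfInjective hTinj hfr) fun g => ?_⟩
  ext v
  exact hTg g v

end DihedralRep

/-! ### Constructing irreducible representations of dihedral groups -/

section IrreducibleDihedral

open Module

variable {G : Type*} [Group G] {K : Type*} [Field K]
variable {V : Type*} [AddCommGroup V] [Module K V] {ρ : Representation K G V}

theorem isIrreducible_iff : ρ.IsIrreducible ↔ Nontrivial V ∧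
    ∀ W : Submodule K V, (∀ g, ∀ v ∈ W, ρ g v ∈ W) → W = ⊥ ∨ W = ⊤ := by
  constructor
  · intro h
    constructor
    · by_contra hn
      rw [not_nontrivial_iff_subsingleton] at hn
      exact (bot_ne_top (α := Subrepresentation ρ))
        (Subrepresentation.toSubmodule_injective (Subsingleton.elim _ _))
    · intro W hW
      rcases h.eq_bot_or_eq_top (⟨W, fun g v hv => hW g v hv⟩ : Subrepresentation ρ)
        with h1 | h1
      · exact Or.inl (congrArg Subrepresentation.toSubmodule h1)
      · exact Or.inr (congrArg Subrepresentation.toSubmodule h1)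
  · rintro ⟨hn, h⟩
    have : Nontrivial (Subrepresentation ρ) := ⟨⊥, ⊤, fun h1 =>
      bot_ne_top (α := Submodule K V) (congrArg Subrepresentation.toSubmodule h1)⟩
    refine ⟨fun W => ?_⟩
    rcases h W.toSubmodule (fun g v hv => W.apply_mem_toSubmodule g hv) with h1 | h1
    · exact Or.inl (Subrepresentation.toSubmodule_injective h1)
    · exact Or.inr (Subrepresentation.toSubmodule_injective h1)

/-- The representation on the second of two isomorphic spaces. -/
def transport {V' : Type*} [AddCommGroup V'] [Module K V'] (e : V ≃ₗ[K] V')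
    (ρ : Representation K G V) : Representation K G V' where
  toFun g := e.conj (ρ g)
  map_one' := by ext; simp
  map_mul' g h := by ext; simp

theorem transport_apply {V' : Type*} [AddCommGroup V'] [Module K V'] (e : V ≃ₗ[K] V') (g : G)
    (v : V') : transport e ρ g v = e (ρ g (e.symm v)) := rfl

/-- Commuting involutions of a non-zero finite-dimensional space have a common fixed vector in
characteristic two: they fix each vector of a minimal non-zero stable subspace. -/
theorem exists_fixed_of_commuting_involutions [CharP K 2] [FiniteDimensional K V] [Nontrivial V]
    (S : Set (End K V)) (hsq : ∀ s ∈ S, s * s = 1) (hcomm : ∀ s ∈ S, ∀ t ∈ S, s * t = t * s) :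
    ∃ v ≠ 0, ∀ s ∈ S, s v = v := by
  obtain ⟨W, ⟨hW0, hWS⟩, hmin⟩ := WellFounded.has_min (wellFounded_lt (α := Submodule K V))
    {W | W ≠ ⊥ ∧ ∀ s ∈ S, ∀ v ∈ W, s v ∈ W} ⟨⊤, top_ne_bot, fun _ _ _ _ => trivial⟩
  obtain ⟨v, hv, hv0⟩ := Submodule.exists_mem_ne_zero_of_ne_bot hW0
  refine ⟨v, hv0, fun s hs => ?_⟩
  have h2 (x : V) : x + x = 0 := by
    rw [← two_smul K, CharTwo.two_eq_zero, zero_smul]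
  let W' := W ⊓ LinearMap.eqLocus s LinearMap.id
  have hW' : W' = W := by
    by_contra hne
    refine hmin W' ⟨?_, fun t ht x hx => ⟨hWS t ht x hx.1, ?_⟩⟩ (lt_of_le_of_ne inf_le_left hne)
    · by_cases h0 : s v = v
      · exact (Submodule.ne_bot_iff _).2 ⟨v, ⟨hv, h0⟩, hv0⟩
      · refine (Submodule.ne_bot_iff _).2 ⟨s v - v, ⟨sub_mem (hWS s hs v hv) hv, ?_⟩,
          sub_ne_zero.2 h0⟩
        have h3 : s (s v) = v := by
          rw [← Module.End.mul_apply, hsq s hs]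
          rfl
        change s (s v - v) = s v - v
        rw [map_sub, h3, ← sub_eq_zero, ← neg_sub (s v) v, ← neg_add', h2, neg_zero]
    · have h3 : s x = x := hx.2
      change s (t x) = t x
      rw [← Module.End.mul_apply, hcomm s hs t ht, Module.End.mul_apply, h3]
  have h3 : v ∈ W' := by rwa [hW']
  exact h3.2

variable {Z : Subgroup G} {θ w : G} {r : ℕ} {ψ : G →* Kˣ}

theorem isDihedralRep_charRep : IsDihedralRep Z θ w ψ (charRep ψ) :=
  ⟨fun _ _ _ => rfl, fun _ _ => rfl⟩

theorem finrank_eigenspace_charRep [DecidableEq K] (l : K) :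
    finrank K (End.eigenspace (charRep ψ θ) l) = if l = ψ θ then 1 else 0 := by
  split_ifs with hl
  · have : End.eigenspace (charRep ψ θ) l = ⊤ := by
      rw [eq_top_iff]
      intro v _
      rw [End.mem_eigenspace_iff, hl]
      rfl
    rw [this, finrank_top, finrank_self]
  · have : End.eigenspace (charRep ψ θ) l = ⊥ := by
      rw [eq_bot_iff]
      intro v hv
      have hv' : (ψ θ : K) * v = l * v := End.mem_eigenspace_iff.1 hv
      rw [← sub_eq_zero, ← sub_mul, mul_eq_zero, sub_eq_zero] at hv'
      exact hv'.resolve_left fun h => hl h.symm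
    rw [this, finrank_bot]

theorem IsDihedralRep.of_equiv {V' : Type*} [AddCommGroup V'] [Module K V']
    {ρ' : Representation K G V'} (hρ : IsDihedralRep Z θ w ψ ρ) (e : V ≃ₗ[K] V')
    (he : ∀ g v, e (ρ g v) = ρ' g (e v)) : IsDihedralRep Z θ w ψ ρ' where
  central z hz v := by
    obtain ⟨v, rfl⟩ := e.surjective v
    rw [← he, hρ.central z hz, map_smul]
  refl v hv := by
    obtain ⟨v, rfl⟩ := e.surjective v
    rw [← he, ← map_smul] at hv ⊢
    rw [hρ.refl v (e.injective hv)]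

theorem IsDihedralRep.restrict {V' : Type*} [AddCommGroup V'] [Module K V']
    {ρ' : Representation K G V'} (hρ : IsDihedralRep Z θ w ψ ρ) (i : V' →ₗ[K] V)
    (hinj : Function.Injective i) (hi : ∀ g v, i (ρ' g v) = ρ g (i v)) :
    IsDihedralRep Z θ w ψ ρ' where
  central z hz v := hinj (by rw [hi, hρ.central z hz, map_smul])
  refl v hv := hinj (by rw [hi, map_smul, hρ.refl (i v) (by rw [← hi, hv, map_smul])])

theorem IsDihedralRep.pi {ι : Type*} {W : ι → Type*} [∀ i, AddCommGroup (W i)]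
    [∀ i, Module K (W i)] {σ : ∀ i, Representation K G (W i)}
    (hσ : ∀ i, IsDihedralRep Z θ w ψ (σ i)) (ρ : Representation K G V)
    (p : ∀ i, V →ₗ[K] W i) (hp : ∀ v v', (∀ i, p i v = p i v') → v = v')
    (hρ : ∀ i g v, p i (ρ g v) = σ i g (p i v)) : IsDihedralRep Z θ w ψ ρ where
  central z hz v := hp _ _ fun i => by rw [hρ, (hσ i).central z hz, map_smul]
  refl v hv := hp _ _ fun i => by
    rw [hρ, map_smul, (hσ i).refl (p i v) (by rw [← hρ, hv, map_smul])]

variable [Z.Normal]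

theorem cast_ne_zero_of_odd [CharP K 2] (hr : Odd r) : (r : K) ≠ 0 := by
  rw [Ne, CharP.cast_eq_zero_iff K 2]
  exact fun h2 => Nat.not_even_iff_odd.2 hr (even_iff_two_dvd.2 h2)

/-- The eigenspace of `θ` for the eigenvalue `ψ θ` is a subrepresentation. -/
theorem ActsBy.apply_mem_eigenspace (hρ : ActsBy Z ψ ρ) (h : IsDihedralMod Z θ w r) (g : G) {v : V}
    (hv : v ∈ End.eigenspace (ρ θ) (ψ θ : K)) : ρ g v ∈ End.eigenspace (ρ θ) (ψ θ : K) := by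
  refine h.apply_mem _ (fun z hz v hv => ?_) (fun v hv => ?_) (fun v hv => ?_) g hv
  · rw [hρ z hz]
    exact Submodule.smul_mem _ _ hv
  · rw [End.mem_eigenspace_iff.1 hv]
    exact Submodule.smul_mem _ _ hv
  · rw [End.mem_eigenspace_iff] at hv ⊢
    have := hρ.apply_w_of_mem_eigenspace h hv
    rwa [sq, mul_div_cancel_left₀ _ (ψ θ).ne_zero] at this

theorem ActsBy.isDihedralRep_of_isIrreducible [CharP K 2] (hρ : ActsBy Z ψ ρ)
    (h : IsDihedralMod Z θ w r)
    (hirr : ∀ W : Submodule K V, (∀ g, ∀ v ∈ W, ρ g v ∈ W) → W = ⊥ ∨ W = ⊤) :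
    IsDihedralRep Z θ w ψ ρ := by
  refine ⟨hρ, fun v hv => ?_⟩
  rcases hirr (End.eigenspace (ρ θ) (ψ θ : K)) (fun g v hv => hρ.apply_mem_eigenspace h g hv)
    with hE | hE
  · have : v = 0 := by
      rw [← Submodule.mem_bot K, ← hE]
      exact End.mem_eigenspace_iff.2 hv
    simp [this]
  have hθ (v : V) : ρ θ v = (ψ θ : K) • v := by
    rw [← End.mem_eigenspace_iff, hE]
    trivial
  have hstable := fun g v hv => h.apply_mem (End.eigenspace (ρ w) (ψ w : K))
    (fun z hz v hv => by rw [hρ z hz]; exact Submodule.smul_mem _ _ hv)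
    (fun v hv => by rw [hθ]; exact Submodule.smul_mem _ _ hv)
    (fun v hv => by rw [End.mem_eigenspace_iff.1 hv]; exact Submodule.smul_mem _ _ hv) g (v := v) hv
  rcases hirr _ hstable with hE' | hE'
  · -- `(w - ψ w) ^ 2 = 0` in characteristic two, so `w - ψ w` vanishes if it is injective
    have h1 : ρ w v - (ψ w : K) • v ∈ End.eigenspace (ρ w) (ψ w : K) := by
      rw [End.mem_eigenspace_iff, map_sub, map_smul, hρ.apply_w_w h, smul_sub, smul_smul,
        ← sub_eq_zero, ← neg_sub (_ • ρ w v), ← neg_add', ← two_smul K, CharTwo.two_eq_zero,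
        zero_smul, neg_zero]
    rwa [hE', Submodule.mem_bot, sub_eq_zero] at h1
  · rw [← End.mem_eigenspace_iff, hE']
    trivial

/-- In characteristic two a character is determined by its restriction to `Z`. -/
theorem eq_of_eqOn_of_isDihedralMod [CharP K 2] (h : IsDihedralMod Z θ w r) {ψ' : G →* Kˣ}
    (hZ : ∀ z ∈ Z, ψ z = ψ' z) : ψ = ψ' := by
  have hsq {a b : Kˣ} (hab : a * a = b * b) : a = b := by
    refine Units.ext (eq_of_pow_two_pow_eq 1 ?_)
    rw [pow_one, sq, sq, ← Units.val_mul, hab, Units.val_mul]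
  have hw : ψ w = ψ' w := hsq (by rw [← map_mul, ← map_mul, hZ _ h.mul_self_mem])
  have hθ : ψ θ = ψ' θ := hsq (by
    have := hZ _ h.conj_mem
    simpa only [map_mul, map_inv, mul_right_comm, mul_inv_cancel_comm, mul_inv_cancel,
      one_mul, mul_comm (ψ w), mul_comm (ψ' w), mul_inv_cancel_right] using this)
  ext g
  obtain ⟨i, z, hz, rfl | rfl⟩ := h.exists_eq g
  · simp only [map_mul, map_pow, hθ, hZ z hz]
  · simp only [map_mul, map_pow, hθ, hw, hZ z hz]

end IrreducibleDihedral

/-! ### Two-dimensional representations of dihedral groups -/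

section TwoDimensional

open Module Polynomial

variable {G : Type*} [Group G] {K : Type*} [Field K]
variable {V : Type*} [AddCommGroup V] [Module K V]
  {ρ : Representation K G V}
variable {Z : Subgroup G} [Z.Normal] {θ w : G} {r : ℕ} {ψ : G →* Kˣ}

theorem div_pow_eq {l : K} (hl : l ^ r = (ψ θ : K) ^ r) :
    ((ψ θ : K) ^ 2 / l) ^ r = (ψ θ : K) ^ r := by
  rw [div_pow, hl, ← pow_mul, mul_comm, pow_mul, sq,
    mul_div_cancel_left₀ _ (pow_ne_zero _ (ψ θ).ne_zero)]

theorem ne_zero_of_pow_eq (hr : Odd r) {l : K} (hl : l ^ r = (ψ θ : K) ^ r) : l ≠ 0 := by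
  rintro rfl
  rw [zero_pow hr.pos.ne'] at hl
  exact pow_ne_zero _ (ψ θ).ne_zero hl.symm

/-- The eigenspace of `θ` for `ψ θ` is stable, and `G` acts on it through `ψ`. -/
theorem eq_zero_of_isIrreducible_of_finrank_eq_two (h : IsDihedralMod Z θ w r)
    (hρ : IsDihedralRep Z θ w ψ ρ) (h2 : finrank K V = 2) (hirr : ρ.IsIrreducible) :
    finrank K (End.eigenspace (ρ θ) (ψ θ : K)) = 0 := by
  have hirr := (isIrreducible_iff.1 hirr).2
  rcases hirr (End.eigenspace (ρ θ) (ψ θ : K))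
    (fun g v hv => hρ.central.apply_mem_eigenspace h g hv) with hE | hE
  · rw [hE, finrank_bot]
  exfalso
  have hθ (v : V) : ρ θ v = (ψ θ : K) • v := by
    rw [← End.mem_eigenspace_iff, hE]
    trivial
  have : Nontrivial V := Module.nontrivial_of_finrank_pos (R := K) (by omega)
  obtain ⟨v, hv⟩ := exists_ne (0 : V)
  have hstable := fun g x hx => h.apply_mem (Submodule.span K {v})
    (fun z hz v hv => by rw [hρ.central z hz]; exact Submodule.smul_mem _ _ hv)
    (fun v hv => by rw [hθ]; exact Submodule.smul_mem _ _ hv)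
    (fun v hv => by rw [hρ.refl v (hθ v)]; exact Submodule.smul_mem _ _ hv) g (v := x) hx
  have hfr := finrank_span_singleton (K := K) hv
  rcases hirr _ hstable with h3 | h3
  · rw [h3, finrank_bot] at hfr
    omega
  · rw [h3, finrank_top] at hfr
    omega

variable [CharP K 2]

theorem div_eq_self_iff (hr : Odd r) {l : K} (hl : l ^ r = (ψ θ : K) ^ r) :
    (ψ θ : K) ^ 2 / l = l ↔ l = ψ θ := by
  rw [div_eq_iff (ne_zero_of_pow_eq hr hl), ← sq]
  exact ⟨fun h => (eq_of_pow_two_pow_eq 1 (by rw [pow_one, h])), fun h => by rw [h]⟩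

variable [IsAlgClosed K] [FiniteDimensional K V]

/-- The eigenvalues of `θ` other than `ψ θ` come in pairs with equal multiplicities. -/
theorem even_finrank (h : IsDihedralMod Z θ w r) (hρ : ActsBy Z ψ ρ)
    (h0 : finrank K (End.eigenspace (ρ θ) (ψ θ : K)) = 0) : Even (finrank K V) := by
  classical
  rw [finrank_eq_sum_eigenspace (cast_ne_zero_of_odd h.odd) (pow_ne_zero r (ψ θ).ne_zero)
    (hρ.pow_eq h), ← ZMod.natCast_eq_zero_iff_even, Nat.cast_sum]
  refine Finset.sum_involution (fun l _ => (ψ θ : K) ^ 2 / l) (fun l hl => ?_) (fun l hl hne => ?_)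
    (fun l hl => ?_) (fun l hl => ?_)
  · rw [hρ.finrank_eigenspace_div h, ← two_mul]
    rw [show (2 : ZMod 2) = 0 from rfl, zero_mul]
  · rw [Multiset.mem_toFinset, mem_roots_X_pow_sub_C (cast_ne_zero_of_odd h.odd)] at hl
    rw [Ne, div_eq_self_iff h.odd hl]
    rintro rfl
    rw [h0] at hne
    exact hne rfl
  · rw [Multiset.mem_toFinset, mem_roots_X_pow_sub_C (cast_ne_zero_of_odd h.odd)] at hl ⊢
    exact div_pow_eq hl
  · exact div_div_cancel₀ (pow_ne_zero _ (ψ θ).ne_zero)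

/-- All subrepresentations have even dimension. -/
theorem isIrreducible_of_finrank_eigenspace_eq_zero (h : IsDihedralMod Z θ w r)
    (hρ : ActsBy Z ψ ρ) (h2 : finrank K V = 2)
    (h0 : finrank K (End.eigenspace (ρ θ) (ψ θ : K)) = 0) : ρ.IsIrreducible := by
  rw [isIrreducible_iff]
  refine ⟨Module.nontrivial_of_finrank_pos (R := K) (by omega), fun W hW => ?_⟩
  let σ : Representation K G W := (⟨W, fun g v hv => hW g v hv⟩ : Subrepresentation ρ).toRepresentation
  have hσ (g : G) (v : W) : ((σ g v : W) : V) = ρ g v := rfl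
  have hσZ : ActsBy Z ψ σ := fun z hz v => Subtype.ext (by rw [hσ, hρ z hz]; rfl)
  have h1 : finrank K (End.eigenspace (σ θ) (ψ θ : K)) = 0 := by
    rw [finrank_eq_zero_iff_of_free, Submodule.subsingleton_iff_eq_bot] at h0 ⊢
    rw [eq_bot_iff] at h0 ⊢
    intro v hv
    have := h0 (x := (v : V)) (End.mem_eigenspace_iff.2 (by
      rw [← hσ, End.mem_eigenspace_iff.1 hv]; rfl))
    exact Subtype.ext this
  have heven := even_finrank h hσZ h1
  have hle : finrank K W ≤ 2 := h2 ▸ Submodule.finrank_le W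
  rcases (show finrank K W = 0 ∨ finrank K W = 2 by
    obtain ⟨k, hk⟩ := heven
    omega) with h3 | h3
  · exact Or.inl (Submodule.finrank_eq_zero.1 h3)
  · exact Or.inr (Submodule.eq_top_of_finrank_eq (h3.trans h2.symm))

/-- A two-dimensional irreducible representation has the eigenvalues `l` and `ψ(θ)² / l`. -/
theorem exists_eigenvalue_of_isIrreducible [DecidableEq K] (h : IsDihedralMod Z θ w r)
    (hρ : IsDihedralRep Z θ w ψ ρ) (h2 : finrank K V = 2) (hirr : ρ.IsIrreducible) :
    ∃ l : K, l ^ r = (ψ θ : K) ^ r ∧ l ≠ ψ θ ∧ ∀ μ, finrank K (End.eigenspace (ρ θ) μ) =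
      if μ = l ∨ μ = (ψ θ : K) ^ 2 / l then 1 else 0 := by
  have h0 := eq_zero_of_isIrreducible_of_finrank_eq_two h hρ h2 hirr
  have hr : (r : K) ≠ 0 := cast_ne_zero_of_odd h.odd
  have ht := hρ.central.pow_eq h
  have hsum := finrank_eq_sum_eigenspace hr (pow_ne_zero r (ψ θ).ne_zero) ht
  rw [h2] at hsum
  obtain ⟨l, hl, hne⟩ := Finset.exists_ne_zero_of_sum_ne_zero (hsum ▸ two_ne_zero)
  rw [Multiset.mem_toFinset, mem_roots_X_pow_sub_C hr] at hl
  have hlψ : l ≠ ψ θ := by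
    rintro rfl
    exact hne h0
  have hll' : l ≠ (ψ θ : K) ^ 2 / l := fun h' => hlψ ((div_eq_self_iff h.odd hl).1 h'.symm)
  have hd' := hρ.central.finrank_eigenspace_div h l
  refine ⟨l, hl, hlψ, fun μ => ?_⟩
  by_cases hμr : μ ^ r = (ψ θ : K) ^ r
  swap
  · rw [eigenspace_eq_bot ht hμr, finrank_bot, if_neg]
    rintro (rfl | rfl)
    · exact hμr hl
    · exact hμr (div_pow_eq hl)
  have hmem (μ : K) (hμ : μ ^ r = (ψ θ : K) ^ r) :
      μ ∈ (X ^ r - C ((ψ θ : K) ^ r) : K[X]).roots.toFinset := by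
    rw [Multiset.mem_toFinset, mem_roots_X_pow_sub_C hr]
    exact hμ
  split_ifs with hμ
  · have hle : ∑ μ ∈ {l, (ψ θ : K) ^ 2 / l}, finrank K (End.eigenspace (ρ θ) μ) ≤ 2 := by
      refine (Finset.sum_le_sum_of_subset ?_).trans_eq hsum.symm
      intro μ hμ
      rw [Finset.mem_insert, Finset.mem_singleton] at hμ
      rcases hμ with rfl | rfl
      · exact hmem _ hl
      · exact hmem _ (div_pow_eq hl)
    rw [Finset.sum_pair hll', hd'] at hle
    rcases hμ with rfl | rfl
    · omega
    · omega
  · have hle : ∑ μ ∈ {l, (ψ θ : K) ^ 2 / l, μ}, finrank K (End.eigenspace (ρ θ) μ) ≤ 2 := by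
      refine (Finset.sum_le_sum_of_subset ?_).trans_eq hsum.symm
      intro μ hμ
      rw [Finset.mem_insert, Finset.mem_insert, Finset.mem_singleton] at hμ
      rcases hμ with rfl | rfl | rfl
      · exact hmem _ hl
      · exact hmem _ (div_pow_eq hl)
      · exact hmem _ hμr
    rw [not_or] at hμ
    rw [Finset.sum_insert (by simp [hll', Ne.symm hμ.1]),
      Finset.sum_pair (Ne.symm hμ.2), hd'] at hle
    omega

/-- The two-dimensional subrepresentation spanned by the eigenvectors for `l` and `ψ(θ)² / l`. -/
theorem exists_two_dimensional [DecidableEq K] (h : IsDihedralMod Z θ w r)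
    (hρ : IsDihedralRep Z θ w ψ ρ)
    (hd : ∀ l, l ^ r = (ψ θ : K) ^ r → finrank K (End.eigenspace (ρ θ) l) = 1) {l : K}
    (hl : l ^ r = (ψ θ : K) ^ r) (hlψ : l ≠ ψ θ) :
    ∃ π : Representation K G (Fin 2 → K), IsDihedralRep Z θ w ψ π ∧
      ∀ μ, finrank K (End.eigenspace (π θ) μ) =
        if μ = l ∨ μ = (ψ θ : K) ^ 2 / l then 1 else 0 := by
  have hψ0 : ((ψ θ : K) ^ 2) ≠ 0 := pow_ne_zero _ (ψ θ).ne_zero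
  set l' := (ψ θ : K) ^ 2 / l with hl'
  have hll' : l ≠ l' := fun h' => hlψ ((div_eq_self_iff h.odd hl).1 h'.symm)
  have hdd : (ψ θ : K) ^ 2 / l' = l := div_div_cancel₀ hψ0
  set W : Submodule K V := End.eigenspace (ρ θ) l ⊔ End.eigenspace (ρ θ) l' with hW
  have hWθ (μ : K) (v : V) (hv : v ∈ End.eigenspace (ρ θ) μ) :
      ρ θ v ∈ End.eigenspace (ρ θ) μ := by
    rw [End.mem_eigenspace_iff.1 hv]
    exact Submodule.smul_mem _ _ hv
  have hWw (μ : K) (v : V) (hv : v ∈ End.eigenspace (ρ θ) μ) :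
      ρ w v ∈ End.eigenspace (ρ θ) ((ψ θ : K) ^ 2 / μ) :=
    End.mem_eigenspace_iff.2 (hρ.central.apply_w_of_mem_eigenspace h (End.mem_eigenspace_iff.1 hv))
  have hWg (g : G) (v : V) (hv : v ∈ W) : ρ g v ∈ W := by
    refine h.apply_mem W (fun z hz v hv => ?_) ?_ ?_ g hv
    · rw [hρ.central z hz]
      exact Submodule.smul_mem _ _ hv
    · intro v hv
      obtain ⟨a, ha, b, hb, rfl⟩ := Submodule.mem_sup.1 hv
      rw [map_add]
      exact add_mem (Submodule.mem_sup_left (hWθ _ _ ha)) (Submodule.mem_sup_right (hWθ _ _ hb))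
    · intro v hv
      obtain ⟨a, ha, b, hb, rfl⟩ := Submodule.mem_sup.1 hv
      rw [map_add]
      refine add_mem (Submodule.mem_sup_right (hWw _ _ ha)) (Submodule.mem_sup_left ?_)
      rw [← hdd]
      exact hWw _ _ hb
  have hdisj : Disjoint (End.eigenspace (ρ θ) l) (End.eigenspace (ρ θ) l') :=
    (End.eigenspaces_iSupIndep (ρ θ)).pairwiseDisjoint hll'
  have hfr : finrank K W = 2 := by
    have := Submodule.finrank_sup_add_finrank_inf_eq (End.eigenspace (ρ θ) l)
      (End.eigenspace (ρ θ) l')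
    rw [disjoint_iff.1 hdisj, finrank_bot, hd l hl, hd l' (div_pow_eq hl)] at this
    exact this
  let σ : Representation K G W := (⟨W, fun g v hv => hWg g v hv⟩ : Subrepresentation ρ).toRepresentation
  have hσ (g : G) (v : W) : ((σ g v : W) : V) = ρ g v := rfl
  have hσd (μ : K) : finrank K (End.eigenspace (σ θ) μ) = if μ = l ∨ μ = l' then 1 else 0 := by
    have hmap : (End.eigenspace (σ θ) μ).map W.subtype = W ⊓ End.eigenspace (ρ θ) μ := by
      ext v
      simp only [Submodule.mem_map, End.mem_eigenspace_iff, Submodule.mem_inf]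
      constructor
      · rintro ⟨v, hv, rfl⟩
        exact ⟨v.2, congrArg Subtype.val hv⟩
      · rintro ⟨hv, hv'⟩
        exact ⟨⟨v, hv⟩, Subtype.ext hv', rfl⟩
    rw [← Submodule.finrank_map_subtype_eq W, hmap]
    split_ifs with hμ
    · rcases hμ with rfl | rfl
      · rw [inf_eq_right.2 le_sup_left, hd _ hl]
      · rw [inf_eq_right.2 le_sup_right, hd _ (div_pow_eq hl)]
    · rw [not_or] at hμ
      have hind := End.eigenspaces_iSupIndep (ρ θ) μ
      have : Disjoint (End.eigenspace (ρ θ) μ) W :=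
        hind.mono_right (sup_le (le_iSup₂_of_le (f := fun j (_ : j ≠ μ) => End.eigenspace (ρ θ) j) l
          (Ne.symm hμ.1) le_rfl)
          (le_iSup₂_of_le (f := fun j (_ : j ≠ μ) => End.eigenspace (ρ θ) j) l'
          (Ne.symm hμ.2) le_rfl))
      rw [inf_comm, disjoint_iff.1 this, finrank_bot]
  have hσD : IsDihedralRep Z θ w ψ σ := hρ.restrict W.subtype W.injective_subtype fun _ _ => rfl
  let e : W ≃ₗ[K] (Fin 2 → K) := LinearEquiv.ofFinrankEq _ _ (by rw [hfr, finrank_fin_fun])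
  have he (g : G) (v : W) : e (σ g v) = transport e σ g (e v) := by
    rw [transport_apply, e.symm_apply_apply]
  refine ⟨transport e σ, hσD.of_equiv e he, fun μ => ?_⟩
  rw [← hσd μ]
  exact (finrank_eigenspace_congr e (he θ) μ).symm

/-- The two-dimensional irreducible representations, given one in which all eigenvalues of the
rotation occur once: there is one for each pair of eigenvalues `l ≠ ψ(θ)² / l`. -/
theorem exists_system_two_dimensional (h : IsDihedralMod Z θ w r)
    (hρ : IsDihedralRep Z θ w ψ ρ)
    (hd : ∀ l, l ^ r = (ψ θ : K) ^ r → finrank K (End.eigenspace (ρ θ) l) = 1) :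
    ∃ (m : ℕ) (π : Fin m → Representation K G (Fin 2 → K)),
      (∀ i, IsDihedralRep Z θ w ψ (π i)) ∧ (∀ i, (π i).IsIrreducible) ∧
      (∀ i j, Nonempty ((π i).Equiv (π j)) → i = j) ∧
      (∀ (W : Type) [AddCommGroup W] [Module K W] (τ : Representation K G W),
        finrank K W = 2 → IsDihedralRep Z θ w ψ τ → τ.IsIrreducible →
          ∃ i, Nonempty (τ.Equiv (π i))) ∧
      ∀ l, l ^ r = (ψ θ : K) ^ r → ∑ i, finrank K (End.eigenspace (π i θ) l) +
        finrank K (End.eigenspace (charRep ψ θ) l) = 1 := by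
  classical
  have hr : (r : K) ≠ 0 := cast_ne_zero_of_odd h.odd
  have hψ0 : ((ψ θ : K) ^ 2) ≠ 0 := pow_ne_zero _ (ψ θ).ne_zero
  -- a linear order on the field singles out one of `l` and `ψ(θ)² / l`
  let : LinearOrder K := WellOrderingRel.isWellOrder.linearOrder
  let S : Finset K := (X ^ r - C ((ψ θ : K) ^ r) : K[X]).roots.toFinset.filter
    fun l => l < (ψ θ : K) ^ 2 / l
  have hS (l : K) : l ∈ S ↔ l ^ r = (ψ θ : K) ^ r ∧ l < (ψ θ : K) ^ 2 / l := by
    rw [Finset.mem_filter, Multiset.mem_toFinset, mem_roots_X_pow_sub_C hr]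
  have hSψ (l : K) (hl : l ∈ S) : l ≠ ψ θ := by
    rintro rfl
    have := ((hS _).1 hl).2
    rw [(div_eq_self_iff h.odd rfl).2 rfl] at this
    exact lt_irrefl _ this
  let e := S.equivFin
  have hex := fun i : Fin S.card => exists_two_dimensional h hρ hd
    ((hS _).1 (e.symm i).2).1 (hSψ _ (e.symm i).2)
  choose π hπ hπd using hex
  have hcase (l : K) (i : Fin S.card) (hl : l ∈ S) (h' : l = (e.symm i : K) ∨
      l = (ψ θ : K) ^ 2 / (e.symm i : K)) : l = (e.symm i : K) := by
    rcases h' with h' | h'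
    · exact h'
    · have h1 := ((hS _).1 hl).2
      have h2 := ((hS _).1 (e.symm i).2).2
      rw [← h'] at h2
      rw [h', div_div_cancel₀ hψ0, ← h'] at h1
      exact absurd h1 h2.asymm
  refine ⟨S.card, π, hπ, fun i => ?_, fun i j hij => ?_, ?_, fun l hl => ?_⟩
  · refine isIrreducible_of_finrank_eigenspace_eq_zero h (hπ i).central (finrank_fin_fun K) ?_
    rw [hπd, if_neg]
    have h1 := hSψ _ (e.symm i).2
    rintro (h2 | h2)
    · exact h1 h2.symm
    · refine h1 ?_
      rw [eq_div_iff (ne_zero_of_pow_eq h.odd ((hS _).1 (e.symm i).2).1), sq] at h2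
      exact mul_left_cancel₀ (ψ θ).ne_zero h2
  · obtain ⟨f⟩ := hij
    have h1 := finrank_eigenspace_congr f.toLinearEquiv
      (fun v => LinearMap.congr_fun (f.isIntertwining' θ) v) (e.symm i : K)
    rw [hπd, hπd, if_pos (Or.inl rfl)] at h1
    have h2 := hcase _ j (e.symm i).2 (by
      by_contra h3
      rw [if_neg h3] at h1
      exact one_ne_zero h1)
    exact e.symm.injective (Subtype.ext h2)
  · intro W _ _ τ hW hτ hirr
    have : FiniteDimensional K W := .of_finrank_pos (by omega)
    obtain ⟨l, hl, hlψ, hτd⟩ := exists_eigenvalue_of_isIrreducible h hτ hW hirr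
    have key : ∃ l₀ ∈ S, ∀ μ, (μ = l ∨ μ = (ψ θ : K) ^ 2 / l) ↔
        (μ = l₀ ∨ μ = (ψ θ : K) ^ 2 / l₀) := by
      rcases lt_trichotomy l ((ψ θ : K) ^ 2 / l) with h1 | h1 | h1
      · exact ⟨l, (hS l).2 ⟨hl, h1⟩, fun μ => Iff.rfl⟩
      · exact absurd ((div_eq_self_iff h.odd hl).1 h1.symm) hlψ
      · refine ⟨(ψ θ : K) ^ 2 / l, (hS _).2 ⟨div_pow_eq hl, ?_⟩, fun μ => ?_⟩
        · rwa [div_div_cancel₀ hψ0]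
        · rw [div_div_cancel₀ hψ0, or_comm]
    obtain ⟨l₀, hl₀, hiff⟩ := key
    refine ⟨e ⟨l₀, hl₀⟩, nonempty_equiv_of_finrank_eigenspace h hτ (hπ _) fun μ _ => ?_⟩
    rw [hτd, hπd, e.symm_apply_apply]
    simp only [hiff]
  · simp_rw [hπd, finrank_eigenspace_charRep]
    by_cases hlψ : l = ψ θ
    · rw [if_pos hlψ, Finset.sum_eq_zero]
      intro i _
      rw [if_neg]
      have h1 := hSψ _ (e.symm i).2
      rintro (h2 | h2)
      · exact h1 (h2.symm.trans hlψ)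
      · refine h1 ?_
        rw [hlψ, eq_div_iff (ne_zero_of_pow_eq h.odd ((hS _).1 (e.symm i).2).1), sq] at h2
        exact mul_left_cancel₀ (ψ θ).ne_zero h2
    · rw [if_neg hlψ, add_zero]
      have key : ∃ l₀ ∈ S, l = l₀ ∨ l = (ψ θ : K) ^ 2 / l₀ := by
        rcases lt_trichotomy l ((ψ θ : K) ^ 2 / l) with h1 | h1 | h1
        · exact ⟨l, (hS l).2 ⟨hl, h1⟩, Or.inl rfl⟩
        · exact absurd ((div_eq_self_iff h.odd hl).1 h1.symm) hlψ
        · refine ⟨(ψ θ : K) ^ 2 / l, (hS _).2 ⟨div_pow_eq hl, ?_⟩, Or.inr ?_⟩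
          · rwa [div_div_cancel₀ hψ0]
          · rw [div_div_cancel₀ hψ0]
      obtain ⟨l₀, hl₀, hor⟩ := key
      rw [Finset.sum_eq_single (e ⟨l₀, hl₀⟩)]
      · rw [e.symm_apply_apply, if_pos hor]
      · intro i _ hi
        rw [if_neg]
        intro h'
        refine hi ?_
        rw [← e.symm_apply_eq]
        refine Subtype.ext (hcase l₀ i hl₀ ?_).symm
        rcases hor with rfl | rfl
        · exact h'
        · rcases h' with h' | h'
          · exact Or.inr (by rw [← h', div_div_cancel₀ hψ0])
          · left
            rw [← div_div_cancel₀ hψ0 (b := l₀), h', div_div_cancel₀ hψ0]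
      · intro hn
        exact absurd (Finset.mem_univ _) hn

end TwoDimensional

/-! ### Composition factors and semisimplification -/

section CompositionFactors

open Module

variable {G : Type*} [Group G] {K : Type*} [Field K]

theorem fin_sum_telescope {n : ℕ} (f : Fin (n + 1) → ℕ) (g : Fin n → ℕ)
    (h : ∀ i : Fin n, f i.succ = f i.castSucc + g i) : f (Fin.last n) = f 0 + ∑ i, g i := by
  induction n with
  | zero => simp
  | succ n ih =>
    rw [Fin.sum_univ_castSucc, ← add_assoc, ← Fin.castSucc_zero,
      ← ih (fun i => f i.castSucc) (fun i => g i.castSucc) (fun i => h i.castSucc), ← h,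
      Fin.succ_last]

section GroupAlgebra

variable {M : Type*} [AddCommGroup M] [Module K M] [Module K[G] M] [IsScalarTower K K[G] M]

theorem ofModule'_apply (g : G) (x : M) :
    Representation.ofModule' (k := K) (G := G) M g x = MonoidAlgebra.of K G g • x := rfl

theorem isIrreducible_ofModule' (h : IsSimpleModule K[G] M) :
    (Representation.ofModule' (k := K) (G := G) M).IsIrreducible := by
  rw [isIrreducible_iff]
  refine ⟨h.nontrivial, fun W hW => ?_⟩
  let W' : Submodule K[G] M := MonoidAlgebra.submoduleOfSMulMem W hW
  have hW' (x : M) : x ∈ W' ↔ x ∈ W := Iff.rfl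
  rcases eq_bot_or_eq_top W' with h1 | h1
  · left
    ext x
    rw [← hW', h1]
    rfl
  · right
    ext x
    rw [← hW', h1]
    simp

theorem finrank_eigenspace_of_exact_module {A B Q : Type*} [AddCommGroup A] [Module K A]
    [Module K[G] A] [IsScalarTower K K[G] A] [AddCommGroup B] [Module K B] [Module K[G] B]
    [IsScalarTower K K[G] B] [AddCommGroup Q] [Module K Q] [Module K[G] Q] [IsScalarTower K K[G] Q]
    [FiniteDimensional K B] {r : ℕ} {c : K} (hr : (r : K) ≠ 0) (hc : c ≠ 0) {θ : G}
    (ht : ∀ x : B, MonoidAlgebra.of K G (θ ^ r) • x = c • x) (i : A →ₗ[K[G]] B) (π : B →ₗ[K[G]] Q)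
    (hinj : Function.Injective i) (hsurj : Function.Surjective π)
    (hex : ∀ b, (∃ a, i a = b) ↔ π b = 0) (l : K) :
    finrank K (End.eigenspace (Representation.ofModule' (k := K) (G := G) B θ) l) =
      finrank K (End.eigenspace (Representation.ofModule' (k := K) (G := G) A θ) l) +
      finrank K (End.eigenspace (Representation.ofModule' (k := K) (G := G) Q θ) l) := by
  refine finrank_eigenspace_of_exact hr hc ?_ (i.restrictScalars K) (π.restrictScalars K)
    (fun a => i.map_smul _ a) (fun b => π.map_smul _ b) hinj hsurj ?_ l
  · refine LinearMap.ext fun x => ?_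
    rw [← map_pow]
    exact ht x
  · ext b
    exact hex b

/-- The dimension of an eigenspace of a group element, for submodules and their quotients. -/
theorem finrank_eigenspace_submodule [FiniteDimensional K M] {r : ℕ} {c : K} (hr : (r : K) ≠ 0)
    (hc : c ≠ 0) {θ : G}
    (ht : ∀ x : M, MonoidAlgebra.of K G (θ ^ r) • x = c • x) {A B : Submodule K[G] M}
    (hAB : A ≤ B) (l : K) :
    finrank K (End.eigenspace (Representation.ofModule' (k := K) (G := G) B θ) l) =
      finrank K (End.eigenspace (Representation.ofModule' (k := K) (G := G) A θ) l) +
      finrank K (End.eigenspace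
        (Representation.ofModule' (k := K) (G := G) (B ⧸ A.submoduleOf B) θ) l) := by
  have : FiniteDimensional K B := FiniteDimensional.of_injective
    (B.subtype.restrictScalars K) B.injective_subtype
  refine finrank_eigenspace_of_exact_module hr hc (fun x => Subtype.ext (ht x))
    (Submodule.inclusion hAB) (A.submoduleOf B).mkQ (Submodule.inclusion_injective hAB)
    (Submodule.mkQ_surjective _) (fun x => ?_) l
  rw [Submodule.mkQ_apply, Submodule.Quotient.mk_eq_zero]
  constructor
  · rintro ⟨y, rfl⟩
    exact y.2
  · intro hx
    exact ⟨⟨x, hx⟩, rfl⟩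

theorem finiteDimensional_of_surjective_module {B Q : Type*} [AddCommGroup B] [Module K B]
    [Module K[G] B] [IsScalarTower K K[G] B] [AddCommGroup Q] [Module K Q] [Module K[G] Q]
    [IsScalarTower K K[G] Q] [FiniteDimensional K B] (π : B →ₗ[K[G]] Q)
    (hsurj : Function.Surjective π) : FiniteDimensional K Q :=
  FiniteDimensional.of_surjective (π.restrictScalars K) hsurj

theorem finiteDimensional_subquotient [FiniteDimensional K M] (A B : Submodule K[G] M) :
    FiniteDimensional K (B ⧸ A.submoduleOf B) := by
  have : FiniteDimensional K B := FiniteDimensional.of_injective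
    (B.subtype.restrictScalars K) B.injective_subtype
  exact finiteDimensional_of_surjective_module (G := G) (A.submoduleOf B).mkQ
    (Submodule.mkQ_surjective _)

theorem smul_eq_of_subquotient {A B : Submodule K[G] M} {g : G} {c : K}
    (hg : ∀ x : M, MonoidAlgebra.of K G g • x = c • x) (x : B ⧸ A.submoduleOf B) :
    MonoidAlgebra.of K G g • x = c • x := by
  obtain ⟨y, rfl⟩ := Submodule.mkQ_surjective _ x
  have hy : MonoidAlgebra.of K G g • y = c • y := Subtype.ext (hg y)
  rw [← map_smul, hy]
  rfl

theorem finrank_eigenspace_compositionSeries [FiniteDimensional K M] {r : ℕ} {c : K}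
    (hr : (r : K) ≠ 0) (hc : c ≠ 0) {θ : G}
    (ht : ∀ x : M, MonoidAlgebra.of K G (θ ^ r) • x = c • x)
    (s : CompositionSeries (Submodule K[G] M)) (hs0 : s.head = ⊥) (hs1 : s.last = ⊤) (l : K) :
    finrank K (End.eigenspace (Representation.ofModule' (k := K) (G := G) M θ) l) =
      ∑ i : Fin s.length, finrank K (End.eigenspace (Representation.ofModule' (k := K) (G := G)
        ((s i.succ : Submodule K[G] M) ⧸
          (s i.castSucc : Submodule K[G] M).submoduleOf (s i.succ)) θ) l) := by
  have h1 := fin_sum_telescope (fun i => finrank K (End.eigenspace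
    (Representation.ofModule' (k := K) (G := G) (s i : Submodule K[G] M) θ) l)) _
    (fun i => finrank_eigenspace_submodule hr hc ht (s.step i).le l)
  have h2 : finrank K (End.eigenspace (Representation.ofModule' (k := K) (G := G)
      (s 0 : Submodule K[G] M) θ) l) = 0 := by
    have hs0' : s 0 = ⊥ := hs0
    have : Subsingleton (s 0 : Submodule K[G] M) := by
      rw [hs0']
      infer_instance
    exact finrank_zero_of_subsingleton
  have h3 : finrank K (End.eigenspace (Representation.ofModule' (k := K) (G := G)
      (s (Fin.last _) : Submodule K[G] M) θ) l) =
      finrank K (End.eigenspace (Representation.ofModule' (k := K) (G := G) M θ) l) := by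
    have hs1' : s (Fin.last _) = ⊤ := hs1
    refine finrank_eigenspace_congr (LinearEquiv.ofBijective
      ((s (Fin.last _)).subtype.restrictScalars K)
      ⟨Submodule.injective_subtype _, fun x => ⟨⟨x, ?_⟩, rfl⟩⟩) (fun v => rfl) l
    rw [hs1']
    trivial
  rw [← h3, h1, h2, zero_add]

end GroupAlgebra

universe u

variable {Z : Subgroup G} {θ w : G} {r : ℕ} {ψ : G →* Kˣ}

/-- Successive quotients of a composition series are dihedral if all irreducible representations on
which the scalars of the module persist are. -/
theorem isDihedralRep_of_covBy {M : Type u} [AddCommGroup M] [Module K M] [FiniteDimensional K M]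
    [Module K[G] M] [IsScalarTower K K[G] M]
    (hfac : ∀ (Q : Type u) [AddCommGroup Q] [Module K Q] [FiniteDimensional K Q]
      (σ : Representation K G Q), σ.IsIrreducible →
      (∀ (g : G) (c : K), (∀ x : M, MonoidAlgebra.of K G g • x = c • x) →
        ∀ x, σ g x = c • x) → IsDihedralRep Z θ w ψ σ)
    {A B : Submodule K[G] M} (hAB : A ⋖ B) :
    IsDihedralRep Z θ w ψ (Representation.ofModule' (k := K) (G := G) (B ⧸ A.submoduleOf B)) := by
  have := finiteDimensional_subquotient (K := K) A B
  have hsimple := (covBy_iff_quot_is_simple hAB.le).1 hAB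
  exact hfac _ _ (isIrreducible_ofModule' hsimple) fun g c hg => smul_eq_of_subquotient hg

variable [CharP K 2] [IsAlgClosed K] [Z.Normal]

theorem nonempty_linearEquiv_pi (h : IsDihedralMod Z θ w r) {ι : Type*} [Fintype ι] {Q : ι → Type*}
    [∀ i, AddCommGroup (Q i)] [∀ i, Module K (Q i)] [∀ i, FiniteDimensional K (Q i)]
    [∀ i, Module K[G] (Q i)] [∀ i, IsScalarTower K K[G] (Q i)]
    (hσ : ∀ i, IsDihedralRep Z θ w ψ (Representation.ofModule' (k := K) (G := G) (Q i)))
    {W : Type*} [AddCommGroup W] [Module K W] [FiniteDimensional K W] {τ : Representation K G W}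
    (hτ : IsDihedralRep Z θ w ψ τ)
    (hd : ∀ l, l ^ r = (ψ θ : K) ^ r → finrank K (End.eigenspace (τ θ) l) =
      ∑ i, finrank K (End.eigenspace (Representation.ofModule' (k := K) (G := G) (Q i) θ) l)) :
    Nonempty (τ.asModule ≃ₗ[K[G]] ∀ i, Q i) := by
  have hσP := IsDihedralRep.pi hσ (Representation.ofModule' (k := K) (G := G) (∀ i, Q i))
    (fun i => LinearMap.proj i) (fun v v' hv => funext hv) (fun _ _ _ => rfl)
  obtain ⟨e⟩ := nonempty_equiv_of_finrank_eigenspace h hτ hσP (fun l hl => by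
    rw [hd l hl]
    exact (finrank_eigenspace_pi
      (fun i => Representation.ofModule' (k := K) (G := G) (Q i) θ) _ (fun _ _ => rfl) l).symm)
  refine ⟨LinearEquiv.ofBijective (MonoidAlgebra.equivariantOfLinearOfComm
    (e.toLinearEquiv.toLinearMap ∘ₗ τ.asModuleEquiv.toLinearMap) fun g v => ?_)
    (e.toLinearEquiv.bijective.comp τ.asModuleEquiv.bijective)⟩
  have := LinearMap.congr_fun (e.isIntertwining' g) (τ.asModuleEquiv v)
  refine Eq.trans ?_ this
  change e.toLinearEquiv (τ.asModuleEquiv (MonoidAlgebra.single g (1 : K) • v)) = _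
  rw [Representation.asModuleEquiv_map_smul, Representation.asAlgebraHom_single, one_smul]
  rfl

/-- The semisimplification of `ρ` is determined by the dimensions of the eigenspaces of the
rotation, provided that all composition factors of `ρ` are twisted representations of the dihedral
group. -/
theorem isSemisimplification_of_finrank_eigenspace (h : IsDihedralMod Z θ w r)
    {V : Type u} [AddCommGroup V] [Module K V] [FiniteDimensional K V] {ρ : Representation K G V}
    (hfac : ∀ (Q : Type u) [AddCommGroup Q] [Module K Q] [FiniteDimensional K Q]
      (σ : Representation K G Q), σ.IsIrreducible →
      (∀ (g : G) (c : K), (∀ v, ρ g v = c • v) → ∀ x, σ g x = c • x) → IsDihedralRep Z θ w ψ σ)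
    (ht : ∀ v, ρ (θ ^ r) v = (ψ θ : K) ^ r • v)
    {W : Type*} [AddCommGroup W] [Module K W] [FiniteDimensional K W] {τ : Representation K G W}
    (hτ : IsDihedralRep Z θ w ψ τ)
    (hd : ∀ l, l ^ r = (ψ θ : K) ^ r →
      finrank K (End.eigenspace (ρ θ) l) = finrank K (End.eigenspace (τ θ) l)) :
    IsSemisimplification ρ τ := by
  have hNoeth : IsNoetherian K[G] ρ.asModule := isNoetherian_of_tower K inferInstance
  have hArt : IsArtinian K[G] ρ.asModule := isArtinian_of_tower K inferInstance
  obtain ⟨s, hs0, hs1⟩ := exists_compositionSeries_of_isNoetherian_isArtinian K[G] ρ.asModule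
  refine ⟨s, hs0, hs1, ?_⟩
  have hof (g : G) (x : ρ.asModule) :
      MonoidAlgebra.of K G g • x = ρ.asModuleEquiv.symm (ρ g (ρ.asModuleEquiv x)) := by
    rw [Representation.asModuleEquiv_symm_map_rho, LinearEquiv.symm_apply_apply]
  have hσ (i : Fin s.length) := isDihedralRep_of_covBy (M := ρ.asModule) (Z := Z) (θ := θ) (w := w)
    (ψ := ψ) (fun Q _ _ _ σ hσ hg => hfac Q σ hσ fun g c hgc => hg g c fun x => by
      rw [hof, hgc, map_smul, LinearEquiv.symm_apply_apply]) (s.step i)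
  have hfin (i : Fin s.length) := finiteDimensional_subquotient (K := K)
    (s i.castSucc : Submodule K[G] ρ.asModule) (s i.succ)
  refine nonempty_linearEquiv_pi h hσ hτ fun l hl => ?_
  rw [← hd l hl, ← finrank_eigenspace_compositionSeries (cast_ne_zero_of_odd h.odd)
      (pow_ne_zero _ (ψ θ).ne_zero)
      (fun x => by rw [hof, ht, map_smul, LinearEquiv.symm_apply_apply]) s hs0 hs1 l]
  exact (finrank_eigenspace_congr ρ.asModuleEquiv
    (fun v => by rw [ofModule'_apply, Representation.asModuleEquiv_map_smul,
      MonoidAlgebra.of_apply, Representation.asAlgebraHom_single, one_smul]) l).symm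

end CompositionFactors

/-! ### Cosets of a normal subgroup of index two -/

section Cosets

variable {G : Type*} [Group G] {Z : Subgroup G} [Z.Normal] {θ w : G} {r : ℕ}

namespace IsDihedralMod

variable (h : IsDihedralMod Z θ w r)
include h

theorem orderOf_eq : orderOf (θ : G ⧸ Z) = r :=
  Nat.dvd_antisymm (orderOf_dvd_of_pow_eq_one ((h.pow_eq_one_iff r).2 dvd_rfl))
    ((h.pow_eq_one_iff _).1 (pow_orderOf_eq_one _))

theorem pow_eq_pow_iff (i j : ℕ) : (θ : G ⧸ Z) ^ i = (θ : G ⧸ Z) ^ j ↔ i ≡ j [MOD r] := by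
  rw [pow_eq_pow_iff_modEq, h.orderOf_eq]

/-- A reflection is not a rotation, unless the rotation is trivial. -/
theorem eq_one_of_eq_pow_mul_inv {i j : ℕ}
    (hw : (w : G ⧸ Z) = (θ : G ⧸ Z) ^ i * ((θ : G ⧸ Z) ^ j)⁻¹) : r = 1 := by
  have hcomm : Commute (w : G ⧸ Z) (θ : G ⧸ Z) := by
    rw [hw]
    exact ((Commute.refl _).pow_left i).mul_left ((Commute.refl _).pow_left j).inv_left
  have h1 := h.conj
  rw [hcomm.eq, mul_assoc (θ : G ⧸ Z) (w : G ⧸ Z) (w : G ⧸ Z), h.w_mul_w, mul_one, ← sq, h.pow_eq_one_iff] at h1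
  have := (Nat.dvd_prime Nat.prime_two).1 h1
  rcases this with h2 | h2
  · exact h2
  · exact absurd h.odd (by rw [h2]; decide)

theorem exists_eq_w_mul (x : G ⧸ Z) :
    ∃ i : ℕ, x = (θ : G ⧸ Z) ^ i ∨ x = (w : G ⧸ Z) * (θ : G ⧸ Z) ^ i := by
  have hinv (i : ℕ) : ((θ : G ⧸ Z) ^ i)⁻¹ = (θ : G ⧸ Z) ^ ((r - 1) * i) := by
    rw [inv_eq_iff_mul_eq_one, ← pow_add, h.pow_eq_one_iff]
    refine ⟨i, ?_⟩
    obtain ⟨k, hk⟩ := Nat.exists_eq_add_of_le' h.odd.pos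
    rw [hk, Nat.add_sub_cancel]
    ring
  obtain ⟨i, hi | hi⟩ := h.gen x⁻¹
  · exact ⟨(r - 1) * i, Or.inl (by rw [← hinv, ← hi, inv_inv])⟩
  · refine ⟨(r - 1) * i, Or.inr ?_⟩
    rw [← hinv, ← inv_inv x, hi, mul_inv_rev, inv_eq_of_mul_eq_one_left h.w_mul_w]

/-- A nowhere vanishing function that transforms under right translation by the rotation through
a given root of unity `μ`. -/
theorem exists_multiplier {K : Type*} [Field K] {μ : K} (hμ : μ ^ r = 1) :
    ∃ g : G → K, (∀ x, g x ≠ 0) ∧ (∀ x, g (x * θ) = μ * g x) ∧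
      ∀ b x : G, ((b : G ⧸ Z) = 1 ∨ (b : G ⧸ Z) = w) → g (b * x) = g x := by
  have hμ0 : μ ≠ 0 := by
    rintro rfl
    rw [zero_pow h.odd.pos.ne'] at hμ
    exact zero_ne_one hμ
  choose i hi using fun x : G => h.exists_eq_w_mul x
  have huniq (x : G) (j : ℕ) (hj : (x : G ⧸ Z) = (θ : G ⧸ Z) ^ j ∨
      (x : G ⧸ Z) = (w : G ⧸ Z) * (θ : G ⧸ Z) ^ j) : μ ^ i x = μ ^ j := by
    have hmod : i x ≡ j [MOD r] := by
      rcases hi x with h1 | h1 <;> rcases hj with h2 | h2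
      · exact (h.pow_eq_pow_iff _ _).1 (h1.symm.trans h2)
      · rw [h.eq_one_of_eq_pow_mul_inv (eq_mul_inv_of_mul_eq (h2.symm.trans h1))]
        exact Nat.modEq_one
      · rw [h.eq_one_of_eq_pow_mul_inv (eq_mul_inv_of_mul_eq (h1.symm.trans h2))]
        exact Nat.modEq_one
      · exact (h.pow_eq_pow_iff _ _).1 (mul_left_cancel (h1.symm.trans h2))
    exact pow_eq_pow_of_modEq hmod hμ
  refine ⟨fun x => μ ^ i x, fun x => pow_ne_zero _ hμ0, fun x => ?_, fun b x hb => huniq _ _ ?_⟩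
  · rw [← pow_succ']
    refine huniq _ _ ?_
    rw [QuotientGroup.mk_mul, pow_succ, ← mul_assoc]
    exact (hi x).imp (fun h => by rw [h]) (fun h => by rw [h])
  · rw [QuotientGroup.mk_mul]
    rcases hb with hb | hb
    · rw [hb, one_mul]
      exact hi x
    · rw [hb]
      rcases hi x with h1 | h1
      · exact Or.inr (by rw [h1])
      · exact Or.inl (by rw [h1, ← mul_assoc, h.w_mul_w, one_mul])

theorem index_eq (B : Subgroup G) (hB : ∀ b : G, b ∈ B ↔ (b : G ⧸ Z) = 1 ∨ (b : G ⧸ Z) = w) :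
    B.index = r := by
  let f : Fin r → G ⧸ B := fun i => ((θ ^ (i : ℕ) : G) : G ⧸ B)
  have hf : Function.Bijective f := by
    constructor
    · intro i j hij
      rw [QuotientGroup.eq, hB, QuotientGroup.mk_mul, QuotientGroup.mk_inv, QuotientGroup.mk_pow,
        QuotientGroup.mk_pow] at hij
      refine Fin.ext ?_
      rcases hij with h1 | h1
      · rw [inv_mul_eq_one, h.pow_eq_pow_iff] at h1
        exact h1.eq_of_lt_of_lt i.2 j.2
      · have hr : r = 1 := h.eq_one_of_eq_pow_mul_inv (i := j) (j := i) (by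
          rw [← h1]
          exact (((Commute.refl (θ : G ⧸ Z)).pow_left i).inv_left.pow_right j).eq)
        have := i.2
        have := j.2
        omega
    · intro x
      obtain ⟨x, rfl⟩ := QuotientGroup.mk_surjective x
      obtain ⟨i, hi⟩ := h.gen x
      refine ⟨⟨i % r, Nat.mod_lt _ h.odd.pos⟩, ?_⟩
      rw [QuotientGroup.eq, hB, QuotientGroup.mk_mul, QuotientGroup.mk_inv, QuotientGroup.mk_pow]
      have hmod : (θ : G ⧸ Z) ^ (i % r) = (θ : G ⧸ Z) ^ i :=
        (h.pow_eq_pow_iff _ _).2 (Nat.mod_modEq _ _)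
      rw [hmod]
      exact hi.imp (fun h => by rw [h, inv_mul_cancel]) (fun h => by rw [h, inv_mul_cancel_left])
  rw [Subgroup.index, ← Nat.card_congr (Equiv.ofBijective f hf), Nat.card_eq_fintype_card,
    Fintype.card_fin]

end IsDihedralMod

end Cosets

/-! ### Smoothly induced representations -/

section Induction

open Module

variable {F : Type*} [Field F] [ValuativeRel F] [TopologicalSpace F] [IsNonarchimedeanLocalField F]
variable {D : Type*} [DivisionRing D] [Algebra F D]
variable {K : Type*} [Field K] {H : Subgroup Dˣ} {χ : H →* Kˣ} {M : ℕ}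

theorem smoothInd_apply (g : Dˣ) (f : smoothIndSpace F D H χ) (x : Dˣ) :
    (smoothInd F D H χ g f : Dˣ → K) x = (f : Dˣ → K) (x * g) := rfl

theorem mul_out_mem (x : Dˣ) : x * ((x⁻¹ : Dˣ) : Dˣ ⧸ H).out ∈ H := by
  have := QuotientGroup.mk_out_eq_mul H x⁻¹
  obtain ⟨h, hh⟩ := this
  rw [hh, mul_inv_cancel_left]
  exact h.2

/-- Smooth functions with `f (h x) = χ(h) f(x)` are determined by their values on representatives
of the cosets `H x`, which can be prescribed if `χ` is trivial on `U_D^M ≤ H`. -/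
def indEquiv (hM : ∀ u ∈ congrSubgroup F D M, ∃ hu : u ∈ H, χ ⟨u, hu⟩ = 1) :
    smoothIndSpace F D H χ ≃ₗ[K] (Dˣ ⧸ H → K) where
  toFun f s := (f : Dˣ → K) (s.out)⁻¹
  map_add' _ _ := rfl
  map_smul' _ _ := rfl
  invFun φ := ⟨fun x => (χ ⟨_, mul_out_mem (H := H) x⟩ : K) * φ ((x⁻¹ : Dˣ) : Dˣ ⧸ H), by
    constructor
    · intro h x
      have h1 : (((h * x : Dˣ)⁻¹ : Dˣ) : Dˣ ⧸ H) = ((x⁻¹ : Dˣ) : Dˣ ⧸ H) := by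
        rw [QuotientGroup.eq]
        simp
      have h2 : (⟨_, mul_out_mem (H := H) (h * x : Dˣ)⟩ : H) = h * ⟨_, mul_out_mem (H := H) x⟩ := by
        refine Subtype.ext ?_
        change (h : Dˣ) * x * _ = h * (x * _)
        rw [h1, mul_assoc]
      beta_reduce
      rw [h2, h1, map_mul, Units.val_mul, mul_assoc]
    · refine ⟨M, fun u hu x => ?_⟩
      obtain ⟨hu', hχ⟩ := hM _ (conj_mem_congrSubgroup F D M x hu)
      have h1 : (((x * u : Dˣ)⁻¹ : Dˣ) : Dˣ ⧸ H) = ((x⁻¹ : Dˣ) : Dˣ ⧸ H) := by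
        rw [QuotientGroup.eq]
        simpa [mul_assoc] using hu'
      have h2 : (⟨_, mul_out_mem (H := H) (x * u : Dˣ)⟩ : H) =
          ⟨_, hu'⟩ * ⟨_, mul_out_mem (H := H) x⟩ := by
        refine Subtype.ext ?_
        change x * u * _ = x * u * x⁻¹ * (x * _)
        rw [h1]
        group
      beta_reduce
      rw [h2, h1, map_mul, hχ, one_mul]⟩
  left_inv f := by
    refine Subtype.ext (funext fun x => ?_)
    change (χ ⟨_, mul_out_mem (H := H) x⟩ : K) * (f : Dˣ → K) (((x⁻¹ : Dˣ) : Dˣ ⧸ H).out)⁻¹ = _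
    rw [← f.2.1]
    exact congrArg (f : Dˣ → K) (mul_inv_cancel_right _ _)
  right_inv φ := by
    funext s
    change (χ ⟨_, _⟩ : K) * φ (((s.out⁻¹)⁻¹ : Dˣ) : Dˣ ⧸ H) = φ s
    have h1 : (((s.out⁻¹)⁻¹ : Dˣ) : Dˣ ⧸ H) = s := by rw [inv_inv, QuotientGroup.out_eq']
    have h2 : (⟨_, mul_out_mem (H := H) s.out⁻¹⟩ : H) = 1 := by
      refine Subtype.ext ?_
      change s.out⁻¹ * _ = 1
      rw [h1, inv_mul_cancel]
    rw [h2, h1, map_one, Units.val_one, one_mul]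

theorem indEquiv_apply (hM : ∀ u ∈ congrSubgroup F D M, ∃ hu : u ∈ H, χ ⟨u, hu⟩ = 1)
    (f : smoothIndSpace F D H χ) (s : Dˣ ⧸ H) : indEquiv hM f s = (f : Dˣ → K) (s.out)⁻¹ := rfl

theorem indEquiv_symm_apply (hM : ∀ u ∈ congrSubgroup F D M, ∃ hu : u ∈ H, χ ⟨u, hu⟩ = 1)
    (φ : Dˣ ⧸ H → K) (x : Dˣ) : ((indEquiv hM).symm φ : Dˣ → K) x =
      (χ ⟨_, mul_out_mem (H := H) x⟩ : K) * φ ((x⁻¹ : Dˣ) : Dˣ ⧸ H) := rfl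

theorem finiteDimensional_smoothInd (hM : ∀ u ∈ congrSubgroup F D M, ∃ hu : u ∈ H, χ ⟨u, hu⟩ = 1)
    (hi : H.index ≠ 0) : FiniteDimensional K (smoothIndSpace F D H χ) := by
  have : Finite (Dˣ ⧸ H) := Nat.finite_of_card_ne_zero hi
  exact (indEquiv hM).symm.finiteDimensional

theorem finrank_smoothInd (hM : ∀ u ∈ congrSubgroup F D M, ∃ hu : u ∈ H, χ ⟨u, hu⟩ = 1)
    (hi : H.index ≠ 0) : finrank K (smoothIndSpace F D H χ) = H.index := by
  have : Finite (Dˣ ⧸ H) := Nat.finite_of_card_ne_zero hi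
  have := Fintype.ofFinite (Dˣ ⧸ H)
  rw [(indEquiv hM).finrank_eq, finrank_pi, Subgroup.index, Nat.card_eq_fintype_card]

/-- A normal subgroup on which `χ` is the restriction of a class function `ω` acts on the induced
representation through `ω`. -/
theorem smoothInd_apply_of_normal {N : Subgroup Dˣ} [N.Normal] {ω : Dˣ → K}
    (hω : ∀ g x : Dˣ, ω (x * g * x⁻¹) = ω g)
    (hN : ∀ u ∈ N, ∃ hu : u ∈ H, χ ⟨u, hu⟩ = ω u) {g : Dˣ} (hg : g ∈ N)
    (f : smoothIndSpace F D H χ) : smoothInd F D H χ g f = ω g • f := by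
  refine Subtype.ext (funext fun x => ?_)
  obtain ⟨hu, hχ⟩ := hN _ (Subgroup.Normal.conj_mem inferInstance g hg x)
  rw [smoothInd_apply]
  change _ = ω g * (f : Dˣ → K) x
  rw [← hω g x, ← hχ, ← f.2.1]
  simp

theorem smoothInd_apply_of_mem_congrSubgroup
    (hM : ∀ u ∈ congrSubgroup F D M, ∃ hu : u ∈ H, χ ⟨u, hu⟩ = 1) {u : Dˣ}
    (hu : u ∈ congrSubgroup F D M) (f : smoothIndSpace F D H χ) : smoothInd F D H χ u f = f := by
  refine Subtype.ext (funext fun x => ?_)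
  obtain ⟨hu', hχ⟩ := hM _ (conj_mem_congrSubgroup F D M x hu)
  have := f.2.1 ⟨_, hu'⟩ x
  rw [hχ, Units.val_one, one_mul] at this
  rw [smoothInd_apply, ← this]
  simp

variable {Z : Subgroup Dˣ} [Z.Normal] {θ w : Dˣ} {r : ℕ}

/-- Multiplication by a function that transforms through a root of unity `μ` carries the
eigenspace for `l` to the one for `μ l`. -/
theorem finrank_eigenspace_smoothInd_mul_le (h : IsDihedralMod Z θ w r)
    (hH : ∀ b ∈ H, (b : Dˣ ⧸ Z) = 1 ∨ (b : Dˣ ⧸ Z) = w)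
    (hZ : ∃ m, congrSubgroup F D m ≤ Z) [FiniteDimensional K (smoothIndSpace F D H χ)] {μ : K}
    (hμ : μ ^ r = 1) (l : K) :
    finrank K (End.eigenspace (smoothInd F D H χ θ) l) ≤
      finrank K (End.eigenspace (smoothInd F D H χ θ) (μ * l)) := by
  obtain ⟨g, hg0, hgθ, hgb⟩ := h.exists_multiplier hμ
  obtain ⟨m₀, hm₀⟩ := hZ
  have hmem (f : smoothIndSpace F D H χ) : (fun x => g x * (f : Dˣ → K) x) ∈ smoothIndSpace F D H χ := by
    obtain ⟨m, hm⟩ := f.2.2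
    refine ⟨fun b x => ?_, max m m₀, fun u hu x => ?_⟩
    · beta_reduce
      rw [hgb b x (hH b b.2), f.2.1]
      ring
    · beta_reduce
      rw [hm u (congrSubgroup_anti F D (le_max_left _ _) hu)]
      congr 1
      have h1 : x * u = x * u * x⁻¹ * x := by group
      rw [h1, hgb]
      left
      rw [QuotientGroup.eq_one_iff]
      exact hm₀ (conj_mem_congrSubgroup F D m₀ x (congrSubgroup_anti F D (le_max_right _ _) hu))
  let T : End.eigenspace (smoothInd F D H χ θ) l →ₗ[K]
      End.eigenspace (smoothInd F D H χ θ) (μ * l) :=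
    { toFun := fun f => ⟨⟨_, hmem f⟩, by
        have hf := End.mem_eigenspace_iff.1 f.2
        rw [End.mem_eigenspace_iff]
        refine Subtype.ext (funext fun x => ?_)
        rw [smoothInd_apply]
        change g (x * θ) * (f.1 : Dˣ → K) (x * θ) = μ * l * (g x * (f.1 : Dˣ → K) x)
        rw [← smoothInd_apply, hf, hgθ]
        change _ * (l * (f.1 : Dˣ → K) x) = _
        ring⟩
      map_add' := fun f f' => Subtype.ext (Subtype.ext (funext fun x => mul_add _ _ _))
      map_smul' := fun c f => Subtype.ext (Subtype.ext (funext fun x => mul_left_comm _ _ _)) }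
  refine LinearMap.finrank_le_finrank_of_injective (f := T) fun f f' hff' => ?_
  refine Subtype.ext (Subtype.ext (funext fun x => ?_))
  have := congrFun (congrArg (fun f => (f.1.1 : Dˣ → K)) hff') x
  exact mul_left_cancel₀ (hg0 x) this

/-- All eigenvalues of the rotation on an induced representation have the same multiplicity. -/
theorem finrank_eigenspace_smoothInd [IsAlgClosed K] (h : IsDihedralMod Z θ w r)
    (hr : (r : K) ≠ 0)
    (hH : ∀ b ∈ H, (b : Dˣ ⧸ Z) = 1 ∨ (b : Dˣ ⧸ Z) = w) (hZ : ∃ m, congrSubgroup F D m ≤ Z)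
    (hM : ∀ u ∈ congrSubgroup F D M, ∃ hu : u ∈ H, χ ⟨u, hu⟩ = 1) {N : ℕ} (hN : N ≠ 0)
    (hi : H.index = r * N) {c : K} (hc : c ≠ 0)
    (ht : (smoothInd F D H χ θ) ^ r = algebraMap K _ c) {l : K} (hl : l ^ r = c) :
    finrank K (End.eigenspace (smoothInd F D H χ θ) l) = N := by
  classical
  have hi0 : H.index ≠ 0 := by
    rw [hi]
    exact mul_ne_zero h.odd.pos.ne' hN
  have := finiteDimensional_smoothInd hM hi0
  have hl0 : l ≠ 0 := by
    rintro rfl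
    rw [zero_pow h.odd.pos.ne'] at hl
    exact hc hl.symm
  have heq (l' : K) (hl' : l' ^ r = c) : finrank K (End.eigenspace (smoothInd F D H χ θ) l') =
      finrank K (End.eigenspace (smoothInd F D H χ θ) l) := by
    have hl'0 : l' ≠ 0 := by
      rintro rfl
      rw [zero_pow h.odd.pos.ne'] at hl'
      exact hc hl'.symm
    refine le_antisymm ?_ ?_
    · have := finrank_eigenspace_smoothInd_mul_le (χ := χ) h hH hZ (μ := l / l') (by
        rw [div_pow, hl, hl', div_self hc]) l'
      rwa [div_mul_cancel₀ _ hl'0] at this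
    · have := finrank_eigenspace_smoothInd_mul_le (χ := χ) h hH hZ (μ := l' / l) (by
        rw [div_pow, hl, hl', div_self hc]) l
      rwa [div_mul_cancel₀ _ hl0] at this
  have hsum := finrank_eq_sum_eigenspace hr hc ht
  rw [finrank_smoothInd hM hi0, hi, Finset.sum_congr rfl fun l' hl' => heq l' (by
    rwa [Multiset.mem_toFinset, mem_roots_X_pow_sub_C hr] at hl'), Finset.sum_const, smul_eq_mul,
    Multiset.toFinset_card_of_nodup (nodup_roots_X_pow_sub_C hr hc),
    ← (IsAlgClosed.splits _).natDegree_eq_card_roots, Polynomial.natDegree_X_pow_sub_C] at hsum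
  exact (Nat.eq_of_mul_eq_mul_left h.odd.pos hsum).symm

end Induction

/-! ### Coefficient fields -/

section CoefficientFields

open Polynomial

variable (p : ℕ) [Fact p.Prime]

theorem mem_intBar_iff {x : PadicAlgCl p} : x ∈ IntBar p ↔ ‖x‖ ≤ 1 := by
  rw [Valuation.mem_valuationSubring_iff, PadicAlgCl.valuation_def, ← NNReal.coe_le_coe]
  rfl

instance charP_FpBar : CharP (FpBar p) p := by
  have h : ((p : ℕ) : FpBar p) = 0 := by
    rw [← map_natCast (IsLocalRing.residue (IntBar p)), IsLocalRing.residue_eq_zero_iff,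
      Valuation.mem_maximalIdeal_iff]
    change Valued.v (p : PadicAlgCl p) < 1
    rw [PadicAlgCl.valuation_p, one_div]
    exact inv_lt_one_of_one_lt₀ (by exact_mod_cast (Fact.out : p.Prime).one_lt)
  exact (CharP.charP_iff_prime_eq_zero Fact.out).2 h

/-- Monic polynomials over the residue field lift, and their roots in `ℚ̄_p` are integral. -/
instance isAlgClosed_FpBar : IsAlgClosed (FpBar p) := by
  refine IsAlgClosed.of_exists_root _ fun f hf hirr => ?_
  obtain ⟨g, hg, hdeg, hgm⟩ := lifts_and_natDegree_eq_and_monic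
    ((lifts_iff_coeff_lifts _).2 fun n => IsLocalRing.residue_surjective (f.coeff n)) hf
  have hd : (g.map (algebraMap (IntBar p) (PadicAlgCl p))).degree ≠ 0 := by
    rw [hgm.degree_map, degree_eq_natDegree hgm.ne_zero, hdeg]
    exact_mod_cast hirr.natDegree_pos.ne'
  obtain ⟨x, hx⟩ := IsAlgClosed.exists_root _ hd
  have hint : IsIntegral (IntBar p) x := ⟨g, hgm, by rwa [IsRoot.def, eval_map] at hx⟩
  obtain ⟨y, rfl⟩ := IsIntegrallyClosed.isIntegral_iff.1 hint
  refine ⟨IsLocalRing.residue _ y, ?_⟩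
  have hy : g.eval y = 0 := by
    rw [IsRoot.def, eval_map, eval₂_at_apply] at hx
    exact (map_eq_zero_iff _ (IsFractionRing.injective (IntBar p) (PadicAlgCl p))).1 hx
  rw [← hg, eval_map, eval₂_at_apply, hy, map_zero]

end CoefficientFields

/-! ### Stable lattices and their reduction -/

section Lattices

open Module Polynomial

variable {G : Type*} [Group G] {p : ℕ} [Fact p.Prime]
variable {V : Type*} [AddCommGroup V] [Module (PadicAlgCl p) V]
  {ρ : Representation (PadicAlgCl p) G V}

theorem mem_ringOfInt_iff {K : IntermediateField ℚ_[p] (PadicAlgCl p)} {x : PadicAlgCl p} :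
    x ∈ ringOfInt p K ↔ ‖x‖ ≤ 1 ∧ x ∈ K := by
  rw [← mem_intBar_iff]
  rfl

/-- A scalar that preserves a lattice is integral over the field of definition of the lattice. -/
theorem StableLattice.mem_ringOfInt_of_smul_mem (L : StableLattice p ρ) [Nontrivial V]
    {c : PadicAlgCl p} (hc : ∀ v ∈ L.Λ, c • v ∈ L.Λ) : c ∈ ringOfInt p L.K := by
  obtain ⟨d, b, hb⟩ := L.lattice
  have : Nonempty (Fin d) := b.index_nonempty
  obtain ⟨i⟩ := this
  have h := hc (b i) (by rw [hb]; exact Submodule.subset_span ⟨i, rfl⟩)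
  rw [hb, b.mem_span_iff_repr_mem (ringOfInt p L.K)] at h
  obtain ⟨a, ha⟩ := h i
  have : c = a := by
    rw [map_smul, b.repr_self] at ha
    have h1 : c = algebraMap (ringOfInt p L.K) (PadicAlgCl p) a := by simpa using ha.symm
    exact h1
  rw [this]
  exact a.2

/-- A representation whose matrix coefficients in some basis lie in the integers of a finite
extension of `ℚ_p` is integral. -/
theorem isPIntegral_of_basis {ι : Type*} [Finite ι] (b : Basis ι (PadicAlgCl p) V)
    (K : IntermediateField ℚ_[p] (PadicAlgCl p)) (hK : FiniteDimensional ℚ_[p] K)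
    (hb : ∀ g i j, b.repr (ρ g (b j)) i ∈ ringOfInt p K) : IsPIntegral p ρ := by
  have := Fintype.ofFinite ι
  let b' := b.reindex (Fintype.equivFin ι)
  refine ⟨⟨K, hK, Submodule.span _ (Set.range b'), ⟨_, b', rfl⟩, fun g v hv => ?_⟩⟩
  induction hv using Submodule.span_induction with
  | mem v hv =>
    obtain ⟨j, rfl⟩ := hv
    rw [b'.mem_span_iff_repr_mem (ringOfInt p K)]
    intro i
    refine ⟨⟨_, hb g ((Fintype.equivFin ι).symm i) ((Fintype.equivFin ι).symm j)⟩, ?_⟩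
    simp [b']
    rfl
  | zero => simp
  | add v w _ _ hv hw =>
    rw [map_add]
    exact add_mem hv hw
  | smul a v _ hv =>
    have : ρ g (a • v) = a • ρ g v := map_smul (ρ g) (a : PadicAlgCl p) v
    rw [this]
    exact Submodule.smul_mem _ _ hv

theorem isPIntegral_charRep_iff {ξ : G →* (PadicAlgCl p)ˣ} : IsPIntegral p (charRep ξ) ↔
    ∃ K : IntermediateField ℚ_[p] (PadicAlgCl p), FiniteDimensional ℚ_[p] K ∧
      ∀ g, (ξ g : PadicAlgCl p) ∈ ringOfInt p K := by
  constructor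
  · rintro ⟨L⟩
    exact ⟨L.K, L.finite, fun g => L.mem_ringOfInt_of_smul_mem (L.stable g)⟩
  · rintro ⟨K, hK, h⟩
    refine isPIntegral_of_basis (Basis.singleton Unit (PadicAlgCl p)) K hK fun g i j => ?_
    have : (Basis.singleton Unit (PadicAlgCl p)).repr
        (charRep ξ g (Basis.singleton Unit (PadicAlgCl p) j)) i = ξ g := by
      simp [charRep]
    rw [this]
    exact h g

theorem exists_isReductionOfChar {ξ : G →* (PadicAlgCl p)ˣ}
    (h : ∀ g, (ξ g : PadicAlgCl p) ∈ IntBar p) :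
    ∃ ξbar : G →* (FpBar p)ˣ, IsReductionOfChar ξ ξbar := by
  let f : G →* IntBar p :=
    { toFun := fun g => ⟨ξ g, h g⟩
      map_one' := Subtype.ext (by simp)
      map_mul' := fun a b => Subtype.ext (by simp) }
  exact ⟨((IsLocalRing.residue (IntBar p)).toMonoidHom.comp f).toHomUnits, fun g => ⟨f g, rfl, rfl⟩⟩

theorem IsReductionOfChar.eq {ξ : G →* (PadicAlgCl p)ˣ} {ξbar : G →* (FpBar p)ˣ}
    (h : IsReductionOfChar ξ ξbar) {g : G} {a : IntBar p} (ha : (a : PadicAlgCl p) = ξ g) :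
    (ξbar g : FpBar p) = IsLocalRing.residue (IntBar p) a := by
  obtain ⟨b, hb, hb'⟩ := h g
  rw [← hb', Subtype.ext (hb.trans ha.symm)]

theorem IsReductionOfChar.apply_eq_of_eq {G' : Type*} [Group G'] {ξ : G →* (PadicAlgCl p)ˣ}
    {ξbar : G →* (FpBar p)ˣ} (h : IsReductionOfChar ξ ξbar) {ξ' : G' →* (PadicAlgCl p)ˣ}
    {ξbar' : G' →* (FpBar p)ˣ} (h' : IsReductionOfChar ξ' ξbar') {g : G} {g' : G'}
    (hg : ξ g = ξ' g') : ξbar g = ξbar' g' := by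
  obtain ⟨b, hb, hb'⟩ := h g
  refine Units.ext ?_
  rw [← hb', h'.eq (hb.trans (by rw [hg]))]

/-- The basis of `V` and the basis of the lattice, with the same coordinates. -/
theorem StableLattice.exists_basis (L : StableLattice p ρ) : ∃ (d : ℕ)
    (b : Basis (Fin d) (PadicAlgCl p) V) (bA : Basis (Fin d) (ringOfInt p L.K) L.Λ),
      (∀ i, (bA i : V) = b i) ∧ ∀ (x : L.Λ) i, b.repr (x : V) i = bA.repr x i := by
  obtain ⟨d, b, hb⟩ := L.lattice
  have hli : LinearIndependent (ringOfInt p L.K) b := b.linearIndependent.restrict_scalars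
    (fun x y hxy => Subtype.ext (by simpa [Subring.smul_def] using hxy))
  let bA : Basis (Fin d) (ringOfInt p L.K) L.Λ :=
    (Basis.span hli).map (LinearEquiv.ofEq _ _ hb.symm)
  have hbA (i) : (bA i : V) = b i := by
    rw [Basis.map_apply, LinearEquiv.coe_ofEq_apply, Basis.span_apply]
  refine ⟨d, b, bA, hbA, fun x i => ?_⟩
  conv_lhs => rw [← bA.sum_repr x]
  rw [AddSubmonoidClass.coe_finsetSum]
  have : ∑ j, ((bA.repr x j • bA j : L.Λ) : V) = ∑ j, ((bA.repr x j : PadicAlgCl p)) • b j :=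
    Finset.sum_congr rfl fun j _ => by rw [← hbA]; rfl
  rw [this, b.repr_sum_self]

theorem StableLattice.free (L : StableLattice p ρ) : Module.Free (ringOfInt p L.K) L.Λ := by
  obtain ⟨d, b, bA, -⟩ := L.exists_basis
  exact Module.Free.of_basis bA

theorem StableLattice.finite_lattice (L : StableLattice p ρ) :
    Module.Finite (ringOfInt p L.K) L.Λ := by
  obtain ⟨d, b, bA, -⟩ := L.exists_basis
  exact Module.Finite.of_basis bA

instance StableLattice.finite_reduction (L : StableLattice p ρ) :
    Module.Finite (FpBar p) (FpBar p ⊗[ringOfInt p L.K] L.Λ) := by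
  obtain ⟨d, b, bA, -⟩ := L.exists_basis
  exact Module.Finite.of_basis (bA.baseChange (FpBar p))

/-- The characteristic polynomial of the reduction is the reduction of the characteristic
polynomial. -/
theorem StableLattice.charpoly_reduction [FiniteDimensional (PadicAlgCl p) V]
    (L : StableLattice p ρ) (g : G) {P : (ringOfInt p L.K)[X]}
    (hP : P.map (ringOfInt p L.K).subtype = (ρ g).charpoly) :
    (L.reduction g).charpoly = P.map (algebraMap (ringOfInt p L.K) (FpBar p)) := by
  have := L.free
  have := L.finite_lattice
  obtain ⟨d, b, bA, hbA, hrepr⟩ := L.exists_basis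
  have h1 : LinearMap.toMatrix b b (ρ g) =
      (LinearMap.toMatrix bA bA (L.rep g)).map (ringOfInt p L.K).subtype := by
    ext i j
    rw [Matrix.map_apply, LinearMap.toMatrix_apply, LinearMap.toMatrix_apply, ← hbA]
    exact hrepr (L.rep g (bA j)) i
  have h2 : (L.rep g).charpoly = P := by
    refine map_injective _ (Subring.subtype_injective _) ?_
    rw [hP, ← LinearMap.charpoly_toMatrix (ρ g) b, h1, Matrix.charpoly_map,
      LinearMap.charpoly_toMatrix]
  rw [← h2, ← LinearMap.charpoly_baseChange]
  rfl

theorem StableLattice.reduction_apply_of_smul (L : StableLattice p ρ) {g : G}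
    {c : ringOfInt p L.K} (hg : ∀ v, ρ g v = (c : PadicAlgCl p) • v)
    (x : FpBar p ⊗[ringOfInt p L.K] L.Λ) :
    L.reduction g x = (algebraMap (ringOfInt p L.K) (FpBar p) c) • x := by
  have h1 (v : L.Λ) : L.rep g v = c • v := Subtype.ext (hg v)
  induction x with
  | zero => simp
  | add x y hx hy => rw [map_add, hx, hy, smul_add]
  | tmul a v =>
    change (L.rep g).baseChange (FpBar p) (a ⊗ₜ v) = _
    rw [LinearMap.baseChange_tmul, h1, TensorProduct.tmul_smul, algebraMap_smul]

end Lattices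

/-! ### Integrality, and the action of `U_D^1` -/

section QuaternionReps

open Module WithZero

section Integrality

variable {F : Type*} [Field F] {D : Type*} [DivisionRing D] [Algebra F D]
variable {V : Type*} [AddCommGroup V] [Module (PadicAlgCl 2) V]
  {ρ : Representation (PadicAlgCl 2) Dˣ V}

theorem isPIntegral_centralChar [Nontrivial V] {Φ : Fˣ →* (PadicAlgCl 2)ˣ}
    (hΦ : HasCentralChar F ρ Φ)
    (h : IsPIntegral 2 ρ) : IsPIntegral 2 (charRep Φ) := by
  obtain ⟨L⟩ := h
  refine isPIntegral_charRep_iff.2 ⟨L.K, L.finite, fun a => L.mem_ringOfInt_of_smul_mem ?_⟩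
  intro v hv
  rw [← hΦ a v]
  exact L.stable _ v hv

variable [ValuativeRel F] [TopologicalSpace F] [IsNonarchimedeanLocalField F]

/-- In the basis of functions supported on one coset, group elements act through matrices whose
entries are zero or values of `χ`. -/
theorem isPIntegral_of_equiv_smoothInd {H : Subgroup Dˣ} {χ : H →* (PadicAlgCl 2)ˣ} {M : ℕ}
    (hM : ∀ u ∈ congrSubgroup F D M, ∃ hu : u ∈ H, χ ⟨u, hu⟩ = 1) (hi : H.index ≠ 0)
    (f : ρ.Equiv (smoothInd F D H χ)) (h : IsPIntegral 2 (charRep χ)) : IsPIntegral 2 ρ := by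
  classical
  obtain ⟨K, hK, hχ⟩ := isPIntegral_charRep_iff.1 h
  have : Finite (Dˣ ⧸ H) := Nat.finite_of_card_ne_zero hi
  refine isPIntegral_of_basis (Basis.ofEquivFun (f.toLinearEquiv.trans (indEquiv hM))) K hK
    fun g s t => ?_
  have h1 : (Basis.ofEquivFun (f.toLinearEquiv.trans (indEquiv hM))).repr
      (ρ g (Basis.ofEquivFun (f.toLinearEquiv.trans (indEquiv hM)) t)) s =
      ((indEquiv hM).symm (Pi.single t 1) : Dˣ → PadicAlgCl 2) (s.out⁻¹ * g) := by
    rw [Basis.ofEquivFun_repr_apply, Basis.coe_ofEquivFun, LinearEquiv.trans_apply, indEquiv_apply]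
    have h2 := LinearMap.congr_fun (f.isIntertwining' g)
      ((f.toLinearEquiv.trans (indEquiv hM)).symm (Pi.single t 1))
    change f.toLinearEquiv (ρ g _) = smoothInd F D H χ g (f.toLinearEquiv _) at h2
    rw [h2, smoothInd_apply, LinearEquiv.trans_symm, LinearEquiv.trans_apply,
      LinearEquiv.apply_symm_apply]
  rw [h1, indEquiv_symm_apply]
  refine mul_mem (hχ _) ?_
  rw [Pi.single_apply]
  split_ifs
  · exact one_mem _
  · exact zero_mem _

end Integrality

variable {F : Type*} [Field F] [ValuativeRel F] [TopologicalSpace F] [IsNonarchimedeanLocalField F]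
variable {D : Type*} [DivisionRing D] [Algebra F D]

section CharTwo

variable {K : Type*} [Field K] {V : Type*} [AddCommGroup V] [Module K V]
  {ρ : Representation K Dˣ V}

theorem actsBy_centreU {ψ : Dˣ →* Kˣ} (hψ : ∀ u ∈ congrSubgroup F D 1, ψ u = 1)
    (hU : ∀ u ∈ congrSubgroup F D 1, ρ u = 1)
    (hcent : HasCentralChar F ρ (ψ.comp (central F D))) : ActsBy (centreU F D) ψ ρ := by
  intro z hz v
  obtain ⟨a, u, hu, rfl⟩ := (mem_centreU_iff z).1 hz
  rw [map_mul, hU u hu, mul_one, hcent a v, map_mul, hψ u hu, mul_one]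
  rfl

/-- On a finite-dimensional smooth representation some `U_D^M` acts trivially. -/
theorem IsSmoothRep.exists_trivial [FiniteDimensional K V] (hρ : IsSmoothRep F ρ) :
    ∃ M, ∀ u ∈ congrSubgroup F D M, ρ u = 1 := by
  let b := Module.finBasis K V
  choose m hm using fun i => hρ (b i)
  refine ⟨Finset.univ.sup m, fun u hu => b.ext fun i => ?_⟩
  exact hm i u (congrSubgroup_anti F D (Finset.le_sup (Finset.mem_univ i)) hu)

variable [CharP K 2] [Algebra.IsCentral F D] [hD : Fact (Module.finrank F D = 4)]

/-- On an irreducible representation in characteristic two, if `U_D^(k+1)` acts trivially, then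
`U_D^k` acts through commuting involutions, whose fixed vectors form a subrepresentation. -/
theorem congrSubgroup_trivial_of_succ (hp : ringChar 𝓀[F] = 2) [FiniteDimensional K V]
    (hirr : ρ.IsIrreducible) {k : ℕ} (hk : 1 ≤ k)
    (h : ∀ u ∈ congrSubgroup F D (k + 1), ρ u = 1) : ∀ u ∈ congrSubgroup F D k, ρ u = 1 := by
  obtain ⟨hnt, hirr⟩ := isIrreducible_iff.1 hirr
  obtain ⟨v, hv0, hv⟩ := exists_fixed_of_commuting_involutions (K := K)
    (ρ '' (congrSubgroup F D k : Set Dˣ)) (by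
      rintro _ ⟨u, hu, rfl⟩
      rw [← map_mul]
      exact h _ (sq_mem_congrSubgroup hp hk hu)) (by
      rintro _ ⟨u, hu, rfl⟩ _ ⟨u', hu', rfl⟩
      have h1 := h _ (commutator_mem_congrSubgroup hk hu hu')
      have h2 : u * u' = u * u' * (u' * u)⁻¹ * (u' * u) := by group
      rw [← map_mul, ← map_mul, h2, map_mul, h1, one_mul])
  let W : Submodule K V :=
    { carrier := {v | ∀ u ∈ congrSubgroup F D k, ρ u v = v}
      zero_mem' := fun u _ => map_zero _
      add_mem' := fun ha hb u hu => by rw [map_add, ha u hu, hb u hu]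
      smul_mem' := fun c _ ha u hu => by rw [map_smul, ha u hu] }
  have hW := hirr W (fun g x hx u hu => by
    have h1 := hx _ (conj_mem_congrSubgroup F D k g⁻¹ hu)
    have h2 : u * g = g * (g⁻¹ * u * g⁻¹⁻¹) := by group
    rw [← Module.End.mul_apply, ← map_mul, h2, map_mul, Module.End.mul_apply, h1])
  intro u hu
  rcases hW with hW | hW
  · have h1 : v ∈ W := fun u hu => hv _ ⟨u, hu, rfl⟩
    rw [hW] at h1
    exact absurd h1 hv0
  · ext x
    have h1 : x ∈ W := by
      rw [hW]
      trivial
    exact h1 u hu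

/-- The pro-`2`-group `U_D^1` acts trivially on irreducible smooth representations in characteristic
two. -/
theorem congrSubgroup_one_trivial (hp : ringChar 𝓀[F] = 2) [FiniteDimensional K V]
    (hirr : ρ.IsIrreducible) {M : ℕ} (h : ∀ u ∈ congrSubgroup F D M, ρ u = 1) :
    ∀ u ∈ congrSubgroup F D 1, ρ u = 1 := by
  have key : ∀ j : ℕ, (∀ u ∈ congrSubgroup F D (j + 1), ρ u = 1) →
      ∀ u ∈ congrSubgroup F D 1, ρ u = 1 := by
    intro j
    induction j with
    | zero => exact id
    | succ j ih => exact fun hj => ih (congrSubgroup_trivial_of_succ hp hirr (by omega) hj)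
  exact key M fun u hu => h u (congrSubgroup_anti F D (Nat.le_succ M) hu)

theorem isDihedralRep_of_isIrreducible (hp : ringChar 𝓀[F] = 2) {θ w : Dˣ} {r : ℕ}
    (h : IsDihedralMod (centreU F D) θ w r) [FiniteDimensional K V] (hirr : ρ.IsIrreducible)
    {M : ℕ} (hM : ∀ u ∈ congrSubgroup F D M, ρ u = 1) {ψ : Dˣ →* Kˣ}
    (hψ : ∀ u ∈ congrSubgroup F D 1, ψ u = 1)
    (hcent : HasCentralChar F ρ (ψ.comp (central F D))) :
    IsDihedralRep (centreU F D) θ w ψ ρ :=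
  (actsBy_centreU hψ (congrSubgroup_one_trivial hp hirr hM) hcent).isDihedralRep_of_isIrreducible h
    (isIrreducible_iff.1 hirr).2

/-- A smooth character of `D^×` in characteristic two is trivial on the pro-`2`-group `U_D^1`. -/
theorem eq_one_of_isSmoothRep_charRep (hp : ringChar 𝓀[F] = 2) {ψ : Dˣ →* Kˣ}
    (hψ : IsSmoothRep F (charRep ψ)) : ∀ u ∈ congrSubgroup F D 1, ψ u = 1 := by
  intro u hu
  obtain ⟨m, hm⟩ := hψ 1
  have h1 := hm _ (congrSubgroup_anti F D (Nat.le_succ m) (pow_two_pow_mem_congrSubgroup hp hu m))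
  have h2 : ((ψ (u ^ 2 ^ m) : Kˣ) : K) * 1 = 1 := h1
  rw [mul_one, map_pow, Units.val_pow_eq_pow_val] at h2
  exact Units.ext (eq_of_pow_two_pow_eq m (by rw [h2, Units.val_one, one_pow]))

end CharTwo

variable [Algebra.IsCentral F D] [hD : Fact (Module.finrank F D = 4)]

/-- Elements of `H` lie in `Z` or in `w Z`, and `w²` lies in `Z`. On `Z` the values of `χ` are those of
`Φ` up to `2 ^ m`-th roots of unity, since `2 ^ m`-th powers of elements of `U_D^1` lie in the kernel
of `χ`. Adjoining these roots of unity and `χ(w)` gives a finite extension. -/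
theorem isPIntegral_char_of_central (hp : ringChar 𝓀[F] = 2) {θ w : Dˣ} {r : ℕ}
    (hdi : IsDihedralMod (centreU F D) θ w r) {H : Subgroup Dˣ}
    (hH : ∀ h ∈ H, (h : Dˣ ⧸ centreU F D) = 1 ∨ (h : Dˣ ⧸ centreU F D) = w) (hwH : w ∈ H)
    (hcH : ∀ a : Fˣ, central F D a ∈ H) {χ : H →* (PadicAlgCl 2)ˣ} (hχ : IsSmoothChar F D H χ)
    {Φ : Fˣ →* (PadicAlgCl 2)ˣ} (hΦ : ∀ a : Fˣ, Φ a = χ ⟨central F D a, hcH a⟩) (hint : IsPIntegral 2 (charRep Φ)) :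
    IsPIntegral 2 (charRep χ) := by
  obtain ⟨K, hK, hKΦ⟩ := isPIntegral_charRep_iff.1 hint
  obtain ⟨m, hm⟩ := hχ
  have hval : ∀ h : H, (h : Dˣ) ∈ centreU F D → ∃ (a : Fˣ) (ζ : (PadicAlgCl 2)ˣ),
      ζ ^ 2 ^ m = 1 ∧ χ h = Φ a * ζ := by
    intro h hh
    obtain ⟨a, u, hu, hau⟩ := (mem_centreU_iff _).1 hh
    have huH : u ∈ H := by
      have : u = (central F D a)⁻¹ * h := by rw [hau]; group
      rw [this]
      exact mul_mem (inv_mem (hcH a)) h.2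
    refine ⟨a, χ ⟨u, huH⟩, ?_, ?_⟩
    · rw [← map_pow]
      exact hm _ (congrSubgroup_anti F D (Nat.le_succ m) (pow_two_pow_mem_congrSubgroup hp hu m))
    · rw [hΦ, ← map_mul]
      exact congrArg χ (Subtype.ext hau)
  have hnΦ (a : Fˣ) : ‖(Φ a : PadicAlgCl 2)‖ = 1 := by
    have h1 := (mem_ringOfInt_iff.1 (hKΦ a)).1
    have h2 := (mem_ringOfInt_iff.1 (hKΦ a⁻¹)).1
    rw [map_inv, Units.val_inv_eq_inv_val, norm_inv] at h2
    refine le_antisymm h1 ?_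
    exact (inv_le_one₀ (norm_pos_iff.2 (Φ a).ne_zero)).1 h2
  have hnζ {ζ : (PadicAlgCl 2)ˣ} (hζ : ζ ^ 2 ^ m = 1) : ‖(ζ : PadicAlgCl 2)‖ = 1 := by
    have h1 : (ζ : PadicAlgCl 2) ^ 2 ^ m = 1 := by
      rw [← Units.val_pow_eq_pow_val, hζ, Units.val_one]
    have h2 : ‖(ζ : PadicAlgCl 2)‖ ^ 2 ^ m = 1 := by rw [← norm_pow, h1, norm_one]
    exact (pow_eq_one_iff_of_nonneg (norm_nonneg _) (by positivity)).1 h2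
  have hnval (h : H) (hh : (h : Dˣ) ∈ centreU F D) : ‖(χ h : PadicAlgCl 2)‖ = 1 := by
    obtain ⟨a, ζ, hζ, heq⟩ := hval h hh
    rw [heq, Units.val_mul, norm_mul, hnΦ, hnζ hζ, one_mul]
  have hnw : ‖(χ ⟨w, hwH⟩ : PadicAlgCl 2)‖ = 1 := by
    have h1 := hnval (⟨w, hwH⟩ * ⟨w, hwH⟩) hdi.mul_self_mem
    rw [map_mul, Units.val_mul, norm_mul, ← sq] at h1
    exact (pow_eq_one_iff_of_nonneg (norm_nonneg _) two_ne_zero).1 h1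
  let S : Set (PadicAlgCl 2) := {(χ ⟨w, hwH⟩ : PadicAlgCl 2)} ∪ {x | x ^ 2 ^ m = 1}
  have hS : S.Finite := by
    refine (Set.finite_singleton _).union ?_
    refine (Multiset.finite_toSet (Polynomial.nthRoots (2 ^ m) (1 : PadicAlgCl 2))).subset ?_
    intro x hx
    exact (Polynomial.mem_nthRoots (by positivity)).2 hx
  have := hS.to_subtype
  let K' := K ⊔ IntermediateField.adjoin ℚ_[2] S
  have : FiniteDimensional ℚ_[2] (IntermediateField.adjoin ℚ_[2] S) :=
    IntermediateField.finiteDimensional_adjoin fun x _ => Algebra.IsIntegral.isIntegral x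
  have hK' : FiniteDimensional ℚ_[2] K' := IntermediateField.finiteDimensional_sup _ _
  have hSK {x : PadicAlgCl 2} (hx : x ∈ S) : x ∈ K' :=
    (le_sup_right : _ ≤ K') (IntermediateField.subset_adjoin _ _ hx)
  have hKval (h : H) (hh : (h : Dˣ) ∈ centreU F D) : (χ h : PadicAlgCl 2) ∈ K' := by
    obtain ⟨a, ζ, hζ, heq⟩ := hval h hh
    rw [heq, Units.val_mul]
    refine mul_mem ((le_sup_left : _ ≤ K') (mem_ringOfInt_iff.1 (hKΦ a)).2) (hSK (Or.inr ?_))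
    change (ζ : PadicAlgCl 2) ^ 2 ^ m = 1
    rw [← Units.val_pow_eq_pow_val, hζ, Units.val_one]
  refine isPIntegral_charRep_iff.2 ⟨K', hK', fun h => mem_ringOfInt_iff.2 ?_⟩
  rcases hH h h.2 with h1 | h1
  · rw [QuotientGroup.eq_one_iff] at h1
    exact ⟨(hnval h h1).le, hKval h h1⟩
  · have h2 : ((⟨w, hwH⟩⁻¹ * h : H) : Dˣ) ∈ centreU F D := by
      rw [← QuotientGroup.eq_one_iff]
      change ((w⁻¹ * (h : Dˣ) : Dˣ) : Dˣ ⧸ centreU F D) = 1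
      rw [QuotientGroup.mk_mul, h1, QuotientGroup.mk_inv, inv_mul_cancel]
    have h3 : χ h = χ ⟨w, hwH⟩ * χ (⟨w, hwH⟩⁻¹ * h) := by rw [← map_mul, mul_inv_cancel_left]
    rw [h3, Units.val_mul]
    refine ⟨?_, mul_mem (hSK (Or.inl rfl)) (hKval _ h2)⟩
    rw [norm_mul, hnw, hnval _ h2, one_mul]

end QuaternionReps

/-! ### Direct sums of dihedral representations -/

section DirectSums

open Module

variable {G : Type*} [Group G] {K : Type*} [Field K]
variable {Z : Subgroup G} {θ w : G} {ψ : G →* Kˣ}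

theorem directSum_apply {ι : Type*} {W : ι → Type*} [∀ i, AddCommGroup (W i)]
    [∀ i, Module K (W i)] (σ : ∀ i, Representation K G (W i)) (g : G) (v : DirectSum ι W) (i : ι) :
    Representation.directSum σ g v i = σ i g (v i) := rfl

theorem IsDihedralRep.directSum {ι : Type*} {W : ι → Type*} [∀ i, AddCommGroup (W i)]
    [∀ i, Module K (W i)] {σ : ∀ i, Representation K G (W i)}
    (hσ : ∀ i, IsDihedralRep Z θ w ψ (σ i)) :
    IsDihedralRep Z θ w ψ (Representation.directSum σ) :=
  .pi hσ _ (fun i => DirectSum.component K ι W i)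
    (fun _ _ h => DirectSum.ext_component K h) (fun i g v => directSum_apply σ g v i)

theorem IsDihedralRep.prod {V V' : Type*} [AddCommGroup V] [Module K V] [AddCommGroup V']
    [Module K V'] {ρ : Representation K G V} {ρ' : Representation K G V'}
    (hρ : IsDihedralRep Z θ w ψ ρ) (hρ' : IsDihedralRep Z θ w ψ ρ') :
    IsDihedralRep Z θ w ψ (ρ.prod ρ') where
  central z hz v := Prod.ext (hρ.central z hz v.1) (hρ'.central z hz v.2)
  refl v hv := Prod.ext (hρ.refl v.1 (congrArg Prod.fst hv)) (hρ'.refl v.2 (congrArg Prod.snd hv))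

theorem ActsBy.isDihedralRep_of_finrank_eq_one {V : Type*} [AddCommGroup V] [Module K V]
    {ρ : Representation K G V} (hρ : ActsBy Z ψ ρ)
    (hd : finrank K (End.eigenspace (ρ θ) (ψ θ : K)) = 1) {f : V} (hf0 : f ≠ 0)
    (hf : ∀ g, ρ g f = (ψ g : K) • f) : IsDihedralRep Z θ w ψ ρ := by
  refine ⟨hρ, fun v hv => ?_⟩
  obtain ⟨c, hc⟩ := exists_smul_eq_of_finrank_eq_one hd
    (x := ⟨f, End.mem_eigenspace_iff.2 (hf θ)⟩) (fun h0 => hf0 (congrArg Subtype.val h0))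
    ⟨v, End.mem_eigenspace_iff.2 hv⟩
  have hcv : c • f = v := congrArg Subtype.val hc
  rw [← hcv, map_smul, hf, smul_comm]

theorem finrank_eigenspace_copies {V : Type*} [AddCommGroup V] [Module K V] [FiniteDimensional K V]
    (N : ℕ) (ρ : Representation K G V) (g : G) (l : K) :
    finrank K (End.eigenspace (copies N ρ g) l) = N * finrank K (End.eigenspace (ρ g) l) := by
  rw [finrank_eigenspace_directSum (fun _ : Fin N => ρ g) _ (directSum_apply _ g) l]
  simp

end DirectSums

section Rotation

theorem central_mul_comm {F D : Type*} [Field F] [DivisionRing D] [Algebra F D] (a : Fˣ)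
    (g : Dˣ) : central F D a * g = g * central F D a :=
  Units.ext (Algebra.commutes _ _)

variable {F : Type*} [Field F] [ValuativeRel F] [TopologicalSpace F] [IsNonarchimedeanLocalField F]
variable {D : Type*} [DivisionRing D] [Algebra F D] [Algebra.IsCentral F D] [hD : Fact (Module.finrank F D = 4)]

/-- A suitable `2`-power of the rotation is a rotation whose `r`-th power is central up to an
element of `U_D^M`. -/
theorem IsDihedralMod.exists_pow_eq (hp : ringChar 𝓀[F] = 2) {θ w : Dˣ} {r : ℕ}
    (h : IsDihedralMod (centreU F D) θ w r) (M : ℕ) :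
    ∃ θ' : Dˣ, IsDihedralMod (centreU F D) θ' w r ∧
      ∃ a : Fˣ, ∃ u ∈ congrSubgroup F D M, θ' ^ r = central F D a * u := by
  obtain ⟨a, u, hu, hau⟩ := (mem_centreU_iff _).1 h.pow_mem
  refine ⟨θ ^ 2 ^ M, h.pow_left (Nat.Coprime.pow_left M h.odd.coprime_two_left), a ^ 2 ^ M,
    u ^ 2 ^ M, congrSubgroup_anti F D (Nat.le_succ M) (pow_two_pow_mem_congrSubgroup hp hu M), ?_⟩
  rw [← pow_mul, mul_comm, pow_mul, hau, (show Commute _ _ from central_mul_comm a u).mul_pow,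
    map_pow]

end Rotation

/-! ### Characters and induced representations in characteristic two -/

/-- Square roots are unique in characteristic two. -/
theorem eq_of_eqOn_of_sq_mem {K : Type*} [Field K] [CharP K 2] {G : Type*} [Group G]
    {H Z : Subgroup G} (hsq : ∀ h ∈ H, h * h ∈ Z)
    {ψ ψ' : H →* Kˣ} (hZ : ∀ h : H, (h : G) ∈ Z → ψ h = ψ' h) : ψ = ψ' := by
  refine MonoidHom.ext fun h => Units.ext (eq_of_pow_two_pow_eq 1 ?_)
  rw [pow_one, sq, sq, ← Units.val_mul, ← Units.val_mul, ← map_mul, ← map_mul,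
    hZ _ (hsq h h.2)]

section CharactersCharTwo

open Module

variable {F : Type*} [Field F] [ValuativeRel F] [TopologicalSpace F] [IsNonarchimedeanLocalField F]
variable {D : Type*} [DivisionRing D] [Algebra F D]
variable {K : Type*} [Field K]

section Extension

variable [CharP K 2] [Algebra.IsCentral F D] [hD : Fact (Module.finrank F D = 4)]

/-- A smooth character `Φ` of `F^×` extends to `D^×` in characteristic two: the norm of the left
regular representation is `x ↦ x ^ 4` on `F^×`, so that the fourth root of `Φ ∘ N` extends `Φ`. -/
theorem exists_extension_central (hp : ringChar 𝓀[F] = 2) [PerfectRing K 2] {M : ℕ} {Φ : Fˣ →* Kˣ}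
    (hΦ : ∀ a : Fˣ, central F D a ∈ congrSubgroup F D M → Φ a = 1) :
    ∃ ψ : Dˣ →* Kˣ, ψ.comp (central F D) = Φ ∧ ∀ u ∈ congrSubgroup F D 1, ψ u = 1 := by
  have hΦ1 (a : Fˣ) (ha : central F D a ∈ congrSubgroup F D 1) : Φ a = 1 := by
    have h1 := hΦ (a ^ 2 ^ M) (by
      rw [map_pow]
      exact congrSubgroup_anti F D (Nat.le_succ M) (pow_two_pow_mem_congrSubgroup hp ha M))
    refine Units.ext (eq_of_pow_two_pow_eq M ?_)
    rw [← Units.val_pow_eq_pow_val, ← map_pow, h1, Units.val_one, one_pow]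
  let ψ : Dˣ →* Kˣ := (Units.map ((iterateFrobeniusEquiv K 2 2).symm : K →* K)).comp
    (Φ.comp (Units.map (Algebra.norm F)))
  have hψ (g : Dˣ) : (ψ g : K) ^ 2 ^ 2 = Φ (Units.map (Algebra.norm F) g) :=
    (iterateFrobeniusEquiv K 2 2).apply_symm_apply _
  refine ⟨ψ, MonoidHom.ext fun a => Units.ext (eq_of_pow_two_pow_eq 2 ?_), fun u hu => ?_⟩
  · rw [MonoidHom.comp_apply, hψ, ← Units.val_pow_eq_pow_val, ← map_pow]
    congr 2
    refine Units.ext ?_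
    change Algebra.norm F (algebraMap F D a) = _
    rw [Algebra.norm_algebraMap, hD.out]
    simp
  · refine Units.ext (eq_of_pow_two_pow_eq 2 ?_)
    rw [hψ, hΦ1 _ (central_norm_mem_congrSubgroup hu), Units.val_one, one_pow]

end Extension

theorem eq_one_of_mem_congrSubgroup_one [CharP K 2] [Algebra.IsCentral F D]
    [hD : Fact (Module.finrank F D = 4)] (hp : ringChar 𝓀[F] = 2) {H : Subgroup Dˣ} {χ : H →* Kˣ}
    (hχ : IsSmoothChar F D H χ) (u : H) (hu : (u : Dˣ) ∈ congrSubgroup F D 1) : χ u = 1 := by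
  obtain ⟨m, hm⟩ := hχ
  have h1 := hm (u ^ 2 ^ m)
    (congrSubgroup_anti F D (Nat.le_succ m) (pow_two_pow_mem_congrSubgroup hp hu m))
  refine Units.ext (eq_of_pow_two_pow_eq m ?_)
  rw [← Units.val_pow_eq_pow_val, ← map_pow, h1, Units.val_one, one_pow]

variable {θ w : Dˣ} {r : ℕ} {ψ : Dˣ →* Kˣ} {H : Subgroup Dˣ}

theorem mem_smoothIndSpace_restrict (hψ : ∀ u ∈ congrSubgroup F D 1, ψ u = 1) :
    (fun x => (ψ x : K)) ∈ smoothIndSpace F D H (ψ.comp H.subtype) :=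
  ⟨fun h x => by simp, 1, fun u hu x => by simp [hψ u hu]⟩

theorem actsBy_smoothInd_restrict (hZ : centreU F D ≤ H) :
    ActsBy (centreU F D) ψ (smoothInd F D H (ψ.comp H.subtype)) := fun z hz v =>
  smoothInd_apply_of_normal (N := centreU F D) (ω := fun x => (ψ x : K))
    (fun g x => by simp) (fun u hu => ⟨hZ hu, rfl⟩) hz v

theorem exists_trivial_restrict (hψ : ∀ u ∈ congrSubgroup F D 1, ψ u = 1)
    (hZ : centreU F D ≤ H) :
    ∀ u ∈ congrSubgroup F D 1, ∃ hu : u ∈ H, (ψ.comp H.subtype) ⟨u, hu⟩ = 1 := fun u hu =>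
  ⟨hZ (congrSubgroup_le_centreU le_rfl hu), hψ u hu⟩

theorem finrank_eigenspace_smoothInd_restrict [CharP K 2] [IsAlgClosed K]
    (h : IsDihedralMod (centreU F D) θ w r)
    (hψ : ∀ u ∈ congrSubgroup F D 1, ψ u = 1) (hZ : centreU F D ≤ H)
    (hH : ∀ b, b ∈ H ↔ (b : Dˣ ⧸ centreU F D) = 1 ∨ (b : Dˣ ⧸ centreU F D) = w) {l : K}
    (hl : l ^ r = (ψ θ : K) ^ r) :
    finrank K (End.eigenspace (smoothInd F D H (ψ.comp H.subtype) θ) l) = 1 :=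
  finrank_eigenspace_smoothInd h (cast_ne_zero_of_odd h.odd) (fun b => (hH b).1)
    ⟨1, congrSubgroup_le_centreU le_rfl⟩ (exists_trivial_restrict hψ hZ) one_ne_zero
    (by rw [h.index_eq H hH, mul_one]) (pow_ne_zero _ (ψ θ).ne_zero)
    ((actsBy_smoothInd_restrict hZ).pow_eq h) hl

/-- The vectors on which the rotation acts through `ψ` are the multiples of the function `ψ`. -/
theorem isDihedralRep_smoothInd_restrict [CharP K 2] [IsAlgClosed K]
    (h : IsDihedralMod (centreU F D) θ w r)
    (hψ : ∀ u ∈ congrSubgroup F D 1, ψ u = 1) (hZ : centreU F D ≤ H)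
    (hH : ∀ b, b ∈ H ↔ (b : Dˣ ⧸ centreU F D) = 1 ∨ (b : Dˣ ⧸ centreU F D) = w) :
    IsDihedralRep (centreU F D) θ w ψ (smoothInd F D H (ψ.comp H.subtype)) := by
  refine (actsBy_smoothInd_restrict hZ).isDihedralRep_of_finrank_eq_one
    (finrank_eigenspace_smoothInd_restrict h hψ hZ hH rfl)
    (f := ⟨_, mem_smoothIndSpace_restrict hψ⟩) (fun h0 => ?_) fun g => ?_
  · exact (ψ 1).ne_zero (congrFun (congrArg Subtype.val h0) 1)
  · refine Subtype.ext (funext fun x => ?_)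
    change ((ψ (x * g) : Kˣ) : K) = ψ g * ψ x
    rw [map_mul, Units.val_mul, mul_comm]

end CharactersCharTwo

/-! ### Reduction of representations on which the rotation has equal eigenspaces -/

section Reduction

open Module Polynomial

variable {F : Type*} [Field F] [ValuativeRel F] [TopologicalSpace F] [IsNonarchimedeanLocalField F]
variable {D : Type*} [DivisionRing D] [Algebra F D]

/-- The central character of an induced representation is the restriction of the inducing
character. -/
theorem central_apply_of_equiv_smoothInd {K : Type*} [Field K] {V : Type*} [AddCommGroup V]
    [Module K V] [Nontrivial V] {ρ : Representation K Dˣ V} {H : Subgroup Dˣ} {χ : H →* Kˣ}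
    (f : ρ.Equiv (smoothInd F D H χ)) {Φ : Fˣ →* Kˣ} (hΦ : HasCentralChar F ρ Φ) (a : Fˣ)
    (ha : central F D a ∈ H) : Φ a = χ ⟨central F D a, ha⟩ := by
  obtain ⟨v, hv⟩ := exists_ne (0 : V)
  have h1 : smoothInd F D H χ (central F D a) (f.toLinearEquiv v) =
      (Φ a : K) • f.toLinearEquiv v := by
    rw [← map_smul, ← hΦ a v]
    exact (LinearMap.congr_fun (f.isIntertwining' (central F D a)) v).symm
  have h2 : f.toLinearEquiv v ≠ 0 := by simpa using hv
  generalize f.toLinearEquiv v = φ at h1 h2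
  obtain ⟨x, hx⟩ : ∃ x, (φ : Dˣ → K) x ≠ 0 := by
    by_contra! h0
    exact h2 (Subtype.ext (funext h0))
  refine Units.ext (mul_right_cancel₀ hx ?_)
  have h3 : (φ : Dˣ → K) (x * central F D a) = Φ a * (φ : Dˣ → K) x :=
    congrFun (congrArg Subtype.val h1) x
  rw [← h3, ← central_mul_comm]
  exact φ.2.1 ⟨_, ha⟩ x

variable [Algebra.IsCentral F D] [hD : Fact (Module.finrank F D = 4)]
variable {V : Type*} [AddCommGroup V] [Module (PadicAlgCl 2) V]
  [FiniteDimensional (PadicAlgCl 2) V] [Nontrivial V] {ρ : Representation (PadicAlgCl 2) Dˣ V}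

/-- The eigenspaces of the rotation on the reduction have the dimension of those on `ρ`, since the
characteristic polynomial `(X ^ r - c) ^ N` reduces to a polynomial of the same shape, and on the
composition factors of the reduction the group `U_D^1` acts trivially. -/
theorem isSemisimplification_reduction (hp : ringChar 𝓀[F] = 2) {θ w : Dˣ} {r : ℕ}
    (h : IsDihedralMod (centreU F D) θ w r) {M : ℕ} (hM1 : 1 ≤ M)
    (hM : ∀ u ∈ congrSubgroup F D M, ρ u = 1)
    {Φ : Fˣ →* (PadicAlgCl 2)ˣ} (hΦ : HasCentralChar F ρ Φ) {Φbar : Fˣ →* (FpBar 2)ˣ}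
    (hΦbar : IsReductionOfChar Φ Φbar) {a : Fˣ} {u : Dˣ} (hu : u ∈ congrSubgroup F D M)
    (hθ : θ ^ r = central F D a * u) {N : ℕ}
    (hd : ∀ l, l ^ r = (Φ a : PadicAlgCl 2) →
      finrank (PadicAlgCl 2) (End.eigenspace (ρ θ) l) = N)
    {ψ : Dˣ →* (FpBar 2)ˣ} (hψΦ : ψ.comp (central F D) = Φbar)
    (hψ : ∀ u ∈ congrSubgroup F D 1, ψ u = 1) {W : Type*} [AddCommGroup W] [Module (FpBar 2) W]
    [FiniteDimensional (FpBar 2) W] {τ : Representation (FpBar 2) Dˣ W}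
    (hτ : IsDihedralRep (centreU F D) θ w ψ τ)
    (hdτ : ∀ l, l ^ r = (ψ θ : FpBar 2) ^ r → finrank (FpBar 2) (End.eigenspace (τ θ) l) = N)
    (L : StableLattice 2 ρ) : IsSemisimplification L.reduction τ := by
  have hcent : HasCentralChar F L.reduction Φbar := by
    intro b x
    have hb : (Φ b : PadicAlgCl 2) ∈ ringOfInt 2 L.K :=
      L.mem_ringOfInt_of_smul_mem fun v hv => by
        rw [← hΦ b v]
        exact L.stable _ v hv
    rw [L.reduction_apply_of_smul (c := ⟨_, hb⟩) (hΦ b),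
      hΦbar.eq (g := b) (a := ⟨_, hb.1⟩) rfl]
    rfl
  have hMred (v : Dˣ) (hv : v ∈ congrSubgroup F D M) : L.reduction v = 1 := by
    refine LinearMap.ext fun x => ?_
    rw [L.reduction_apply_of_smul (c := 1) (fun y => by simp [hM v hv]), map_one, one_smul]
    rfl
  have hψθ : ψ θ ^ r = Φbar a := by
    rw [← map_pow, hθ, map_mul, hψ u (congrSubgroup_anti F D hM1 hu), mul_one, ← hψΦ]
    rfl
  have ht : (ρ θ) ^ r = algebraMap _ _ (Φ a : PadicAlgCl 2) := by
    ext v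
    rw [← map_pow, hθ, map_mul, hM u hu, mul_one, hΦ a v, Module.algebraMap_end_apply]
  have htr (v) : L.reduction (θ ^ r) v = (ψ θ : FpBar 2) ^ r • v := by
    rw [hθ, map_mul, hMred u hu, mul_one, hcent a v, ← hψθ, Units.val_pow_eq_pow_val]
  have hred : (L.reduction θ) ^ r = algebraMap _ _ ((ψ θ : FpBar 2) ^ r) := by
    refine LinearMap.ext fun v => ?_
    rw [← map_pow, htr, Module.algebraMap_end_apply]
  have ha : (Φ a : PadicAlgCl 2) ∈ ringOfInt 2 L.K :=
    L.mem_ringOfInt_of_smul_mem fun v hv => by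
      rw [← hΦ a v]
      exact L.stable _ v hv
  have hchar : (L.reduction θ).charpoly = (X ^ r - C ((ψ θ : FpBar 2) ^ r)) ^ N := by
    rw [L.charpoly_reduction θ (P := (X ^ r - C ⟨_, ha⟩) ^ N)]
    · rw [Polynomial.map_pow, Polynomial.map_sub, Polynomial.map_pow, map_X, map_C,
        ← Units.val_pow_eq_pow_val, hψθ, hΦbar.eq (g := a) (a := ⟨_, ha.1⟩) rfl]
      rfl
    · rw [Polynomial.map_pow, Polynomial.map_sub, Polynomial.map_pow, map_X, map_C]
      exact (charpoly_eq_pow (by exact_mod_cast h.odd.pos.ne') (Φ a).ne_zero ht N hd).symm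
  refine isSemisimplification_of_finrank_eigenspace h (fun Q _ _ _ σ hσ hg => ?_) htr hτ
    fun l hl => ?_
  · refine isDihedralRep_of_isIrreducible hp h hσ (M := M) (fun v hv => ?_) hψ fun b x => ?_
    · refine LinearMap.ext fun x => ?_
      rw [hg v 1 (fun y => by rw [hMred v hv, one_smul]; rfl), one_smul]
      rfl
    · rw [hψΦ]
      exact hg _ _ (hcent b) x
  · rw [hdτ l hl]
    exact finrank_eigenspace_of_charpoly (cast_ne_zero_of_odd h.odd)
      (pow_ne_zero _ (ψ θ).ne_zero) hred hchar hl

end Reduction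

/-! ### The characters and representations over `𝔽̄_2` -/

section Final

open Module

theorem IsReductionOfChar.eq_one {G : Type*} [Group G] {p : ℕ} [Fact p.Prime]
    {ξ : G →* (PadicAlgCl p)ˣ} {ξbar : G →* (FpBar p)ˣ} (h : IsReductionOfChar ξ ξbar) {g : G}
    (hg : ξ g = 1) : ξbar g = 1 := by
  rw [h.apply_eq_of_eq h (hg.trans (map_one ξ).symm), map_one]

variable {F : Type*} [Field F] [ValuativeRel F] [TopologicalSpace F] [IsNonarchimedeanLocalField F]
variable {D : Type*} [DivisionRing D] [Algebra F D]
variable {E : Type*} [Field E] [Algebra F E] {ι : E →ₐ[F] D}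

theorem centreU_le_EU_one : centreU F D ≤ EU F D ι 1 := by
  refine sup_le ?_ le_sup_right
  rintro _ ⟨a, rfl⟩
  exact central_mem F D ι 1 a

/-- The eigenspaces of the rotation on a representation induced from a subgroup with image in
`{1, w}` all have the same dimension. -/
theorem finrank_eigenspace_of_equiv_smoothInd {θ w : Dˣ} {r : ℕ}
    (hdi : IsDihedralMod (centreU F D) θ w r) {K : Type*} [Field K] [IsAlgClosed K]
    (hr : (r : K) ≠ 0) {H : Subgroup Dˣ}
    (hH : ∀ b ∈ H, (b : Dˣ ⧸ centreU F D) = 1 ∨ (b : Dˣ ⧸ centreU F D) = w) {χ : H →* Kˣ} {M : ℕ}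
    (hM : ∀ u ∈ congrSubgroup F D M, ∃ hu : u ∈ H, χ ⟨u, hu⟩ = 1) {N : ℕ} (hN : N ≠ 0)
    (hi : H.index = r * N) {V : Type*} [AddCommGroup V] [Module K V] {ρ : Representation K Dˣ V}
    (f : ρ.Equiv (smoothInd F D H χ)) {c : K} (hc : c ≠ 0) (hρ : ∀ v, ρ (θ ^ r) v = c • v) {l : K}
    (hl : l ^ r = c) : finrank K (End.eigenspace (ρ θ) l) = N := by
  have hf (g : Dˣ) (v : V) : f.toLinearEquiv (ρ g v) = smoothInd F D H χ g (f.toLinearEquiv v) :=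
    LinearMap.congr_fun (f.isIntertwining' g) v
  rw [finrank_eigenspace_congr f.toLinearEquiv (hf θ)]
  refine finrank_eigenspace_smoothInd hdi hr hH ⟨1, congrSubgroup_le_centreU le_rfl⟩ hM hN hi
    hc (LinearMap.ext fun φ => ?_) hl
  obtain ⟨v, rfl⟩ := f.toLinearEquiv.surjective φ
  rw [← map_pow, ← hf, hρ, map_smul, Module.algebraMap_end_apply]

theorem eq_one_of_equiv_smoothInd {K : Type*} [Field K] {H : Subgroup Dˣ} {χ : H →* Kˣ} {M : ℕ}
    (hM : ∀ u ∈ congrSubgroup F D M, ∃ hu : u ∈ H, χ ⟨u, hu⟩ = 1)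
    {V : Type*} [AddCommGroup V] [Module K V] {ρ : Representation K Dˣ V}
    (f : ρ.Equiv (smoothInd F D H χ)) {u : Dˣ} (hu : u ∈ congrSubgroup F D M) : ρ u = 1 := by
  refine LinearMap.ext fun v => f.toLinearEquiv.injective ?_
  have h1 := LinearMap.congr_fun (f.isIntertwining' u) v
  exact h1.trans (smoothInd_apply_of_mem_congrSubgroup hM hu _)

/-- Characters in characteristic two that are trivial on `U_D^1` are determined by their restriction
to the centre. -/
theorem eq_of_comp_central_eq {K : Type*} [Field K] [CharP K 2] {ψ ψ' : Dˣ →* Kˣ} {θ w : Dˣ} {r : ℕ}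
    (hdi : IsDihedralMod (centreU F D) θ w r)
    (hψ : ∀ u ∈ congrSubgroup F D 1, ψ u = 1) (hψ' : ∀ u ∈ congrSubgroup F D 1, ψ' u = 1)
    (h : ψ.comp (central F D) = ψ'.comp (central F D)) : ψ = ψ' := by
  refine eq_of_eqOn_of_isDihedralMod hdi fun z hz => ?_
  obtain ⟨b, v, hv, rfl⟩ := (mem_centreU_iff _).1 hz
  rw [map_mul, map_mul, hψ v hv, hψ' v hv]
  exact congrArg (· * 1) (DFunLike.congr_fun h b)

variable [Algebra.IsCentral F D] [hD : Fact (finrank F D = 4)]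

theorem mem_EU_one_iff (hE : finrank F E = 2) {w₀ : E} {w : Dˣ} (hw₀ : (w : D) = ι w₀)
    (hw : vD F D w = WithZero.exp (-1)) (h : Dˣ) :
    h ∈ EU F D ι 1 ↔ (h : Dˣ ⧸ centreU F D) = 1 ∨ (h : Dˣ ⧸ centreU F D) = w := by
  refine ⟨EU_eq_or E hE ι w₀ w hw₀ hw le_rfl h, ?_⟩
  have hwE : w ∈ EU F D ι 1 := by
    have hw0 : w₀ ≠ 0 := by
      rintro rfl
      exact w.ne_zero (by rw [hw₀, map_zero])
    exact Subgroup.mem_sup_left ⟨Units.mk0 w₀ hw0, Units.ext hw₀.symm⟩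
  rintro (h1 | h1)
  · exact centreU_le_EU_one ((QuotientGroup.eq_one_iff h).1 h1)
  · have h2 := centreU_le_EU_one (ι := ι) (QuotientGroup.eq.1 h1.symm)
    simpa using mul_mem hwE h2

section CharTwo

variable {K : Type} [Field K] [CharP K 2] {ψ : Dˣ →* Kˣ} {θ w : Dˣ} {r : ℕ} {H : Subgroup Dˣ}

theorem eq_restrict_of_central_eq (hp : ringChar 𝓀[F] = 2) (hH : ∀ h ∈ H, h * h ∈ centreU F D)
    (hcH : ∀ a : Fˣ, central F D a ∈ H) {χ : H →* Kˣ} (hχ : IsSmoothChar F D H χ)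
    (hψ : ∀ u ∈ congrSubgroup F D 1, ψ u = 1)
    (h : ∀ a : Fˣ, ψ (central F D a) = χ ⟨central F D a, hcH a⟩) : ψ.comp H.subtype = χ := by
  refine eq_of_eqOn_of_sq_mem hH fun g hg => ?_
  obtain ⟨b, v, hv, hbv⟩ := (mem_centreU_iff _).1 hg
  let z : H := ⟨central F D b, hcH b⟩
  have h1 : ((z⁻¹ * g : H) : Dˣ) = v := by
    change (central F D b)⁻¹ * g = v
    rw [hbv, inv_mul_cancel_left]
  have h3 := eq_one_of_mem_congrSubgroup_one hp hχ (z⁻¹ * g) (by rwa [h1])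
  rw [map_mul, map_inv, inv_mul_eq_one] at h3
  rw [← h3, ← h, MonoidHom.comp_apply, Subgroup.subtype_apply, hbv, map_mul, hψ v hv, mul_one]

variable [IsAlgClosed K]

/-- The representation induced from the restriction of `ψ` is the direct sum of `ψ` and of the
two-dimensional irreducible representations with the same central character. -/
theorem exists_isSystemOfTwoDimReps (hp : ringChar 𝓀[F] = 2)
    (hdi : IsDihedralMod (centreU F D) θ w r) (hψ : ∀ u ∈ congrSubgroup F D 1, ψ u = 1)
    (hZ : centreU F D ≤ H)
    (hH : ∀ b, b ∈ H ↔ (b : Dˣ ⧸ centreU F D) = 1 ∨ (b : Dˣ ⧸ centreU F D) = w) (N : ℕ) :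
    ∃ (m : ℕ) (π : Fin m → Representation K Dˣ (Fin 2 → K)),
      IsSystemOfTwoDimReps F (ψ.comp (central F D)) π ∧
      Nonempty ((copies N (smoothInd F D H (ψ.comp H.subtype))).Equiv
        ((Representation.directSum fun i : Fin m => copies N (π i)).prod
          (copies N (charRep ψ)))) := by
  have hInd := isDihedralRep_smoothInd_restrict hdi hψ hZ hH
  have hdInd (l : K) (hl : l ^ r = (ψ θ : K) ^ r) :=
    finrank_eigenspace_smoothInd_restrict hdi hψ hZ hH hl
  have hfd := finiteDimensional_smoothInd (exists_trivial_restrict hψ hZ)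
    (by rw [hdi.index_eq H hH]; exact hdi.odd.pos.ne')
  obtain ⟨m, π, hπ, hπirr, hπinj, hπex, hπd⟩ := exists_system_two_dimensional hdi hInd hdInd
  refine ⟨m, π, ⟨fun i v => ⟨1, fun g hg => ?_⟩, hπirr, fun i b => ?_, hπinj, ?_⟩, ?_⟩
  · rw [(hπ i).central g (congrSubgroup_le_centreU le_rfl hg), hψ g hg, Units.val_one, one_smul]
  · exact (hπ i).central _ (central_mem_centreU b)
  · intro W _ _ τ hW hτ hτirr hτc
    have : FiniteDimensional K W := .of_finrank_pos (by omega)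
    obtain ⟨m', hm'⟩ := hτ.exists_trivial
    exact hπex W τ hW (isDihedralRep_of_isIrreducible hp hdi hτirr hm' hψ hτc) hτirr
  · refine nonempty_equiv_of_finrank_eigenspace hdi (.directSum fun _ => hInd)
      (.prod (.directSum fun i => .directSum fun _ => hπ i)
        (.directSum fun _ => isDihedralRep_charRep (ψ := ψ))) fun l hl => ?_
    have h1 : finrank K (End.eigenspace
        (Representation.directSum (fun i : Fin m => copies N (π i)) θ) l) =
        N * ∑ i, finrank K (End.eigenspace (π i θ) l) := by
      rw [finrank_eigenspace_directSum (fun i => copies N (π i) θ) _ (directSum_apply _ θ) l,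
        Finset.mul_sum]
      exact Finset.sum_congr rfl fun i _ => finrank_eigenspace_copies N (π i) θ l
    rw [finrank_eigenspace_copies, hdInd l hl]
    refine Eq.symm ((finrank_eigenspace_prod l).trans ?_)
    rw [h1, finrank_eigenspace_copies, ← mul_add, hπd l hl]

end CharTwo

end Final

end QuatRed

end

theorem mainTheorem8
    {F : Type*} [Field F] [ValuativeRel F] [TopologicalSpace F] [IsNonarchimedeanLocalField F]
    (hp : ringChar 𝓀[F] = 2)
    {D : Type*} [DivisionRing D] [Algebra F D] [Algebra.IsCentral F D]
    (hD : Module.finrank F D = 4)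
    {E : Type*} [Field E] [Algebra F E] (hE : QuatRed.IsTotallyRamifiedQuadratic F E)
    (ι : E →ₐ[F] D)
    (n : ℕ) (hn : Odd n)
    (χ : QuatRed.EU F D ι ((n + 1) / 2) →* (PadicAlgCl 2)ˣ)
    (hχ : QuatRed.IsSmoothChar F D _ χ)
    {V : Type*} [AddCommGroup V] [Module (PadicAlgCl 2) V]
    (Pi : Representation (PadicAlgCl 2) Dˣ V)
    (hPi : Nonempty (Pi.Equiv (QuatRed.smoothInd F D _ χ)))
    (hirr : Pi.IsIrreducible)
    (hdim : 1 < Module.finrank (PadicAlgCl 2) V)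
    (hwild : ¬ QuatRed.IsTamelyRamifiedRep F Pi)
    (Φ : Fˣ →* (PadicAlgCl 2)ˣ) (hΦ : QuatRed.HasCentralChar F Pi Φ) :
    ((QuatRed.IsPIntegral 2 Pi ↔ QuatRed.IsPIntegral 2 (QuatRed.charRep Φ)) ∧
      (QuatRed.IsPIntegral 2 Pi ↔ QuatRed.IsPIntegral 2 (QuatRed.charRep χ))) ∧
    (QuatRed.IsPIntegral 2 Pi →
      -- the reductions of `χ` and `Φ`
      ∃ (χbar : QuatRed.EU F D ι ((n + 1) / 2) →* (QuatRed.FpBar 2)ˣ)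
        (Φbar : Fˣ →* (QuatRed.FpBar 2)ˣ),
        QuatRed.IsReductionOfChar χ χbar ∧ QuatRed.IsReductionOfChar Φ Φbar ∧
        Φbar = χbar.comp (QuatRed.centralEU F D ι ((n + 1) / 2)) ∧
      -- the extension `χdd` of `χbar` to `E^× U_D^1` that is trivial on `U_D^1`
      ∃ χdd : QuatRed.EU F D ι 1 →* (QuatRed.FpBar 2)ˣ,
        χdd.comp (Subgroup.inclusion (QuatRed.EU_anti F D ι
          (QuatRed.one_le_half_succ hn))) = χbar ∧
        (∀ h : QuatRed.EU F D ι 1, (h : Dˣ) ∈ QuatRed.congrSubgroup F D 1 → χdd h = 1) ∧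
      -- the unique character `χt` of `D^×` extending `Φbar`, equivalently extending `χdd`
      ∃ χt : Dˣ →* (QuatRed.FpBar 2)ˣ,
        QuatRed.IsSmoothRep F (QuatRed.charRep χt) ∧
        (∀ ψ : Dˣ →* (QuatRed.FpBar 2)ˣ, QuatRed.IsSmoothRep F (QuatRed.charRep ψ) →
          ((ψ.comp (QuatRed.central F D) = Φbar ↔ ψ = χt) ∧
            (ψ.comp (QuatRed.EU F D ι 1).subtype = χdd ↔ ψ = χt))) ∧
      -- the two-dimensional irreducible representations with central character `Φbar`
      ∃ (m : ℕ) (π : Fin m → Representation (QuatRed.FpBar 2) Dˣ (Fin 2 → QuatRed.FpBar 2)),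
        QuatRed.IsSystemOfTwoDimReps F Φbar π ∧
      -- the reduction
        (∀ L : QuatRed.StableLattice 2 Pi,
          QuatRed.IsSemisimplification L.reduction
            (QuatRed.copies (Nat.card 𝓀[F] ^ ((n - 1) / 2))
              (QuatRed.smoothInd F D (QuatRed.EU F D ι 1) χdd))) ∧
        Nonempty
          ((QuatRed.copies (Nat.card 𝓀[F] ^ ((n - 1) / 2))
              (QuatRed.smoothInd F D (QuatRed.EU F D ι 1) χdd)).Equiv
            ((Representation.directSum fun i : Fin m =>
                QuatRed.copies (Nat.card 𝓀[F] ^ ((n - 1) / 2)) (π i)).prod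
              (QuatRed.copies (Nat.card 𝓀[F] ^ ((n - 1) / 2)) (QuatRed.charRep χt))))) := by
  open QuatRed Module in
  have hD' : Fact (finrank F D = 4) := ⟨hD⟩
  have hV : FiniteDimensional (PadicAlgCl 2) V := .of_finrank_pos (by omega)
  have hnt : Nontrivial V := nontrivial_of_finrank_pos (R := PadicAlgCl 2) (by omega)
  obtain ⟨f⟩ := hPi
  have hk : (n + 1) / 2 = (n - 1) / 2 + 1 := by
    obtain ⟨j, rfl⟩ := hn
    omega
  have hk1 := one_le_half_succ hn
  -- a uniformizer of `E` is the reflection, a unit that generates the residue field of `D` the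
  -- rotation
  obtain ⟨w₀, hw⟩ := exists_uniformizer ι hE
  have hw0 : w₀ ≠ 0 := by
    rintro rfl
    rw [map_zero, map_zero] at hw
    exact WithZero.exp_ne_zero hw.symm
  let w : Dˣ := Units.map (ι : E →* D) (Units.mk0 w₀ hw0)
  have hwk : w ∈ EU F D ι ((n + 1) / 2) := Subgroup.mem_sup_left ⟨_, rfl⟩
  obtain ⟨x, hx1, hx2⟩ := exists_residue_generator ι hw
  have hx : IsResidueGenerator F x := ⟨hx1, hx2⟩
  obtain ⟨θ₀, hdi₀⟩ := exists_isDihedralMod hp hx w hw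
  obtain ⟨m₀, hm₀⟩ := hχ
  obtain ⟨M, hM1, hM⟩ : ∃ M, 1 ≤ M ∧ ∀ u ∈ congrSubgroup F D M,
      ∃ hu : u ∈ EU F D ι ((n + 1) / 2), χ ⟨u, hu⟩ = 1 :=
    ⟨max m₀ ((n + 1) / 2), le_max_of_le_right hk1, fun u hu =>
      ⟨Subgroup.mem_sup_right (congrSubgroup_anti F D (le_max_right _ _) hu),
        hm₀ _ (congrSubgroup_anti F D (le_max_left _ _) hu)⟩⟩
  obtain ⟨θ, hdi, a, u, hu, hθ⟩ := hdi₀.exists_pow_eq hp M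
  have hN0 : Nat.card 𝓀[F] ^ ((n - 1) / 2) ≠ 0 := pow_ne_zero _ Nat.card_pos.ne'
  have hH1 := mem_EU_one_iff (ι := ι) hE.1 (w := w) rfl hw
  have hHk := EU_eq_or E hE.1 ι w₀ w rfl hw hk1
  have hik : (EU F D ι ((n + 1) / 2)).index =
      (Nat.card 𝓀[F] + 1) * Nat.card 𝓀[F] ^ ((n - 1) / 2) := by
    rw [← Subgroup.relIndex_mul_index (EU_anti F D ι hk1), hdi.index_eq _ hH1, hk,
      relIndex_EU hE.1 ι w₀ hw hx, mul_comm]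
  have hΦχ (b : Fˣ) := central_apply_of_equiv_smoothInd f hΦ b (central_mem F D ι _ b)
  have hMPi (v : Dˣ) (hv : v ∈ congrSubgroup F D M) := eq_one_of_equiv_smoothInd hM f hv
  have hr : ((Nat.card 𝓀[F] + 1 : ℕ) : PadicAlgCl 2) ≠ 0 := Nat.cast_ne_zero.2 (Nat.succ_ne_zero _)
  have hd (l : PadicAlgCl 2) (hl : l ^ (Nat.card 𝓀[F] + 1) = Φ a) :
      finrank (PadicAlgCl 2) (End.eigenspace (Pi θ) l) = Nat.card 𝓀[F] ^ ((n - 1) / 2) :=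
    finrank_eigenspace_of_equiv_smoothInd hdi hr hHk hM hN0 hik f (Φ a).ne_zero (fun v => by
      rw [hθ, map_mul, hMPi u hu, mul_one, hΦ a v]) hl
  have hintΦ := isPIntegral_centralChar (ρ := Pi) hΦ
  have hintχ := isPIntegral_char_of_central hp hdi hHk hwk (central_mem F D ι _) ⟨m₀, hm₀⟩ hΦχ
  have hintInd := isPIntegral_of_equiv_smoothInd hM
    (by rw [hik]; exact mul_ne_zero (Nat.succ_ne_zero _) hN0) f
  refine ⟨⟨⟨hintΦ, fun h => hintInd (hintχ h)⟩, fun h => hintχ (hintΦ h), hintInd⟩, fun hint => ?_⟩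
  obtain ⟨K, -, hK⟩ := isPIntegral_charRep_iff.1 (hintχ (hintΦ hint))
  obtain ⟨K', -, hK'⟩ := isPIntegral_charRep_iff.1 (hintΦ hint)
  obtain ⟨χbar, hχbar⟩ := exists_isReductionOfChar fun g => (hK g).1
  obtain ⟨Φbar, hΦbar⟩ := exists_isReductionOfChar fun g => (hK' g).1
  have hΦχbar (b : Fˣ) : Φbar b = χbar (centralEU F D ι _ b) := hΦbar.apply_eq_of_eq hχbar (hΦχ b)
  obtain ⟨χt, hχtΦ, hχt⟩ := exists_extension_central (D := D) hp (M := M) (Φ := Φbar)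
    fun b hb => by
      obtain ⟨_, h1⟩ := hM _ hb
      exact hΦbar.eq_one ((hΦχ b).trans h1)
  obtain ⟨m, π, hπ, hπe⟩ := exists_isSystemOfTwoDimReps hp hdi hχt centreU_le_EU_one hH1
    (Nat.card 𝓀[F] ^ ((n - 1) / 2))
  have hfd := finiteDimensional_smoothInd (exists_trivial_restrict hχt
    (centreU_le_EU_one (ι := ι))) (by rw [hdi.index_eq _ hH1]; exact Nat.succ_ne_zero _)
  refine ⟨χbar, Φbar, hχbar, hΦbar, MonoidHom.ext hΦχbar, χt.comp (EU F D ι 1).subtype, ?_,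
    fun h hh => hχt h hh, χt, fun c => ⟨1, fun v hv => ?_⟩, fun ψ hψ => ?_, m, π, hχtΦ ▸ hπ,
    fun L => ?_, hπe⟩
  · have hres : χt.comp (EU F D ι ((n + 1) / 2)).subtype = χbar := by
      refine eq_restrict_of_central_eq hp (fun h hh => ?_) (central_mem F D ι _)
        ⟨m₀, fun h hh => hχbar.eq_one (hm₀ h hh)⟩ hχt fun b => ?_
      · rw [← QuotientGroup.eq_one_iff, QuotientGroup.mk_mul]
        rcases hHk h hh with h1 | h1
        · rw [h1, one_mul]
        · rw [h1, hdi.w_mul_w]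
      · exact (DFunLike.congr_fun hχtΦ b).trans (hΦχbar b)
    rw [← hres, MonoidHom.comp_assoc, Subgroup.subtype_comp_inclusion]
  · change (χt v : FpBar 2) * c = c
    rw [hχt v hv, Units.val_one, one_mul]
  · have huniq (hψΦ : ψ.comp (central F D) = Φbar) : ψ = χt :=
      eq_of_comp_central_eq hdi (eq_one_of_isSmoothRep_charRep hp hψ) hχt (hψΦ.trans hχtΦ.symm)
    refine ⟨⟨huniq, fun h => by rw [h, hχtΦ]⟩, fun h => huniq ?_, fun h => by rw [h]⟩
    rw [← hχtΦ]
    exact MonoidHom.ext fun b => DFunLike.congr_fun h (centralEU F D ι 1 b)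
  · exact isSemisimplification_reduction hp hdi hM1 hMPi hΦ hΦbar hu hθ hd hχtΦ hχt
      (.directSum fun _ => isDihedralRep_smoothInd_restrict hdi hχt centreU_le_EU_one hH1)
      (fun l hl => by
        rw [finrank_eigenspace_copies,
          finrank_eigenspace_smoothInd_restrict hdi hχt centreU_le_EU_one hH1 hl, mul_one]) L
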